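/- \textbf{Vocabularies.} Planes are two-sorted structures (points and lines). $L_\parallel$ has incidence and a binary relation $\parallel$ on lines; $L_\perp$ has incidence and a binary relation $\perp$ on lines. In $L_\perp$ we write $\ell\parallel k$ if the lines $\ell,k$ are equal or have no common point. The \emph{complex affine plane} has point set $\mathbb C^2$ and as lines the solution sets of linear equations $ax+by+c=0$ with $(a,b)\neq(0,0)$. In $L_\parallel$, $\parallel$ means equal or disjoint. In $L_\perp$, $\ell\perp k$ means $(q_1-p_1)(s_1-r_1)+(q_2-p_2)(s_2-r_2)=0$ for all $p,q\in\ell$ and $r,s\in k$. \textbf{Incidence axioms.} Two distinct points lie on exactly one line; every line has at least two points; there are three non-collinear points. \textbf{Pappian parallelity planes} (in $L_\parallel$): the incidence axioms; $\parallel$ is an equivalence relation on lines; lines that are not parallel meet; through every point there is exactly one parallel to a given line; and Pappus: if $A_1,A_2,A_3$ lie on a line $\ell$ and $B_1,B_2,B_3$ lie on a line $k\ne\ell$, all six points being distinct, then $A_1B_2\parallel A_2B_1$ and $A_2B_3\parallel A_3B_2$ imply $A_1B_3\parallel A_3B_1$. \textbf{Wu-orthogonal planes} (in $L_\perp$): the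 incidence axioms; every line is infinite (a scheme of axioms); through every point there is exactly one parallel to a given line; the orthogonality axioms (O-1) $\ell_1\perp\ell_2\leftrightarrow\ell_2\perp\ell_1$; (O-2) for every point $O$ and line $\ell_1$ there is exactly one line $\ell_2$ through $O$ with $\ell_1\perp\ell_2$; (O-3) $\ell_1\perp\ell_2$ and $\ell_1\perp\ell_3$ imply $\ell_2\parallel\ell_3$; (O-4) through every point there is a line $\ell$ with $\ell\not\perp\ell$; (O-5) the three heights of a triangle have a common point; and two forms of Desargues: if $a,b,c$ are three distinct lines which (first form) are pairwise parallel or (second form) pass through a common point $O$, and $A,A'\in a$, $B,B'\in b$, $C,C'\in c$ (all different from $O$ in the second form), then $AB\parallel A'B'$ and $AC\parallel A'C'$ imply $BC\parallel B'C'$. \textbf{Translation.} Given non-collinear points $O,E,E'$, interpret the language of rings on the set of points of the line $OE$ as follows. Zero is $O$ and one is $E$. We have $a+b=c$ iff $Pc\parallel E'b$, where $P$ is the intersection of the parallel to $OE$ through $E'$ and the parallel to $OE'$ through $a$. We have $ab=c$ iff $Qc\parallel E'a$, where $Q$ is the intersection of $OE'$ and the parallel to $EE'$ through $b$. (Here $XY\parallel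 ZW$ means that some line through $X,Y$ is parallel to some line through $Z,W$.) For a first-order sentence $\sigma$ in the language of rings let $\sigma^*$ be the geometric sentence ``for all non-collinear $O,E,E'$, the structure interpreted on $OE$ satisfies $\sigma$''. \textbf{Theorem.} Let $\mathrm{ACF}_0$ be the usual axioms of algebraically closed fields of characteristic $0$, and $\mathrm{ACF}_0^*=\{\sigma^*:\sigma\in \mathrm{ACF}_0\}$. (i) An $L_\parallel$-sentence is true in the complex affine plane if and only if it is a consequence of the axioms of Pappian parallelity planes together with $\mathrm{ACF}_0^*$. (ii) An $L_\perp$-sentence is true in the complex affine plane with $\perp$ if and only if it is a consequence of the axioms of Wu-orthogonal planes together with $\mathrm{ACF}_0^*$. -/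

import Mathlib

open FirstOrder FirstOrder.Language

namespace AffineGeometry

/-! ### Vocabularies

Points and lines are two sorts. A two-sorted structure is coded, as usual, as a one-sorted one
whose universe is the disjoint union of the sorts, with a predicate for each sort. -/

/-- Basic symbols of parallelity planes: being a point, being a line, incidence of a point with a
line, parallelism of lines. -/
inductive ParRel : ℕ → Type
  | point : ParRel 1
  | line : ParRel 1
  | inc : ParRel 2
  | par : ParRel 2

/-- The vocabulary of parallelity planes. -/
abbrev parLang : FirstOrder.Language.{0, 0} := ⟨fun _ => Empty, ParRel⟩

/-- Basic symbols of orthogonal planes: being a point, being a line, incidence of a point with a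
line, orthogonality of lines. -/
inductive OrthRel : ℕ → Type
  | point : OrthRel 1
  | line : OrthRel 1
  | inc : OrthRel 2
  | perp : OrthRel 2

/-- The vocabulary of orthogonal planes. -/
abbrev orthLang : FirstOrder.Language.{0, 0} := ⟨fun _ => Empty, OrthRel⟩

/-- A plane vocabulary: symbols for points, lines and incidence, and a (basic or defined) formula
for parallelism. Variables are numbered: a formula in `L.BoundedFormula Empty m` has its variables
in `Fin m`, and a quantifier binds the variable with the last number. -/
class PlaneVocabulary (L : FirstOrder.Language.{0, 0}) where
  point : L.Relations 1
  line : L.Relations 1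
  inc : L.Relations 2
  par : ∀ {m : ℕ}, Fin m → Fin m → L.BoundedFormula Empty m

section Formulas

variable {L : FirstOrder.Language.{0, 0}} {m : ℕ}

/-- `x = y` -/
def eqF (x y : Fin m) : L.BoundedFormula Empty m := (&x) =' &y

/-- the `v i` are pairwise distinct -/
noncomputable def distinctF {k : ℕ} (v : Fin k → Fin m) : L.BoundedFormula Empty m :=
  BoundedFormula.iInf fun p : {p : Fin k × Fin k // p.1 < p.2} => ∼(eqF (v p.1.1) (v p.1.2))

variable [PlaneVocabulary L]

/-- `x` is a point -/
def pt (x : Fin m) : L.BoundedFormula Empty m :=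
  Relations.boundedFormula₁ (PlaneVocabulary.point : L.Relations 1) &x

/-- `l` is a line -/
def ln (l : Fin m) : L.BoundedFormula Empty m :=
  Relations.boundedFormula₁ (PlaneVocabulary.line : L.Relations 1) &l

/-- the point `x` is on the line `l` -/
def on (x l : Fin m) : L.BoundedFormula Empty m :=
  Relations.boundedFormula₂ (PlaneVocabulary.inc : L.Relations 2) (&x) &l

/-- the lines `l` and `k` are parallel -/
def par (l k : Fin m) : L.BoundedFormula Empty m := PlaneVocabulary.par l k

/-- `x`, `y`, `z` are on a common line -/
def coll (x y z : Fin m) : L.BoundedFormula Empty m :=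
  ∃' (on x.castSucc (Fin.last m) ⊓ on y.castSucc (Fin.last m) ⊓ on z.castSucc (Fin.last m))

/-- some line through `x`, `y` is parallel to some line through `z`, `w`; when `x ≠ y` and `z ≠ w`
this says `xy ∥ zw` -/
def joinPar (x y z w : Fin m) : L.BoundedFormula Empty m :=
  ∃' ∃' (on x.castSucc.castSucc (Fin.last m).castSucc ⊓
    on y.castSucc.castSucc (Fin.last m).castSucc ⊓
    on z.castSucc.castSucc (Fin.last (m + 1)) ⊓ on w.castSucc.castSucc (Fin.last (m + 1)) ⊓
    par (Fin.last m).castSucc (Fin.last (m + 1)))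

end Formulas

/-- In parallelity planes parallelism is a basic symbol. -/
instance : PlaneVocabulary parLang where
  point := ParRel.point
  line := ParRel.line
  inc := ParRel.inc
  par l k := Relations.boundedFormula₂ (L := parLang) ParRel.par (&l) &k

/-- In orthogonal planes two lines are called parallel if they are equal or have no point in
common. -/
instance : PlaneVocabulary orthLang where
  point := OrthRel.point
  line := OrthRel.line
  inc := OrthRel.inc
  par {m} l k :=
    Relations.boundedFormula₁ (L := orthLang) OrthRel.line (&l) ⊓
    Relations.boundedFormula₁ (L := orthLang) OrthRel.line (&k) ⊓
    (eqF l k ⊔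
      ∼(∃' (Relations.boundedFormula₂ (L := orthLang) OrthRel.inc (&(Fin.last m)) (&l.castSucc) ⊓
        Relations.boundedFormula₂ (L := orthLang) OrthRel.inc (&(Fin.last m)) (&k.castSucc))))

/-- the lines `l` and `k` are orthogonal -/
def perp {m : ℕ} (l k : Fin m) : orthLang.BoundedFormula Empty m :=
  Relations.boundedFormula₂ (L := orthLang) OrthRel.perp (&l) &k

/-! ### Axioms

`φ.alls` is the universal closure of `φ`. In the axioms below the variables are numbers. -/

section Axioms

variable (L : FirstOrder.Language.{0, 0}) [PlaneVocabulary L]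

/-- The incidence axioms of planes. -/
def incidenceAxioms : L.Theory :=
  { -- every object is a point or a line, not both; incidence holds between points and lines
    BoundedFormula.alls (n := 1) (pt 0 ⊔ ln 0),
    BoundedFormula.alls (n := 1) (∼(pt 0 ⊓ ln 0)),
    BoundedFormula.alls (n := 2) (on 0 1 ⟹ pt 0 ⊓ ln 1),
    -- two distinct points are on exactly one line
    BoundedFormula.alls (n := 2) (pt 0 ⊓ pt 1 ⊓ ∼(eqF 0 1) ⟹ ∃' (on 0 2 ⊓ on 1 2)),
    BoundedFormula.alls (n := 4)
      (∼(eqF 0 1) ⊓ on 0 2 ⊓ on 1 2 ⊓ on 0 3 ⊓ on 1 3 ⟹ eqF 2 3),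
    -- every line has at least two points
    BoundedFormula.alls (n := 1) (ln 0 ⟹ ∃' ∃' (∼(eqF 1 2) ⊓ on 1 0 ⊓ on 2 0)),
    -- there are three non-collinear points
    ∃' ∃' ∃' (pt 0 ⊓ pt 1 ⊓ pt 2 ⊓ ∼(coll 0 1 2)) }

/-- Through every point there is exactly one parallel to a given line. -/
def uniqueParallelAxioms : L.Theory :=
  { BoundedFormula.alls (n := 2) (pt 0 ⊓ ln 1 ⟹ ∃' (on 0 2 ⊓ par 2 1)),
    BoundedFormula.alls (n := 4) (on 0 2 ⊓ on 0 3 ⊓ par 2 1 ⊓ par 3 1 ⟹ eqF 2 3) }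

/-- Parallelism is an equivalence relation on lines, and lines that are not parallel meet. -/
def parallelismAxioms : L.Theory :=
  { BoundedFormula.alls (n := 2) (par 0 1 ⟹ ln 0 ⊓ ln 1),
    BoundedFormula.alls (n := 1) (ln 0 ⟹ par 0 0),
    BoundedFormula.alls (n := 2) (par 0 1 ⟹ par 1 0),
    BoundedFormula.alls (n := 3) (par 0 1 ⊓ par 1 2 ⟹ par 0 2),
    BoundedFormula.alls (n := 2) (ln 0 ⊓ ln 1 ⊓ ∼(par 0 1) ⟹ ∃' (on 2 0 ⊓ on 2 1)) }

/-- Pappus: if `A₁, A₂, A₃` (numbers 0, 1, 2) are on the line `l` (number 6) and `B₁, B₂, B₃`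
(numbers 3, 4, 5) are on another line `k` (number 7), all six points being distinct, then
`A₁B₂ ∥ A₂B₁` and `A₂B₃ ∥ A₃B₂` imply `A₁B₃ ∥ A₃B₁`. -/
noncomputable def pappusAxiom : L.Sentence :=
  BoundedFormula.alls (n := 8)
    (distinctF ![0, 1, 2, 3, 4, 5] ⊓ ∼(eqF 6 7) ⊓
      on 0 6 ⊓ on 1 6 ⊓ on 2 6 ⊓ on 3 7 ⊓ on 4 7 ⊓ on 5 7 ⊓
      joinPar 0 4 1 3 ⊓ joinPar 1 5 2 4 ⟹ joinPar 0 5 2 3)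

/-- Desargues, for three distinct parallel lines (numbers 6, 7, 8) carrying `A, A'` (0, 3),
`B, B'` (1, 4) and `C, C'` (2, 5): if `AB ∥ A'B'` and `AC ∥ A'C'`, then `BC ∥ B'C'`. -/
noncomputable def desarguesParallelAxiom : L.Sentence :=
  BoundedFormula.alls (n := 9)
    (distinctF ![6, 7, 8] ⊓ par 6 7 ⊓ par 6 8 ⊓ par 7 8 ⊓
      on 0 6 ⊓ on 3 6 ⊓ on 1 7 ⊓ on 4 7 ⊓ on 2 8 ⊓ on 5 8 ⊓
      joinPar 0 1 3 4 ⊓ joinPar 0 2 3 5 ⟹ joinPar 1 2 4 5)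

/-- Desargues, for three distinct lines (numbers 6, 7, 8) through a point `O` (number 9), carrying
`A, A'` (0, 3), `B, B'` (1, 4) and `C, C'` (2, 5), all different from `O`: if `AB ∥ A'B'` and
`AC ∥ A'C'`, then `BC ∥ B'C'`. -/
noncomputable def desarguesConcurrentAxiom : L.Sentence :=
  BoundedFormula.alls (n := 10)
    (distinctF ![6, 7, 8] ⊓ on 9 6 ⊓ on 9 7 ⊓ on 9 8 ⊓
      on 0 6 ⊓ on 3 6 ⊓ on 1 7 ⊓ on 4 7 ⊓ on 2 8 ⊓ on 5 8 ⊓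
      ∼(eqF 0 9) ⊓ ∼(eqF 1 9) ⊓ ∼(eqF 2 9) ⊓ ∼(eqF 3 9) ⊓ ∼(eqF 4 9) ⊓ ∼(eqF 5 9) ⊓
      joinPar 0 1 3 4 ⊓ joinPar 0 2 3 5 ⟹ joinPar 1 2 4 5)

/-- No `n` points exhaust a line: for all `x₀, …, xₙ₋₁` and every line `l` (number `n`) there is a
point on `l` different from all the `xᵢ`. -/
noncomputable def infiniteLineAxiom (n : ℕ) : L.Sentence :=
  BoundedFormula.alls (n := n + 1)
    (ln (Fin.last n) ⟹ ∃' (on (Fin.last (n + 1)) (Fin.last n).castSucc ⊓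
      BoundedFormula.iInf fun i : Fin n => ∼(eqF (Fin.last (n + 1)) i.castSucc.castSucc)))

end Axioms

/-- The axioms of Pappian parallelity planes. -/
noncomputable def pappianParallelityPlane : parLang.Theory :=
  incidenceAxioms parLang ∪ parallelismAxioms parLang ∪ uniqueParallelAxioms parLang ∪
    {pappusAxiom parLang}

/-- The axioms on orthogonality. -/
def orthogonalityAxioms : orthLang.Theory :=
  { -- orthogonality is a symmetric relation between lines
    BoundedFormula.alls (n := 2) (perp 0 1 ⟹ ln 0 ⊓ ln 1),
    BoundedFormula.alls (n := 2) (perp 0 1 ⇔ perp 1 0),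
    -- through every point there is exactly one orthogonal to a given line
    BoundedFormula.alls (n := 2) (pt 0 ⊓ ln 1 ⟹ ∃' (perp 1 2 ⊓ on 0 2)),
    BoundedFormula.alls (n := 4) (perp 1 2 ⊓ on 0 2 ⊓ perp 1 3 ⊓ on 0 3 ⟹ eqF 2 3),
    -- two lines orthogonal to the same line are parallel
    BoundedFormula.alls (n := 3) (perp 0 1 ⊓ perp 0 2 ⟹ par 1 2),
    -- through every point there is a line not orthogonal to itself
    BoundedFormula.alls (n := 1) (pt 0 ⟹ ∃' (on 0 1 ⊓ ∼(perp 1 1))),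
    -- the heights (numbers 6, 7, 8) of a triangle with vertices `A, B, C` (numbers 0, 1, 2)
    -- and side lines `BC, CA, AB` (numbers 3, 4, 5) have a point in common
    BoundedFormula.alls (n := 9)
      (pt 0 ⊓ pt 1 ⊓ pt 2 ⊓ ∼(coll 0 1 2) ⊓
        on 1 3 ⊓ on 2 3 ⊓ on 2 4 ⊓ on 0 4 ⊓ on 0 5 ⊓ on 1 5 ⊓
        on 0 6 ⊓ perp 6 3 ⊓ on 1 7 ⊓ perp 7 4 ⊓ on 2 8 ⊓ perp 8 5 ⟹
        ∃' (on 9 6 ⊓ on 9 7 ⊓ on 9 8)) }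

/-- The axioms of Wu-orthogonal planes: incidence, orthogonality, infinite lines, unique parallels
and two forms of Desargues. -/
noncomputable def wuOrthogonalPlane : orthLang.Theory :=
  incidenceAxioms orthLang ∪ orthogonalityAxioms ∪ Set.range (infiniteLineAxiom orthLang) ∪
    uniqueParallelAxioms orthLang ∪
    {desarguesParallelAxiom orthLang, desarguesConcurrentAxiom orthLang}

/-! ### The interpretation of the coordinatizing field

Relative to three non-collinear points `O`, `E`, `E'` the elements of the field are the points of
the line `OE`, with zero `O` and one `E`. -/

section Interpretation

variable {L : FirstOrder.Language.{0, 0}} [PlaneVocabulary L] {m : ℕ}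

/-- `O`, `E`, `E'` are non-collinear points. -/
def frameF (O E E' : Fin m) : L.BoundedFormula Empty m :=
  pt O ⊓ pt E ⊓ pt E' ⊓ ∼(coll O E E')

/-- `a + b = c`: with `P` the intersection of the parallel to `OE` through `E'` and the parallel to
`OE'` through `a`, the line `Pc` is parallel to `E'b`. -/
def addF (O E E' a b c : Fin m) : L.BoundedFormula Empty m :=
  coll O E a ⊓ coll O E b ⊓ coll O E c ⊓
    ∃' (joinPar E'.castSucc (Fin.last m) O.castSucc E.castSucc ⊓
      joinPar a.castSucc (Fin.last m) O.castSucc E'.castSucc ⊓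
      joinPar (Fin.last m) c.castSucc E'.castSucc b.castSucc)

/-- `a * b = c`: with `Q` the intersection of `OE'` and the parallel to `EE'` through `b`, the
line `Qc` is parallel to `E'a`. -/
def mulF (O E E' a b c : Fin m) : L.BoundedFormula Empty m :=
  coll O E a ⊓ coll O E b ⊓ coll O E c ⊓
    ∃' (coll O.castSucc E'.castSucc (Fin.last m) ⊓
      joinPar b.castSucc (Fin.last m) E.castSucc E'.castSucc ⊓
      joinPar (Fin.last m) c.castSucc E'.castSucc a.castSucc)

/-- The formula `t = y` about the field, where the `i`-th variable of the term `t` is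
represented by the variable `ρ i`. -/
def termF {k : ℕ} : FirstOrder.Language.ring.Term (Empty ⊕ Fin k) →
    ∀ {m : ℕ}, (O E E' : Fin m) → (ρ : Fin k → Fin m) → (y : Fin m) → L.BoundedFormula Empty m
  | .var (.inr i), _, _, _, _, ρ, y => eqF (ρ i) y
  | .func ringFunc.zero _, _, O, _, _, _, y => eqF O y
  | .func ringFunc.one _, _, _, E, _, _, y => eqF E y
  | .func ringFunc.neg ts, m, O, E, E', ρ, y =>
      ∃' (termF (ts 0) O.castSucc E.castSucc E'.castSucc (fun i => (ρ i).castSucc) (Fin.last m) ⊓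
        addF O.castSucc E.castSucc E'.castSucc (Fin.last m) y.castSucc O.castSucc)
  | .func ringFunc.add ts, m, O, E, E', ρ, y =>
      ∃' ∃' (termF (ts 0) O.castSucc.castSucc E.castSucc.castSucc E'.castSucc.castSucc
          (fun i => (ρ i).castSucc.castSucc) (Fin.last m).castSucc ⊓
        termF (ts 1) O.castSucc.castSucc E.castSucc.castSucc E'.castSucc.castSucc
          (fun i => (ρ i).castSucc.castSucc) (Fin.last (m + 1)) ⊓
        addF O.castSucc.castSucc E.castSucc.castSucc E'.castSucc.castSucc
          (Fin.last m).castSucc (Fin.last (m + 1)) y.castSucc.castSucc)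
  | .func ringFunc.mul ts, m, O, E, E', ρ, y =>
      ∃' ∃' (termF (ts 0) O.castSucc.castSucc E.castSucc.castSucc E'.castSucc.castSucc
          (fun i => (ρ i).castSucc.castSucc) (Fin.last m).castSucc ⊓
        termF (ts 1) O.castSucc.castSucc E.castSucc.castSucc E'.castSucc.castSucc
          (fun i => (ρ i).castSucc.castSucc) (Fin.last (m + 1)) ⊓
        mulF O.castSucc.castSucc E.castSucc.castSucc E'.castSucc.castSucc
          (Fin.last m).castSucc (Fin.last (m + 1)) y.castSucc.castSucc)

/-- Translation of a formula about the field: quantifiers range over the points of the line `OE`.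
The `i`-th variable of the formula is represented by the variable `ρ i`. -/
def translateF : ∀ {k : ℕ}, FirstOrder.Language.ring.BoundedFormula Empty k →
    ∀ {m : ℕ}, (O E E' : Fin m) → (ρ : Fin k → Fin m) → L.BoundedFormula Empty m
  | _, .falsum, _, _, _, _, _ => ⊥
  | _, .equal s t, m, O, E, E', ρ =>
      ∃' (termF s O.castSucc E.castSucc E'.castSucc (fun i => (ρ i).castSucc) (Fin.last m) ⊓
        termF t O.castSucc E.castSucc E'.castSucc (fun i => (ρ i).castSucc) (Fin.last m))
  | _, .rel R _, _, _, _, _, _ => Empty.elim R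
  | _, .imp φ ψ, _, O, E, E', ρ => translateF φ O E E' ρ ⟹ translateF ψ O E E' ρ
  | _, .all φ, m, O, E, E', ρ =>
      ∀' (coll O.castSucc E.castSucc (Fin.last m) ⟹
        translateF φ O.castSucc E.castSucc E'.castSucc
          (Fin.snoc (α := fun _ => Fin (m + 1)) (fun i => (ρ i).castSucc) (Fin.last m)))

variable (L) in
/-- The geometric translation of a sentence `σ` about fields: for all non-collinear points
`O`, `E`, `E'`, the field on the line `OE` satisfies `σ`. -/
def translate (σ : FirstOrder.Language.ring.Sentence) : L.Sentence :=
  BoundedFormula.alls (n := 3) (frameF 0 1 2 ⟹ translateF σ 0 1 2 Fin.elim0)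

end Interpretation

/-! ### The linear Cartesian plane over a field -/

section Cartesian

variable (F : Type) [Field F]

/-- The lines of the plane over `F`: the solution sets of linear equations. -/
def CartesianLine : Type :=
  {s : Set (F × F) // ∃ a b c : F, (a ≠ 0 ∨ b ≠ 0) ∧ s = {p | a * p.1 + b * p.2 + c = 0}}

/-- The universe of the plane over `F`: its points and its lines. -/
def CartesianPlane : Type := (F × F) ⊕ CartesianLine F

variable {F}

/-- being a point -/
def IsPoint (x : CartesianPlane F) : Prop := ∃ p : F × F, x = Sum.inl p

/-- being a line -/
def IsLine (x : CartesianPlane F) : Prop := ∃ l : CartesianLine F, x = Sum.inr l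

/-- incidence -/
def Inc (x y : CartesianPlane F) : Prop :=
  ∃ (p : F × F) (l : CartesianLine F), x = Sum.inl p ∧ y = Sum.inr l ∧ p ∈ l.1

/-- parallelism -/
def Par (x y : CartesianPlane F) : Prop :=
  ∃ l k : CartesianLine F, x = Sum.inr l ∧ y = Sum.inr k ∧ (l = k ∨ Disjoint l.1 k.1)

/-- orthogonality with respect to the bilinear form `u₁v₁ + u₂v₂` -/
def Perp (x y : CartesianPlane F) : Prop :=
  ∃ l k : CartesianLine F, x = Sum.inr l ∧ y = Sum.inr k ∧
    ∀ p ∈ l.1, ∀ q ∈ l.1, ∀ r ∈ k.1, ∀ s ∈ k.1,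
      (q.1 - p.1) * (s.1 - r.1) + (q.2 - p.2) * (s.2 - r.2) = 0

/-- The plane over `F` with points, lines, incidence and parallelism. -/
instance : parLang.Structure (CartesianPlane F) where
  funMap f := Empty.elim f
  RelMap
    | ParRel.point, v => IsPoint (v 0)
    | ParRel.line, v => IsLine (v 0)
    | ParRel.inc, v => Inc (v 0) (v 1)
    | ParRel.par, v => Par (v 0) (v 1)

/-- The plane over `F` with points, lines, incidence and orthogonality. -/
instance : orthLang.Structure (CartesianPlane F) where
  funMap f := Empty.elim f
  RelMap
    | OrthRel.point, v => IsPoint (v 0)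
    | OrthRel.line, v => IsLine (v 0)
    | OrthRel.inc, v => Inc (v 0) (v 1)
    | OrthRel.perp, v => Perp (v 0) (v 1)

end Cartesian

end AffineGeometry

/-!
The coordinate field is not built from the incidence axioms: `ACF₀*` asserts that the structure
interpreted on a line `OE` is an algebraically closed field of characteristic zero, so in a model
of either theory the points of `OE` form such a field `K` (`exists_field_of_translate`). What the
geometric axioms have to supply is that lines are linear in coordinates over `K`.

For a frame, write a point as a pair `(x, y)` of elements of `K`. All lines are linear as soon as
the projection of `(x, y)` to the first axis, in the direction of the line joining `E'` to the
point `a` of the axis, is `x + a * y`. For `x = 0`, `y = 0` and `y = 1` this is the definition of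
the product and the sum on `OE` (`proj_dir_of_special`). For all points, it follows from one
application of the Desargues axiom for parallel lines (`proj_dir_of_desargues`), or from the axiom
of Pappus, by way of a special case of Desargues for concurrent lines (`Net.Pappus.dilation`,
`proj_dir_of_pappus`). Hence every model of the first theory is isomorphic to `CartesianPlane K`
(`exists_equiv_of_pappian`).

For the second theory, a frame whose axes are perpendicular is used. Lines of slopes `m` and `n`
are then perpendicular iff `m * n` is a constant `κ`, because the heights of a triangle with a
side on the first axis and the opposite vertex on the second one have a common point. Rescaling
the second coordinate by a square root, available as `K` is algebraically closed, makes `κ = -1`,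
the relation of `CartesianPlane K` (`exists_planeIso_of_isOrthogonality`, `exists_equiv_of_wu`).

Conversely the axioms hold in `CartesianPlane ℂ` by analytic geometry, where the structure on a
line `OE` is a copy of `ℂ`. By Steinitz' theorem the fields `K` of cardinality `𝔠` are all
isomorphic to `ℂ`, so both theories are categorical in cardinality `𝔠`; they have no finite
models, and are therefore complete by the Łoś–Vaught test (`mem_completeTheory_iff_models`).
-/

namespace AffineGeometry

/-! ### Semantics of the plane vocabularies -/

/-- The interpretations on `M` of the symbols common to both plane vocabularies: points, lines,
incidence and parallelism, the last being defined from the others in the orthogonal vocabulary. -/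
structure PlaneData (M : Type) where
  pt : M → Prop
  ln : M → Prop
  inc : M → M → Prop
  par : M → M → Prop

namespace PlaneData
variable {M : Type} (D : PlaneData M)

/-- collinearity -/
def Coll (x y z : M) : Prop := ∃ l, D.inc x l ∧ D.inc y l ∧ D.inc z l

/-- Some line through `x`, `y` is parallel to some line through `z`, `w`. -/
def JoinPar (x y z w : M) : Prop :=
  ∃ l k, D.inc x l ∧ D.inc y l ∧ D.inc z k ∧ D.inc w k ∧ D.par l k

/-- `O`, `E`, `E'` are non-collinear points. -/
def Frame (O E E' : M) : Prop := D.pt O ∧ D.pt E ∧ D.pt E' ∧ ¬ D.Coll O E E'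

/-- the graph of the geometric addition on the line `OE` -/
def AddRel (O E E' a b c : M) : Prop :=
  D.Coll O E a ∧ D.Coll O E b ∧ D.Coll O E c ∧
    ∃ P, D.JoinPar E' P O E ∧ D.JoinPar a P O E' ∧ D.JoinPar P c E' b

/-- the graph of the geometric multiplication on the line `OE` -/
def MulRel (O E E' a b c : M) : Prop :=
  D.Coll O E a ∧ D.Coll O E b ∧ D.Coll O E c ∧
    ∃ Q, D.Coll O E' Q ∧ D.JoinPar b Q E E' ∧ D.JoinPar Q c E' a

end PlaneData

section Realize

variable (L : FirstOrder.Language.{0, 0}) (M : Type) [L.Structure M]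

variable {L M} in
@[simp] theorem realize_eqF {m : ℕ} (v : Empty → M) (xs : Fin m → M) (x y : Fin m) :
    (eqF (L := L) x y).Realize v xs ↔ xs x = xs y := by simp [eqF]

variable {L M} in
@[simp] theorem realize_distinctF {m k : ℕ} (v : Empty → M) (xs : Fin m → M) (w : Fin k → Fin m) :
    (distinctF (L := L) w).Realize v xs ↔ Function.Injective (xs ∘ w) := by
  simp only [distinctF, BoundedFormula.realize_iInf, BoundedFormula.realize_not, realize_eqF,
    Subtype.forall, Prod.forall]
  constructor
  · intro h i j hij
    by_contra hne
    rcases lt_or_gt_of_ne hne with hlt | hlt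
    · exact h i j hlt hij
    · exact h j i hlt hij.symm
  · intro h i j hij e
    exact hij.ne (h e)

variable [PlaneVocabulary L]

/-- The plane data of a structure for a plane vocabulary. -/
def planeData : PlaneData M where
  pt x := Structure.RelMap (PlaneVocabulary.point : L.Relations 1) ![x]
  ln x := Structure.RelMap (PlaneVocabulary.line : L.Relations 1) ![x]
  inc x l := Structure.RelMap (PlaneVocabulary.inc : L.Relations 2) ![x, l]
  par l k := (par (L := L) (0 : Fin 2) 1).Realize default ![l, k]

/-- The formula chosen for parallelism depends only on the lines involved, not on the number of
variables in scope. -/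
class LawfulPlaneVocabulary : Prop where
  realize_par : ∀ (M : Type) [L.Structure M] {m : ℕ} (l k : Fin m) (v : Empty → M)
    (xs : Fin m → M), (par (L := L) l k).Realize v xs ↔ (planeData L M).par (xs l) (xs k)

instance : LawfulPlaneVocabulary parLang where
  realize_par M _ m l k v xs := by
    simp [par, PlaneVocabulary.par, planeData]

instance : LawfulPlaneVocabulary orthLang where
  realize_par M _ m l k v xs := by
    simp [par, PlaneVocabulary.par, planeData, eqF]

variable {L M} {m : ℕ} (v : Empty → M) (xs : Fin m → M)

@[simp] theorem realize_pt (x : Fin m) :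
    (pt (L := L) x).Realize v xs ↔ (planeData L M).pt (xs x) := by
  simp [pt, planeData]

@[simp] theorem realize_ln (x : Fin m) :
    (ln (L := L) x).Realize v xs ↔ (planeData L M).ln (xs x) := by
  simp [ln, planeData]

@[simp] theorem realize_on (x l : Fin m) :
    (on (L := L) x l).Realize v xs ↔ (planeData L M).inc (xs x) (xs l) := by
  simp [on, planeData]

@[simp] theorem realize_par [LawfulPlaneVocabulary L] (l k : Fin m) :
    (par (L := L) l k).Realize v xs ↔ (planeData L M).par (xs l) (xs k) :=
  LawfulPlaneVocabulary.realize_par M l k v xs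

@[simp] theorem realize_coll (x y z : Fin m) :
    (coll (L := L) x y z).Realize v xs ↔ (planeData L M).Coll (xs x) (xs y) (xs z) := by
  simp [coll, PlaneData.Coll, and_assoc]

@[simp] theorem realize_frameF (O E E' : Fin m) :
    (frameF (L := L) O E E').Realize v xs ↔
      (planeData L M).Frame (xs O) (xs E) (xs E') := by
  simp [frameF, PlaneData.Frame, and_assoc]

variable [LawfulPlaneVocabulary L]

@[simp] theorem realize_joinPar (x y z w : Fin m) :
    (joinPar (L := L) x y z w).Realize v xs ↔
      (planeData L M).JoinPar (xs x) (xs y) (xs z) (xs w) := by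
  simp [joinPar, PlaneData.JoinPar, and_assoc]

@[simp] theorem realize_addF (O E E' a b c : Fin m) :
    (addF (L := L) O E E' a b c).Realize v xs ↔
      (planeData L M).AddRel (xs O) (xs E) (xs E') (xs a) (xs b) (xs c) := by
  simp [addF, PlaneData.AddRel, and_assoc]

@[simp] theorem realize_mulF (O E E' a b c : Fin m) :
    (mulF (L := L) O E E' a b c).Realize v xs ↔
      (planeData L M).MulRel (xs O) (xs E) (xs E') (xs a) (xs b) (xs c) := by
  simp [mulF, PlaneData.MulRel, and_assoc]

end Realize

/-! ### The field on a line and the translation -/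

section Translation

variable {L : FirstOrder.Language.{0, 0}} [PlaneVocabulary L]
  {M : Type} [L.Structure M]

/-- The map `e` identifies the ring structure of `K` with the one interpreted on the line `OE`.
Negation has no formula of its own: `-a` is the `b` with `a + b = O`. -/
structure IsInterpretation (D : PlaneData M) (O E E' : M) {K : Type} [Language.ring.Structure K]
    (e : K → M) : Prop where
  injective : Function.Injective e
  coll_iff : ∀ x, D.Coll O E x ↔ ∃ t, e t = x
  zero : e (Structure.funMap Ring.zeroFunc ![]) = O
  one : e (Structure.funMap Ring.oneFunc ![]) = E
  add : ∀ a b c, D.AddRel O E E' (e a) (e b) (e c) ↔ Structure.funMap Ring.addFunc ![a, b] = c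
  mul : ∀ a b c, D.MulRel O E E' (e a) (e b) (e c) ↔ Structure.funMap Ring.mulFunc ![a, b] = c
  neg : ∀ a b, D.AddRel O E E' (e a) (e b) O ↔ Structure.funMap Ring.negFunc ![a] = b

/-- A translated sentence holds iff the original one holds in the field of every frame. -/
theorem realize_translate_iff (σ : Language.ring.Sentence) :
    M ⊨ translate L σ ↔ ∀ O E E' : M, (planeData L M).Frame O E E' →
      (translateF (L := L) σ 0 1 2 Fin.elim0).Realize default ![O, E, E'] := by
  simp only [Sentence.Realize, Formula.Realize, translate]
  rw [← Formula.Realize, BoundedFormula.realize_alls]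
  simp only [BoundedFormula.realize_imp, realize_frameF]
  constructor
  · intro h O E E' hf
    exact h ![O, E, E'] hf
  · intro h xs hf
    have := h _ _ _ hf
    rwa [show ![xs 0, xs 1, xs 2] = xs by ext i; fin_cases i <;> rfl] at this

variable [LawfulPlaneVocabulary L] {K : Type} [Language.ring.Structure K] {e : K → M}

/-- The translation of the equation `y = t` defines the graph of the term `t`. -/
theorem IsInterpretation.realize_termF {O E E' : M}
    (h : IsInterpretation (planeData L M) O E E' e)
    {k : ℕ} (t : Language.ring.Term (Empty ⊕ Fin k)) :
    ∀ {m : ℕ} (xs : Fin m → M) (o i j : Fin m) (ρ : Fin k → Fin m) (y : Fin m)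
      (w : Fin k → K), xs o = O → xs i = E → xs j = E' → (∀ s, xs (ρ s) = e (w s)) →
      ((termF (L := L) t o i j ρ y).Realize default xs ↔
        xs y = e (t.realize (Sum.elim default w))) := by
  induction t with
  | var s =>
    intro m xs o i j ρ y w ho hi hj hw
    rcases s with s | s
    · exact s.elim
    · simp [termF, hw, eq_comm]
  | @func n f ts ih =>
    intro m xs o i j ρ y w ho hi hj hw
    cases f with
    | zero =>
      simp only [termF, realize_eqF, ho, ← h.zero]
      rw [eq_comm, Subsingleton.elim ![] fun i => (ts i).realize (Sum.elim default w)]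
      rfl
    | one =>
      simp only [termF, realize_eqF, hi, ← h.one]
      rw [eq_comm, Subsingleton.elim ![] fun i => (ts i).realize (Sum.elim default w)]
      rfl
    | neg =>
      have hts : ∀ g : Fin 1 → K, g = ![g 0] := fun g => by ext i; fin_cases i; rfl
      simp only [termF, BoundedFormula.realize_ex, BoundedFormula.realize_inf, realize_addF,
        Fin.snoc_castSucc, Fin.snoc_last]
      change _ ↔ xs y = e (Structure.funMap Ring.negFunc fun i =>
        (ts i).realize (Sum.elim default w))
      rw [hts (fun i => (ts i).realize _)]
      constructor
      · rintro ⟨z, hz, hadd⟩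
        rw [ih 0 _ _ _ _ _ _ w (by simpa) (by simpa) (by simpa) (by simpa)] at hz
        simp only [Fin.snoc_last] at hz
        obtain ⟨b, hb⟩ := (h.coll_iff (xs y)).1 (by rw [← ho, ← hi]; exact hadd.2.1)
        rw [ho, hi, hj, hz, ← hb] at hadd
        rw [← hb, ← (h.neg _ _).1 hadd]
      · intro hy
        refine ⟨e ((ts 0).realize (Sum.elim default w)), ?_, ?_⟩
        · rw [ih 0 _ _ _ _ _ _ w (by simpa) (by simpa) (by simpa) (by simpa)]
          simp
        · rw [ho, hi, hj, hy]; exact (h.neg _ _).2 rfl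
    | add =>
      have hts : ∀ g : Fin 2 → K, g = ![g 0, g 1] := fun g => by ext i; fin_cases i <;> rfl
      simp only [termF, BoundedFormula.realize_ex, BoundedFormula.realize_inf, realize_addF,
        Fin.snoc_castSucc, Fin.snoc_last]
      change _ ↔ xs y = e (Structure.funMap Ring.addFunc fun i =>
        (ts i).realize (Sum.elim default w))
      rw [hts (fun i => (ts i).realize _)]
      constructor
      · rintro ⟨z, z', ⟨hz, hz'⟩, hadd⟩
        rw [ih _ _ _ _ _ _ _ w (by simpa) (by simpa) (by simpa) (by simpa)] at hz hz'
        simp only [Fin.snoc_last, Fin.snoc_castSucc] at hz hz'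
        obtain ⟨b, hb⟩ := (h.coll_iff (xs y)).1 (by rw [← ho, ← hi]; exact hadd.2.2.1)
        rw [ho, hi, hj, hz, hz', ← hb] at hadd
        rw [← hb, ← (h.add _ _ _).1 hadd]
      · intro hy
        refine ⟨e ((ts 0).realize (Sum.elim default w)), e ((ts 1).realize (Sum.elim default w)),
          ⟨?_, ?_⟩, ?_⟩
        · rw [ih 0 _ _ _ _ _ _ w (by simpa) (by simpa) (by simpa) (by simpa)]
          simp
        · rw [ih 1 _ _ _ _ _ _ w (by simpa) (by simpa) (by simpa) (by simpa)]
          simp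
        · rw [ho, hi, hj, hy]; exact (h.add _ _ _).2 rfl
    | mul =>
      have hts : ∀ g : Fin 2 → K, g = ![g 0, g 1] := fun g => by ext i; fin_cases i <;> rfl
      simp only [termF, BoundedFormula.realize_ex, BoundedFormula.realize_inf, realize_mulF,
        Fin.snoc_castSucc, Fin.snoc_last]
      change _ ↔ xs y = e (Structure.funMap Ring.mulFunc fun i =>
        (ts i).realize (Sum.elim default w))
      rw [hts (fun i => (ts i).realize _)]
      constructor
      · rintro ⟨z, z', ⟨hz, hz'⟩, hadd⟩
        rw [ih _ _ _ _ _ _ _ w (by simpa) (by simpa) (by simpa) (by simpa)] at hz hz'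
        simp only [Fin.snoc_last, Fin.snoc_castSucc] at hz hz'
        obtain ⟨b, hb⟩ := (h.coll_iff (xs y)).1 (by rw [← ho, ← hi]; exact hadd.2.2.1)
        rw [ho, hi, hj, hz, hz', ← hb] at hadd
        rw [← hb, ← (h.mul _ _ _).1 hadd]
      · intro hy
        refine ⟨e ((ts 0).realize (Sum.elim default w)), e ((ts 1).realize (Sum.elim default w)),
          ⟨?_, ?_⟩, ?_⟩
        · rw [ih 0 _ _ _ _ _ _ w (by simpa) (by simpa) (by simpa) (by simpa)]
          simp
        · rw [ih 1 _ _ _ _ _ _ w (by simpa) (by simpa) (by simpa) (by simpa)]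
          simp
        · rw [ho, hi, hj, hy]; exact (h.mul _ _ _).2 rfl

/-- The translation of a formula says on the line `OE` what the formula says in `K`. -/
theorem IsInterpretation.realize_translateF {O E E' : M}
    (h : IsInterpretation (planeData L M) O E E' e)
    {k : ℕ} (φ : Language.ring.BoundedFormula Empty k) :
    ∀ {m : ℕ} (xs : Fin m → M) (o i j : Fin m) (ρ : Fin k → Fin m)
      (w : Fin k → K), xs o = O → xs i = E → xs j = E' → (∀ s, xs (ρ s) = e (w s)) →
      ((translateF (L := L) φ o i j ρ).Realize default xs ↔ φ.Realize default w) := by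
  induction φ with
  | falsum => intros; exact Iff.rfl
  | equal s t =>
    intro m xs o i j ρ w ho hi hj hw
    simp only [translateF, BoundedFormula.realize_ex, BoundedFormula.realize_inf]
    have key : ∀ (x : M) (t : Language.ring.Term (Empty ⊕ Fin _)),
        (termF (L := L) t o.castSucc i.castSucc j.castSucc (fun i => (ρ i).castSucc)
          (Fin.last m)).Realize default (Fin.snoc xs x) ↔
        x = e (t.realize (Sum.elim default w)) := fun x t => by
      rw [h.realize_termF t _ _ _ _ _ _ w (by simpa) (by simpa) (by simpa) (by simpa)]
      simp
    simp only [key]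
    constructor
    · rintro ⟨x, h1, h2⟩
      exact h.injective (h1 ▸ h2)
    · intro hst
      exact ⟨_, rfl, congrArg e hst⟩
  | rel R _ => exact Empty.elim R
  | imp φ ψ ih1 ih2 =>
    intro m xs o i j ρ w ho hi hj hw
    simp only [translateF, BoundedFormula.realize_imp]
    rw [ih1 xs o i j ρ w ho hi hj hw, ih2 xs o i j ρ w ho hi hj hw]
  | all φ ih =>
    intro m xs o i j ρ w ho hi hj hw
    simp only [translateF, BoundedFormula.realize_all, BoundedFormula.realize_imp, realize_coll,
      Fin.snoc_castSucc, Fin.snoc_last, ho, hi, h.coll_iff]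
    have key : ∀ t : K, (translateF (L := L) φ o.castSucc i.castSucc j.castSucc
        (Fin.snoc (α := fun _ => Fin (m + 1)) (fun i => (ρ i).castSucc) (Fin.last m))).Realize
          default (Fin.snoc xs (e t)) ↔ φ.Realize default (Fin.snoc w t) := by
      intro t
      apply ih _ _ _ _ _ (Fin.snoc w t) (by simpa) (by simpa) (by simpa)
      intro s
      induction s using Fin.lastCases with
      | last => simp
      | cast s => simp [hw]
    constructor
    · intro H t
      exact (key t).1 (H _ ⟨t, rfl⟩)
    · rintro H _ ⟨t, rfl⟩
      exact (key t).2 (H t)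

theorem IsInterpretation.realize_translateF_sentence {O E E' : M}
    (h : IsInterpretation (planeData L M) O E E' e) (σ : Language.ring.Sentence) :
    (translateF (L := L) σ 0 1 2 Fin.elim0).Realize default ![O, E, E'] ↔ K ⊨ σ := by
  rw [h.realize_translateF σ ![O, E, E'] 0 1 2 Fin.elim0 (default : Fin 0 → K) rfl rfl rfl
    (fun s => s.elim0)]
  rfl

end Translation

/-! ### The axioms as properties of a structure -/

namespace PlaneData

variable {M : Type} (D : PlaneData M)

/-- The incidence axioms. -/
structure IsIncidence : Prop where
  pt_or_ln : ∀ x, D.pt x ∨ D.ln x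
  not_ln : ∀ x, D.pt x → ¬ D.ln x
  of_inc : ∀ x l, D.inc x l → D.pt x ∧ D.ln l
  exists_join : ∀ x y, D.pt x → D.pt y → x ≠ y → ∃ l, D.inc x l ∧ D.inc y l
  join_unique : ∀ x y l k, x ≠ y → D.inc x l → D.inc y l → D.inc x k → D.inc y k → l = k
  exists_two : ∀ l, D.ln l → ∃ x y, x ≠ y ∧ D.inc x l ∧ D.inc y l
  exists_triangle : ∃ x y z, D.pt x ∧ D.pt y ∧ D.pt z ∧ ¬ D.Coll x y z

/-- Existence and uniqueness of the parallel to a line through a point. -/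
structure HasUniqueParallels : Prop where
  exists_par : ∀ x l, D.pt x → D.ln l → ∃ k, D.inc x k ∧ D.par k l
  par_unique : ∀ x l k k', D.inc x k → D.inc x k' → D.par k l → D.par k' l → k = k'

/-- Parallelism is an equivalence relation between lines, and non-parallel lines meet. -/
structure IsParallelism : Prop where
  of_par : ∀ l k, D.par l k → D.ln l ∧ D.ln k
  refl : ∀ l, D.ln l → D.par l l
  symm : ∀ l k, D.par l k → D.par k l
  trans : ∀ l k j, D.par l k → D.par k j → D.par l j
  meet : ∀ l k, D.ln l → D.ln k → ¬ D.par l k → ∃ x, D.inc x l ∧ D.inc x k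

/-- The axiom of Pappus. -/
def Pappus : Prop :=
  ∀ (A B : Fin 3 → M) (l k : M),
    Function.Injective ![A 0, A 1, A 2, B 0, B 1, B 2] → l ≠ k → (∀ i, D.inc (A i) l) →
    (∀ i, D.inc (B i) k) → D.JoinPar (A 0) (B 1) (A 1) (B 0) →
    D.JoinPar (A 1) (B 2) (A 2) (B 1) → D.JoinPar (A 0) (B 2) (A 2) (B 0)

/-- The axiom of Desargues for three distinct parallel lines. -/
def DesarguesParallel : Prop :=
  ∀ A B C A' B' C' a b c : M, a ≠ b → a ≠ c → b ≠ c → D.par a b → D.par a c → D.par b c →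
    D.inc A a → D.inc A' a → D.inc B b → D.inc B' b → D.inc C c → D.inc C' c →
    D.JoinPar A B A' B' → D.JoinPar A C A' C' → D.JoinPar B C B' C'

/-- The axiom of Desargues for three distinct concurrent lines. -/
def DesarguesConcurrent : Prop :=
  ∀ A B C A' B' C' a b c O : M, a ≠ b → a ≠ c → b ≠ c → D.inc O a → D.inc O b → D.inc O c →
    D.inc A a → D.inc A' a → D.inc B b → D.inc B' b → D.inc C c → D.inc C' c →
    A ≠ O → B ≠ O → C ≠ O → A' ≠ O → B' ≠ O → C' ≠ O →
    D.JoinPar A B A' B' → D.JoinPar A C A' C' → D.JoinPar B C B' C'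

/-- The axioms on an orthogonality relation. -/
structure IsOrthogonality (perp : M → M → Prop) : Prop where
  of_perp : ∀ l k, perp l k → D.ln l ∧ D.ln k
  symm : ∀ l k, perp l k ↔ perp k l
  exists_perp : ∀ x l, D.pt x → D.ln l → ∃ k, perp l k ∧ D.inc x k
  perp_unique : ∀ x l k k', perp l k → D.inc x k → perp l k' → D.inc x k' → k = k'
  par_of_perp : ∀ l k k', perp l k → perp l k' → D.par k k'
  exists_not_perp_self : ∀ x, D.pt x → ∃ l, D.inc x l ∧ ¬ perp l l
  heights : ∀ A B C a b c f g h : M, D.pt A → D.pt B → D.pt C → ¬ D.Coll A B C →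
    D.inc B a → D.inc C a → D.inc C b → D.inc A b → D.inc A c → D.inc B c →
    D.inc A f → perp f a → D.inc B g → perp g b → D.inc C h → perp h c →
    ∃ H, D.inc H f ∧ D.inc H g ∧ D.inc H h

end PlaneData

theorem realize_alls_iff {L : FirstOrder.Language.{0, 0}} {M : Type} [L.Structure M] {n : ℕ}
    (φ : L.BoundedFormula Empty n) :
    M ⊨ (φ.alls : L.Sentence) ↔ ∀ xs : Fin n → M, φ.Realize default xs :=
  BoundedFormula.realize_alls

section

variable (L : FirstOrder.Language.{0, 0}) [PlaneVocabulary L] (M : Type) [L.Structure M]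

theorem model_incidenceAxioms_iff : M ⊨ incidenceAxioms L ↔ (planeData L M).IsIncidence := by
  simp only [incidenceAxioms, Theory.model_iff, Set.mem_insert_iff, Set.mem_singleton_iff,
    forall_eq_or_imp, forall_eq, realize_alls_iff]
  constructor
  · rintro ⟨h1, h2, h3, h4, h5, h6, h7⟩
    refine ⟨fun x => ?_, fun x => ?_, fun x l => ?_, fun x y => ?_, fun x y l k => ?_,
      fun l => ?_, ?_⟩
    · simpa using h1 ![x]
    · simpa using h2 ![x]
    · simpa using h3 ![x, l]
    · simpa [Fin.snoc] using h4 ![x, y]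
    · simpa using h5 ![x, y, l, k]
    · simpa [Fin.snoc, and_assoc] using h6 ![l]
    · simpa [Sentence.Realize, Formula.Realize, Fin.snoc, and_assoc] using h7
  · intro h
    refine ⟨fun xs => ?_, fun xs => ?_, fun xs => ?_, fun xs => ?_, fun xs => ?_, fun xs => ?_, ?_⟩
    · simpa using h.pt_or_ln (xs 0)
    · simpa using h.not_ln (xs 0)
    · simpa using h.of_inc (xs 0) (xs 1)
    · simpa [Fin.snoc] using h.exists_join (xs 0) (xs 1)
    · simpa using h.join_unique (xs 0) (xs 1) (xs 2) (xs 3)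
    · simpa [Fin.snoc, and_assoc] using h.exists_two (xs 0)
    · simpa [Sentence.Realize, Formula.Realize, Fin.snoc, and_assoc] using h.exists_triangle

theorem realize_infiniteLineAxiom {n : ℕ}
    (h : ∀ l, (planeData L M).ln l → {x | (planeData L M).inc x l}.Infinite) :
    M ⊨ infiniteLineAxiom L n := by
  simp only [infiniteLineAxiom, realize_alls_iff, BoundedFormula.realize_imp, realize_ln,
    BoundedFormula.realize_ex, BoundedFormula.realize_inf, BoundedFormula.realize_iInf, realize_on,
    BoundedFormula.realize_not, realize_eqF, Fin.snoc_castSucc, Fin.snoc_last]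
  intro xs hl
  classical
  obtain ⟨x, hx, hx'⟩ := (h _ hl).exists_notMem_finset
    (Finset.univ.image fun i : Fin n => xs i.castSucc)
  refine ⟨x, hx, fun i hi => hx' ?_⟩
  simp [hi]

variable [LawfulPlaneVocabulary L]

theorem model_uniqueParallelAxioms_iff :
    M ⊨ uniqueParallelAxioms L ↔ (planeData L M).HasUniqueParallels := by
  simp only [uniqueParallelAxioms, Theory.model_iff, Set.mem_insert_iff, Set.mem_singleton_iff,
    forall_eq_or_imp, forall_eq, realize_alls_iff]
  constructor
  · rintro ⟨h1, h2⟩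
    refine ⟨fun x l => ?_, fun x l k k' => ?_⟩
    · simpa [Fin.snoc] using h1 ![x, l]
    · simpa using h2 ![x, l, k, k']
  · intro h
    refine ⟨fun xs => ?_, fun xs => ?_⟩
    · simpa [Fin.snoc] using h.exists_par (xs 0) (xs 1)
    · simpa using h.par_unique (xs 0) (xs 1) (xs 2) (xs 3)

theorem model_parallelismAxioms_iff :
    M ⊨ parallelismAxioms L ↔ (planeData L M).IsParallelism := by
  simp only [parallelismAxioms, Theory.model_iff, Set.mem_insert_iff, Set.mem_singleton_iff,
    forall_eq_or_imp, forall_eq, realize_alls_iff]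
  constructor
  · rintro ⟨h1, h2, h3, h4, h5⟩
    refine ⟨fun l k => ?_, fun l => ?_, fun l k => ?_, fun l k j => ?_, fun l k => ?_⟩
    · simpa using h1 ![l, k]
    · simpa using h2 ![l]
    · simpa using h3 ![l, k]
    · simpa using h4 ![l, k, j]
    · simpa [Fin.snoc] using h5 ![l, k]
  · intro h
    refine ⟨fun xs => ?_, fun xs => ?_, fun xs => ?_, fun xs => ?_, fun xs => ?_⟩
    · simpa using h.of_par (xs 0) (xs 1)
    · simpa using h.refl (xs 0)
    · simpa using h.symm (xs 0) (xs 1)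
    · simpa using h.trans (xs 0) (xs 1) (xs 2)
    · simpa [Fin.snoc] using h.meet (xs 0) (xs 1)

theorem realize_pappusAxiom_iff : M ⊨ pappusAxiom L ↔ (planeData L M).Pappus := by
  simp only [pappusAxiom, realize_alls_iff, BoundedFormula.realize_imp, BoundedFormula.realize_inf,
    BoundedFormula.realize_not, realize_on, realize_joinPar, realize_eqF, realize_distinctF]
  constructor
  · intro H A B l k hinj hlk hA hB h1 h2
    refine H ![A 0, A 1, A 2, B 0, B 1, B 2, l, k]
      ⟨⟨⟨⟨⟨⟨⟨⟨⟨?_, hlk⟩, hA 0⟩, hA 1⟩, hA 2⟩, hB 0⟩, hB 1⟩, hB 2⟩, h1⟩, h2⟩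
    convert hinj using 1
    ext i; fin_cases i <;> rfl
  · rintro H xs ⟨⟨⟨⟨⟨⟨⟨⟨⟨hinj, hlk⟩, hA0⟩, hA1⟩, hA2⟩, hB0⟩, hB1⟩, hB2⟩, h1⟩, h2⟩
    refine H ![xs 0, xs 1, xs 2] ![xs 3, xs 4, xs 5] (xs 6) (xs 7) ?_ hlk ?_ ?_ h1 h2
    · convert hinj using 1
      ext i; fin_cases i <;> rfl
    · intro i; fin_cases i <;> assumption
    · intro i; fin_cases i <;> assumption

theorem injective_vec_three_iff {α : Type*} (f : Fin 3 → α) :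
    Function.Injective f ↔ f 0 ≠ f 1 ∧ f 0 ≠ f 2 ∧ f 1 ≠ f 2 := by
  constructor
  · intro h
    exact ⟨h.ne (by decide), h.ne (by decide), h.ne (by decide)⟩
  · rintro ⟨h1, h2, h3⟩ i j hij
    fin_cases i <;> fin_cases j <;> first | rfl | (exfalso; simp_all)

theorem realize_desarguesParallelAxiom_iff :
    M ⊨ desarguesParallelAxiom L ↔ (planeData L M).DesarguesParallel := by
  simp only [desarguesParallelAxiom, realize_alls_iff, BoundedFormula.realize_imp,
    BoundedFormula.realize_inf, realize_on, realize_joinPar, realize_par,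
    realize_distinctF, injective_vec_three_iff]
  constructor
  · intro H A B C A' B' C' a b c h1 h2 h3 h4 h5 h6 h7 h8 h9 h10 h11 h12 h13 h14
    exact H ![A, B, C, A', B', C', a, b, c]
      ⟨⟨⟨⟨⟨⟨⟨⟨⟨⟨⟨⟨h1, h2, h3⟩, h4⟩, h5⟩, h6⟩, h7⟩, h8⟩, h9⟩, h10⟩, h11⟩, h12⟩, h13⟩, h14⟩
  · rintro H xs
      ⟨⟨⟨⟨⟨⟨⟨⟨⟨⟨⟨⟨h1, h2, h3⟩, h4⟩, h5⟩, h6⟩, h7⟩, h8⟩, h9⟩, h10⟩, h11⟩, h12⟩, h13⟩, h14⟩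
    exact H (xs 0) (xs 1) (xs 2) (xs 3) (xs 4) (xs 5) (xs 6) (xs 7) (xs 8)
      h1 h2 h3 h4 h5 h6 h7 h8 h9 h10 h11 h12 h13 h14

theorem realize_desarguesConcurrentAxiom_iff :
    M ⊨ desarguesConcurrentAxiom L ↔ (planeData L M).DesarguesConcurrent := by
  simp only [desarguesConcurrentAxiom, realize_alls_iff, BoundedFormula.realize_imp,
    BoundedFormula.realize_inf, realize_on, realize_joinPar, realize_eqF,
    BoundedFormula.realize_not, realize_distinctF, injective_vec_three_iff]
  constructor
  · intro H A B C A' B' C' a b c O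
      h1 h2 h3 h4 h5 h6 h7 h8 h9 h10 h11 h12 h13 h14 h15 h16 h17 h18 h19 h20
    exact H ![A, B, C, A', B', C', a, b, c, O]
      ⟨⟨⟨⟨⟨⟨⟨⟨⟨⟨⟨⟨⟨⟨⟨⟨⟨⟨h1, h2, h3⟩, h4⟩, h5⟩, h6⟩, h7⟩, h8⟩, h9⟩, h10⟩, h11⟩, h12⟩, h13⟩,
        h14⟩, h15⟩, h16⟩, h17⟩, h18⟩, h19⟩, h20⟩
  · rintro H xs
      ⟨⟨⟨⟨⟨⟨⟨⟨⟨⟨⟨⟨⟨⟨⟨⟨⟨⟨h1, h2, h3⟩, h4⟩, h5⟩, h6⟩, h7⟩, h8⟩, h9⟩, h10⟩, h11⟩, h12⟩, h13⟩,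
        h14⟩, h15⟩, h16⟩, h17⟩, h18⟩, h19⟩, h20⟩
    exact H (xs 0) (xs 1) (xs 2) (xs 3) (xs 4) (xs 5) (xs 6) (xs 7) (xs 8) (xs 9)
      h1 h2 h3 h4 h5 h6 h7 h8 h9 h10 h11 h12 h13 h14 h15 h16 h17 h18 h19 h20

end

section Orthogonality

variable (M : Type) [orthLang.Structure M]

/-- the interpretation of the orthogonality symbol -/
def perpRel (l k : M) : Prop := Structure.RelMap (L := orthLang) OrthRel.perp ![l, k]

variable {M} in
@[simp] theorem realize_perp {m : ℕ} (v : Empty → M) (xs : Fin m → M) (l k : Fin m) :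
    (perp l k).Realize v xs ↔ perpRel M (xs l) (xs k) := by
  simp [perp, perpRel]

theorem model_orthogonalityAxioms_iff :
    M ⊨ orthogonalityAxioms ↔ (planeData orthLang M).IsOrthogonality (perpRel M) := by
  simp only [orthogonalityAxioms, Theory.model_iff, Set.mem_insert_iff, Set.mem_singleton_iff,
    forall_eq_or_imp, forall_eq, realize_alls_iff]
  constructor
  · rintro ⟨h1, h2, h3, h4, h5, h6, h7⟩
    refine ⟨fun l k => ?_, fun l k => ?_, fun x l => ?_, fun x l k k' => ?_, fun l k k' => ?_,
      fun x => ?_, fun A B C a b c f g h => ?_⟩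
    · simpa using h1 ![l, k]
    · simpa using h2 ![l, k]
    · simpa [Fin.snoc] using h3 ![x, l]
    · simpa using h4 ![x, l, k, k']
    · simpa using h5 ![l, k, k']
    · simpa [Fin.snoc] using h6 ![x]
    · simpa [Fin.snoc, and_assoc] using h7 ![A, B, C, a, b, c, f, g, h]
  · intro h
    refine ⟨fun xs => ?_, fun xs => ?_, fun xs => ?_, fun xs => ?_, fun xs => ?_, fun xs => ?_,
      fun xs => ?_⟩
    · simpa using h.of_perp (xs 0) (xs 1)
    · simpa using h.symm (xs 0) (xs 1)
    · simpa [Fin.snoc] using h.exists_perp (xs 0) (xs 1)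
    · simpa using h.perp_unique (xs 0) (xs 1) (xs 2) (xs 3)
    · simpa using h.par_of_perp (xs 0) (xs 1) (xs 2)
    · simpa [Fin.snoc] using h.exists_not_perp_self (xs 0)
    · simpa [Fin.snoc, and_assoc] using! h.heights (xs 0) (xs 1) (xs 2) (xs 3) (xs 4) (xs 5) (xs 6)
        (xs 7) (xs 8)

/-- In the orthogonal vocabulary parallel lines are lines that are equal or disjoint. -/
theorem planeData_orthLang_par_iff (l k : M) : (planeData orthLang M).par l k ↔
    (planeData orthLang M).ln l ∧ (planeData orthLang M).ln k ∧
      (l = k ∨ ¬ ∃ x, (planeData orthLang M).inc x l ∧ (planeData orthLang M).inc x k) := by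
  simp [planeData, par, PlaneVocabulary.par, and_assoc]
  rfl

end Orthogonality

/-! ### Analytic geometry of the Cartesian plane -/

section Analytic

variable {F : Type} [Field F]

/-- the determinant of two vectors of the plane -/
def cross (u v : F × F) : F := u.1 * v.2 - u.2 * v.1

/-- the standard bilinear form of the plane -/
def dot (u v : F × F) : F := u.1 * v.1 + u.2 * v.2

theorem exists_smul_of_cross_eq_zero {u v : F × F} (hv : v ≠ 0) (h : cross u v = 0) :
    ∃ t : F, u = t • v := by
  rw [cross] at h
  by_cases h1 : v.1 = 0
  · have h2 : v.2 ≠ 0 := fun h2 => hv (Prod.ext h1 h2)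
    refine ⟨u.2 / v.2, Prod.ext ?_ ?_⟩
    · have : u.1 * v.2 = 0 := by simpa [h1] using h
      simp [h1, (mul_eq_zero.1 this).resolve_right h2]
    · simp [h2]
  · refine ⟨u.1 / v.1, Prod.ext ?_ ?_⟩
    · simp [h1]
    · simp only [Prod.smul_snd, smul_eq_mul]
      field_simp
      linear_combination -h

theorem ne_zero_of_cross_ne_zero {u v : F × F} (h : cross u v ≠ 0) : u ≠ 0 ∧ v ≠ 0 := by
  constructor <;> rintro rfl <;> simp [cross] at h

/-- The line `l` passes through `p` with direction vector `u`. -/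
def HasDirection (l : CartesianLine F) (p u : F × F) : Prop :=
  u ≠ 0 ∧ ∀ q, q ∈ l.1 ↔ cross (q - p) u = 0

theorem exists_hasDirection (l : CartesianLine F) : ∃ p u, HasDirection l p u := by
  obtain ⟨s, a, b, c, hab, rfl⟩ := l
  rcases hab with ha | hb
  · refine ⟨(-c / a, 0), (-b, a), fun h => ha (congrArg Prod.snd h), fun q => ?_⟩
    simp only [cross, Set.mem_ofPred_eq, Prod.fst_sub, Prod.snd_sub]
    rw [show (q.1 - -c / a) * a - (q.2 - 0) * -b = a * q.1 + b * q.2 + c by field_simp; ring]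
  · refine ⟨(0, -c / b), (-b, a), fun h => hb ?_, fun q => ?_⟩
    · simpa using congrArg Prod.fst h
    simp only [cross, Set.mem_ofPred_eq, Prod.fst_sub, Prod.snd_sub]
    rw [show (q.1 - 0) * a - (q.2 - -c / b) * -b = a * q.1 + b * q.2 + c by field_simp; ring]

theorem exists_line_hasDirection (p : F × F) {u : F × F} (hu : u ≠ 0) :
    ∃ l : CartesianLine F, HasDirection l p u := by
  refine ⟨⟨{q | cross (q - p) u = 0}, u.2, -u.1, -cross p u, ?_, ?_⟩, hu, fun q => Iff.rfl⟩
  · by_contra! h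
    exact hu (Prod.ext (by simpa using h.2) h.1)
  · ext q
    simp only [cross, Set.mem_ofPred_eq, Prod.fst_sub, Prod.snd_sub]
    rw [show (q.1 - p.1) * u.2 - (q.2 - p.2) * u.1 =
      u.2 * q.1 + -u.1 * q.2 + -(p.1 * u.2 - p.2 * u.1) by ring]

namespace HasDirection

variable {l k : CartesianLine F} {p q u w : F × F}

theorem mem (h : HasDirection l p u) : p ∈ l.1 := (h.2 p).2 (by simp [cross])

theorem add_smul_mem (h : HasDirection l p u) (t : F) : p + t • u ∈ l.1 :=
  (h.2 _).2 (by simp [cross]; ring)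

theorem rebase (h : HasDirection l p u) (hq : q ∈ l.1) : HasDirection l q u := by
  refine ⟨h.1, fun r => (h.2 r).trans ?_⟩
  have := (h.2 q).1 hq
  simp only [cross, Prod.fst_sub, Prod.snd_sub] at *
  constructor <;> intro h'
  · linear_combination h' - this
  · linear_combination h' + this

theorem exists_smul (h : HasDirection l p u) (hq : q ∈ l.1) : ∃ t : F, q = p + t • u := by
  obtain ⟨t, ht⟩ := exists_smul_of_cross_eq_zero h.1 ((h.2 q).1 hq)
  exact ⟨t, by rw [← ht]; abel⟩

theorem eq_of_cross (hl : HasDirection l p u) (hk : HasDirection k p w) (h : cross u w = 0) :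
    l = k := by
  obtain ⟨t, rfl⟩ := exists_smul_of_cross_eq_zero hk.1 h
  have ht : t ≠ 0 := by rintro rfl; exact hl.1 (by simp)
  refine Subtype.ext (Set.ext fun q => (hl.2 q).trans (Iff.trans ?_ (hk.2 q).symm))
  have : cross (q - p) (t • w) = t * cross (q - p) w := by simp [cross]; ring
  rw [this]; simp [ht]

theorem par_iff (hl : HasDirection l p u) (hk : HasDirection k q w) :
    (l = k ∨ Disjoint l.1 k.1) ↔ cross u w = 0 := by
  constructor
  · rintro (rfl | h)
    · have h1 := (hk.2 _).1 hl.mem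
      have h2 := (hk.2 _).1 (hl.add_smul_mem 1)
      simp only [cross, Prod.fst_sub, Prod.snd_sub, one_smul, Prod.fst_add, Prod.snd_add] at *
      linear_combination h2 - h1
    · by_contra hne
      refine Set.disjoint_left.1 h (hl.add_smul_mem (cross (q - p) w / cross u w)) ((hk.2 _).2 ?_)
      have : cross (p + (cross (q - p) w / cross u w) • u - q) w =
          (cross (q - p) w / cross u w) * cross u w - cross (q - p) w := by
        simp only [cross, Prod.fst_sub, Prod.snd_sub, Prod.fst_add, Prod.snd_add, Prod.smul_fst,
          Prod.smul_snd, smul_eq_mul]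
        ring
      rw [this, div_mul_cancel₀ _ hne, sub_self]
  · intro h
    by_cases hd : Disjoint l.1 k.1
    · exact Or.inr hd
    · obtain ⟨x, hx, hx'⟩ := Set.not_disjoint_iff.1 hd
      exact Or.inl ((hl.rebase hx).eq_of_cross (hk.rebase hx') h)

theorem perp_iff (hl : HasDirection l p u) (hk : HasDirection k q w) :
    (∀ p ∈ l.1, ∀ q ∈ l.1, ∀ r ∈ k.1, ∀ s ∈ k.1,
      (q.1 - p.1) * (s.1 - r.1) + (q.2 - p.2) * (s.2 - r.2) = 0) ↔ dot u w = 0 := by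
  constructor
  · intro h
    have := h _ hl.mem _ (hl.add_smul_mem 1) _ hk.mem _ (hk.add_smul_mem 1)
    simpa [dot] using this
  · intro h p' hp' q' hq' r hr s hs
    obtain ⟨t₁, rfl⟩ := hl.exists_smul hp'
    obtain ⟨t₂, rfl⟩ := hl.exists_smul hq'
    obtain ⟨t₃, rfl⟩ := hk.exists_smul hr
    obtain ⟨t₄, rfl⟩ := hk.exists_smul hs
    simp only [dot, Prod.fst_add, Prod.snd_add, Prod.smul_fst,
      Prod.smul_snd, smul_eq_mul] at *
    linear_combination (t₂ - t₁) * (t₄ - t₃) * h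

end HasDirection

end Analytic

section CartesianData

variable (F : Type) [Field F]

/-- the plane data of the Cartesian plane -/
def cartesianData : PlaneData (CartesianPlane F) := ⟨IsPoint, IsLine, Inc, Par⟩

/-- The parallelity structure of the Cartesian plane induces `cartesianData`. -/
theorem planeData_parLang_cartesian :
    planeData parLang (CartesianPlane F) = cartesianData F := by
  have : (planeData parLang (CartesianPlane F)).par = Par := by
    ext l k
    simp [planeData, par, PlaneVocabulary.par]
    rfl
  rw [cartesianData, ← this]
  rfl

variable {F}

@[simp] theorem cartesianData_inc_inl_inr (p : F × F) (l : CartesianLine F) :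
    (cartesianData F).inc (Sum.inl p) (Sum.inr l) ↔ p ∈ l.1 := by
  constructor
  · rintro ⟨p', l', h1, h2, h⟩
    rwa [Sum.inl_injective h1, Sum.inr_injective h2]
  · intro h
    exact ⟨p, l, rfl, rfl, h⟩

theorem cartesianData_inc {x y : CartesianPlane F} (h : (cartesianData F).inc x y) :
    ∃ (p : F × F) (l : CartesianLine F), x = Sum.inl p ∧ y = Sum.inr l ∧ p ∈ l.1 := h

theorem cartesianData_par_iff {l k : CartesianLine F} {p q u w : F × F}
    (hl : HasDirection l p u) (hk : HasDirection k q w) :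
    (cartesianData F).par (Sum.inr l) (Sum.inr k) ↔ cross u w = 0 := by
  rw [← hl.par_iff hk]
  constructor
  · rintro ⟨l', k', h1, h2, h⟩
    rwa [Sum.inr_injective h1, Sum.inr_injective h2]
  · intro h
    exact ⟨l, k, rfl, rfl, h⟩

theorem cartesianData_par {x y : CartesianPlane F} (h : (cartesianData F).par x y) :
    ∃ l k : CartesianLine F, x = Sum.inr l ∧ y = Sum.inr k := by
  obtain ⟨l, k, h1, h2, -⟩ := h
  exact ⟨l, k, h1, h2⟩

variable (F) in
/-- In the Cartesian plane, the parallelism defined in the orthogonal vocabulary is the usual one.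
-/
theorem planeData_orthLang_cartesian :
    planeData orthLang (CartesianPlane F) = cartesianData F := by
  have : (planeData orthLang (CartesianPlane F)).par = Par := by
    ext l k
    rw [planeData_orthLang_par_iff]
    change IsLine l ∧ IsLine k ∧ (l = k ∨ ¬ ∃ x, Inc x l ∧ Inc x k) ↔ _
    constructor
    · rintro ⟨⟨l, rfl⟩, ⟨k, rfl⟩, h⟩
      refine ⟨l, k, rfl, rfl, h.imp (fun h => Sum.inr_injective h) fun h => ?_⟩
      refine Set.disjoint_left.2 fun p hp hp' => h ⟨Sum.inl p, ?_, ?_⟩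
      · exact ⟨p, l, rfl, rfl, hp⟩
      · exact ⟨p, k, rfl, rfl, hp'⟩
    · rintro ⟨l, k, rfl, rfl, h⟩
      refine ⟨⟨l, rfl⟩, ⟨k, rfl⟩, h.imp (fun h => congrArg Sum.inr h) ?_⟩
      rintro h ⟨x, hx, hx'⟩
      obtain ⟨p, l', rfl, h1, hp⟩ := cartesianData_inc hx
      rw [← Sum.inr_injective h1] at hp
      exact Set.disjoint_left.1 h hp ((cartesianData_inc_inl_inr p k).1 hx')
  rw [cartesianData, ← this]
  rfl

/-- A line through two points, with direction vector the difference if the points are distinct. -/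
theorem exists_line_through (p q : F × F) :
    ∃ (l : CartesianLine F) (u : F × F), HasDirection l p u ∧ q ∈ l.1 ∧ (p ≠ q → u = q - p) := by
  by_cases h : p = q
  · obtain ⟨l, hl⟩ := exists_line_hasDirection p (u := (1, 0)) (by simp)
    exact ⟨l, _, hl, h ▸ hl.mem, fun h' => absurd h h'⟩
  · obtain ⟨l, hl⟩ := exists_line_hasDirection p (sub_ne_zero.2 (Ne.symm h))
    exact ⟨l, _, hl, (hl.2 q).2 (by simp [cross]; ring), fun _ => rfl⟩

/-- `JoinPar` is a determinant condition, degenerate pairs of points included. -/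
theorem cartesianData_joinPar_iff (p q r s : F × F) :
    (cartesianData F).JoinPar (Sum.inl p) (Sum.inl q) (Sum.inl r) (Sum.inl s) ↔
      cross (q - p) (s - r) = 0 := by
  constructor
  · rintro ⟨l, k, h1, h2, h3, h4, h⟩
    obtain ⟨l, k, rfl, rfl⟩ := cartesianData_par h
    rw [cartesianData_inc_inl_inr] at h1 h2 h3 h4
    obtain ⟨p', u, hl⟩ := exists_hasDirection l
    obtain ⟨q', w, hk⟩ := exists_hasDirection k
    rw [cartesianData_par_iff hl hk] at h
    obtain ⟨t₁, rfl⟩ := hl.exists_smul h1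
    obtain ⟨t₂, rfl⟩ := hl.exists_smul h2
    obtain ⟨t₃, rfl⟩ := hk.exists_smul h3
    obtain ⟨t₄, rfl⟩ := hk.exists_smul h4
    simp only [cross, Prod.fst_add, Prod.snd_add, Prod.smul_fst, Prod.fst_sub, Prod.snd_sub,
      Prod.smul_snd, smul_eq_mul] at *
    linear_combination (t₂ - t₁) * (t₄ - t₃) * h
  · intro h
    obtain ⟨l, u, hl, hql, hu⟩ := exists_line_through p q
    obtain ⟨k, w, hk, hsk, hw⟩ := exists_line_through r s
    by_cases hpq : p = q
    · obtain ⟨l', hl'⟩ := exists_line_hasDirection p hk.1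
      refine ⟨Sum.inr l', Sum.inr k, ?_⟩
      simp only [cartesianData_inc_inl_inr, ← hpq]
      exact ⟨hl'.mem, hl'.mem, hk.mem, hsk,
        (cartesianData_par_iff hl' hk).2 (by rw [cross]; ring)⟩
    by_cases hrs : r = s
    · obtain ⟨k', hk'⟩ := exists_line_hasDirection r hl.1
      refine ⟨Sum.inr l, Sum.inr k', ?_⟩
      simp only [cartesianData_inc_inl_inr, ← hrs]
      exact ⟨hl.mem, hql, hk'.mem, hk'.mem,
        (cartesianData_par_iff hl hk').2 (by rw [cross]; ring)⟩
    refine ⟨Sum.inr l, Sum.inr k, ?_⟩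
    simp only [cartesianData_inc_inl_inr]
    exact ⟨hl.mem, hql, hk.mem, hsk,
      (cartesianData_par_iff hl hk).2 (by rw [hu hpq, hw hrs, h])⟩

theorem cartesianData_coll_iff (p q r : F × F) :
    (cartesianData F).Coll (Sum.inl p) (Sum.inl q) (Sum.inl r) ↔ cross (q - p) (r - p) = 0 := by
  constructor
  · rintro ⟨l, h1, h2, h3⟩
    obtain ⟨-, l, -, rfl, -⟩ := cartesianData_inc h1
    rw [cartesianData_inc_inl_inr] at h1 h2 h3
    obtain ⟨p', u, hl⟩ := exists_hasDirection l
    obtain ⟨t₁, rfl⟩ := hl.exists_smul h1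
    obtain ⟨t₂, rfl⟩ := hl.exists_smul h2
    obtain ⟨t₃, rfl⟩ := hl.exists_smul h3
    simp only [cross, Prod.fst_add, Prod.snd_add, Prod.smul_fst, Prod.fst_sub, Prod.snd_sub,
      Prod.smul_snd, smul_eq_mul]
    ring
  · intro h
    by_cases hpq : p = q
    · obtain ⟨l, u, hl, hr, -⟩ := exists_line_through p r
      exact ⟨Sum.inr l, by simp [hl.mem], by simp [hl.mem, ← hpq], by simp [hr]⟩
    · obtain ⟨l, u, hl, hq, hu⟩ := exists_line_through p q
      refine ⟨Sum.inr l, by simp [hl.mem], by simp [hq], ?_⟩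
      rw [cartesianData_inc_inl_inr, hl.2, hu hpq]
      rw [cross] at *
      linear_combination -h

theorem eq_inl_of_joinPar_left {p r s x : CartesianPlane F}
    (h : (cartesianData F).JoinPar p x r s) : ∃ q, x = Sum.inl q := by
  obtain ⟨l, k, -, h2, -⟩ := h
  obtain ⟨q, -, rfl, -⟩ := cartesianData_inc h2
  exact ⟨q, rfl⟩

end CartesianData

/-! ### The axioms in the Cartesian plane -/

section CartesianAxioms

variable (F : Type) [Field F]

/-- A point and a direction vector of a line given as an element of the universe. -/
theorem exists_hasDirection_of_ln {x : CartesianPlane F} (h : (cartesianData F).ln x) :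
    ∃ (l : CartesianLine F) (p u : F × F), x = Sum.inr l ∧ HasDirection l p u := by
  obtain ⟨l, rfl⟩ := h
  obtain ⟨p, u, hl⟩ := exists_hasDirection l
  exact ⟨l, p, u, rfl, hl⟩

theorem cartesianData_isIncidence : (cartesianData F).IsIncidence where
  pt_or_ln x := by
    rcases x with p | l
    · exact Or.inl ⟨p, rfl⟩
    · exact Or.inr ⟨l, rfl⟩
  not_ln := by
    rintro _ ⟨p, rfl⟩ ⟨l, h⟩
    exact Sum.inl_ne_inr h
  of_inc := by
    rintro _ _ ⟨p, l, rfl, rfl, h⟩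
    exact ⟨⟨p, rfl⟩, ⟨l, rfl⟩⟩
  exists_join := by
    rintro _ _ ⟨p, rfl⟩ ⟨q, rfl⟩ -
    obtain ⟨l, u, hl, hq, -⟩ := exists_line_through p q
    exact ⟨Sum.inr l, by simp [hl.mem], by simp [hq]⟩
  join_unique := by
    intro x y l k hne h1 h2 h3 h4
    obtain ⟨p, l, rfl, rfl, -⟩ := cartesianData_inc h1
    obtain ⟨-, k, -, rfl, -⟩ := cartesianData_inc h3
    obtain ⟨q, -, rfl, -⟩ := cartesianData_inc h2
    rw [cartesianData_inc_inl_inr] at h1 h2 h3 h4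
    obtain ⟨_, u, hl⟩ := exists_hasDirection l
    obtain ⟨_, w, hk⟩ := exists_hasDirection k
    replace hl := hl.rebase h1
    replace hk := hk.rebase h3
    obtain ⟨t, rfl⟩ := hl.exists_smul h2
    have ht : t ≠ 0 := by rintro rfl; exact hne (congrArg Sum.inl (by simp))
    refine congrArg Sum.inr (hl.eq_of_cross hk ?_)
    have := (hk.2 _).1 h4
    have h' : t * cross u w = 0 := by
      rw [← this]; simp [cross]; ring
    exact (mul_eq_zero.1 h').resolve_left ht
  exists_two := by
    intro l h
    obtain ⟨l, p, u, rfl, hl⟩ := exists_hasDirection_of_ln F h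
    refine ⟨Sum.inl p, Sum.inl (p + (1 : F) • u), fun h => hl.1 ?_, ?_, ?_⟩
    · simpa using Sum.inl_injective h
    · simpa using hl.mem
    · rw [cartesianData_inc_inl_inr]; exact hl.add_smul_mem 1
  exists_triangle := by
    refine ⟨Sum.inl (0, 0), Sum.inl (1, 0), Sum.inl (0, 1), ⟨_, rfl⟩, ⟨_, rfl⟩, ⟨_, rfl⟩, ?_⟩
    rw [cartesianData_coll_iff]
    simp [cross]

theorem cartesianData_isParallelism : (cartesianData F).IsParallelism where
  of_par := by
    rintro _ _ ⟨l, k, rfl, rfl, -⟩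
    exact ⟨⟨l, rfl⟩, ⟨k, rfl⟩⟩
  refl := by
    rintro _ ⟨l, rfl⟩
    exact ⟨l, l, rfl, rfl, Or.inl rfl⟩
  symm := by
    rintro _ _ ⟨l, k, rfl, rfl, h⟩
    exact ⟨k, l, rfl, rfl, h.imp Eq.symm fun h => h.symm⟩
  trans := by
    intro l k j h1 h2
    obtain ⟨l, k, rfl, rfl⟩ := cartesianData_par h1
    obtain ⟨-, j, -, rfl⟩ := cartesianData_par h2
    obtain ⟨_, u, hl⟩ := exists_hasDirection l
    obtain ⟨_, v, hk⟩ := exists_hasDirection k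
    obtain ⟨_, w, hj⟩ := exists_hasDirection j
    rw [cartesianData_par_iff hl hk] at h1
    rw [cartesianData_par_iff hk hj] at h2
    rw [cartesianData_par_iff hl hj]
    obtain ⟨s, rfl⟩ := exists_smul_of_cross_eq_zero hk.1 h1
    rw [show cross (s • v) w = s * cross v w by simp [cross]; ring, h2, mul_zero]
  meet := by
    rintro _ _ ⟨l, rfl⟩ ⟨k, rfl⟩ h
    have hd : ¬ Disjoint l.1 k.1 := fun hd => h ⟨l, k, rfl, rfl, Or.inr hd⟩
    obtain ⟨x, hx, hx'⟩ := Set.not_disjoint_iff.1 hd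
    exact ⟨Sum.inl x, by simpa using hx, by simpa using hx'⟩

theorem cartesianData_hasUniqueParallels : (cartesianData F).HasUniqueParallels where
  exists_par := by
    rintro _ l ⟨p, rfl⟩ h
    obtain ⟨l, q, u, rfl, hl⟩ := exists_hasDirection_of_ln F h
    obtain ⟨k, hk⟩ := exists_line_hasDirection p hl.1
    refine ⟨Sum.inr k, by simpa using hk.mem, (cartesianData_par_iff hk hl).2 ?_⟩
    rw [cross]; ring
  par_unique := by
    intro x l k k' h1 h2 h3 h4
    have h := (cartesianData_isParallelism F).trans _ _ _ h3
      ((cartesianData_isParallelism F).symm _ _ h4)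
    obtain ⟨k, k', rfl, rfl⟩ := cartesianData_par h
    obtain ⟨p, -, rfl, -⟩ := cartesianData_inc h1
    obtain ⟨_, u, hk⟩ := exists_hasDirection k
    obtain ⟨_, v, hk'⟩ := exists_hasDirection k'
    rw [cartesianData_inc_inl_inr] at h1 h2
    exact congrArg Sum.inr ((hk.rebase h1).eq_of_cross (hk'.rebase h2)
      ((cartesianData_par_iff hk hk').1 h))

/-- With the points written as `p + s i • u` and `q + t i • w`, the three determinants expressing
the parallelisms add up. -/
theorem cartesianData_pappus : (cartesianData F).Pappus := by
  intro A B l k _ _ hA hB h1 h2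
  obtain ⟨-, l, -, rfl, -⟩ := cartesianData_inc (hA 0)
  obtain ⟨-, k, -, rfl, -⟩ := cartesianData_inc (hB 0)
  have hA' : ∀ i, ∃ p : F × F, A i = Sum.inl p := fun i => by
    obtain ⟨p, -, h, -⟩ := cartesianData_inc (hA i)
    exact ⟨p, h⟩
  have hB' : ∀ i, ∃ p : F × F, B i = Sum.inl p := fun i => by
    obtain ⟨p, -, h, -⟩ := cartesianData_inc (hB i)
    exact ⟨p, h⟩
  choose a ha using hA'
  choose b hb using hB'
  obtain ⟨p, u, hl⟩ := exists_hasDirection l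
  obtain ⟨q, w, hk⟩ := exists_hasDirection k
  simp only [ha, hb, cartesianData_inc_inl_inr, cartesianData_joinPar_iff] at *
  choose s hs using fun i => hl.exists_smul (hA i)
  choose t ht using fun i => hk.exists_smul (hB i)
  simp only [hs, ht, cross, Prod.fst_add, Prod.snd_add, Prod.smul_fst, Prod.fst_sub, Prod.snd_sub,
    Prod.smul_snd, smul_eq_mul] at *
  linear_combination h1 + h2

theorem cartesianData_desarguesParallel : (cartesianData F).DesarguesParallel := by
  intro A B C A' B' C' a b c hab hac _ pab pac _ h1 h2 h3 h4 h5 h6 h7 h8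
  obtain ⟨a, b, rfl, rfl⟩ := cartesianData_par pab
  obtain ⟨-, c, -, rfl⟩ := cartesianData_par pac
  obtain ⟨A, -, rfl, -⟩ := cartesianData_inc h1
  obtain ⟨A', -, rfl, -⟩ := cartesianData_inc h2
  obtain ⟨B, -, rfl, -⟩ := cartesianData_inc h3
  obtain ⟨B', -, rfl, -⟩ := cartesianData_inc h4
  obtain ⟨C, -, rfl, -⟩ := cartesianData_inc h5
  obtain ⟨C', -, rfl, -⟩ := cartesianData_inc h6
  rw [cartesianData_inc_inl_inr] at h1 h2 h3 h4 h5 h6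
  rw [cartesianData_joinPar_iff] at *
  obtain ⟨_, u, ha⟩ := exists_hasDirection a
  obtain ⟨_, v, hb⟩ := exists_hasDirection b
  obtain ⟨_, w, hc⟩ := exists_hasDirection c
  replace ha := ha.rebase h1
  replace hb := hb.rebase h3
  replace hc := hc.rebase h5
  rw [cartesianData_par_iff ha hb] at pab
  rw [cartesianData_par_iff ha hc] at pac
  obtain ⟨r, hr⟩ := ha.exists_smul h2
  -- `B'` is the image of `B` under the translation that maps `A` to `A'`
  have key : ∀ (b : CartesianLine F) (B B' v : F × F), HasDirection b B v → B' ∈ b.1 →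
      (Sum.inr a : CartesianPlane F) ≠ Sum.inr b → cross u v = 0 →
      cross (B - A) (B' - A') = 0 → B' = B + r • u := by
    intro b B B' v hb hB' hab hc h
    obtain ⟨t, rfl⟩ := hb.exists_smul hB'
    obtain ⟨s, rfl⟩ := exists_smul_of_cross_eq_zero hb.1 hc
    have hs : s ≠ 0 := by rintro rfl; exact ha.1 (by simp)
    have hne : cross (B - A) v ≠ 0 := by
      intro h0
      have : B ∈ a.1 := by
        rw [ha.2, show cross (B - A) (s • v) = s * cross (B - A) v by simp [cross]; ring, h0,
          mul_zero]
      exact hab (congrArg Sum.inr ((ha.rebase this).eq_of_cross hb hc))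
    have : (t - r * s) * cross (B - A) v = 0 := by
      rw [← h, hr]
      simp only [cross, Prod.fst_add, Prod.snd_add, Prod.smul_fst, Prod.fst_sub, Prod.snd_sub,
        Prod.smul_snd, smul_eq_mul]
      ring
    have ht := sub_eq_zero.1 ((mul_eq_zero.1 this).resolve_right hne)
    rw [ht, smul_smul]
  rw [key b B B' v hb h4 hab pab h7, key c C C' w hc h6 hac pac h8]
  simp only [cross, Prod.fst_add, Prod.snd_add, Prod.fst_sub, Prod.snd_sub]
  ring

theorem cartesianData_desarguesConcurrent : (cartesianData F).DesarguesConcurrent := by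
  intro A B C A' B' C' a b c O hab hac _ ha hb hc h1 h2 h3 h4 h5 h6 nA nB nC _ _ _ h7 h8
  obtain ⟨O, a, rfl, rfl, -⟩ := cartesianData_inc ha
  obtain ⟨-, b, -, rfl, -⟩ := cartesianData_inc hb
  obtain ⟨-, c, -, rfl, -⟩ := cartesianData_inc hc
  obtain ⟨A, -, rfl, -⟩ := cartesianData_inc h1
  obtain ⟨A', -, rfl, -⟩ := cartesianData_inc h2
  obtain ⟨B, -, rfl, -⟩ := cartesianData_inc h3
  obtain ⟨B', -, rfl, -⟩ := cartesianData_inc h4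
  obtain ⟨C, -, rfl, -⟩ := cartesianData_inc h5
  obtain ⟨C', -, rfl, -⟩ := cartesianData_inc h6
  rw [cartesianData_inc_inl_inr] at *
  rw [cartesianData_joinPar_iff] at *
  -- the vector from `O` to a point of a line is a direction vector of that line
  have rebase : ∀ (a : CartesianLine F) (A : F × F), O ∈ a.1 → A ∈ a.1 →
      (Sum.inl A : CartesianPlane F) ≠ Sum.inl O → HasDirection a O (A - O) := by
    intro a A hO hA hne
    obtain ⟨_, u, h⟩ := exists_hasDirection a
    replace h := h.rebase hO
    obtain ⟨t, rfl⟩ := h.exists_smul hA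
    have ht : t ≠ 0 := by rintro rfl; simp at hne
    refine ⟨by simpa using ⟨ht, h.1⟩, fun q => (h.2 q).trans ?_⟩
    have : cross (q - O) (O + t • u - O) = t * cross (q - O) u := by simp [cross]; ring
    rw [this]; simp [ht]
  have da := rebase a A ha h1 nA
  have db := rebase b B hb h3 nB
  have dc := rebase c C hc h5 nC
  obtain ⟨r, hr⟩ := da.exists_smul h2
  -- `B'` is the image of `B` under the dilation with center `O` that maps `A` to `A'`
  have key : ∀ (b : CartesianLine F) (B B' : F × F), HasDirection b O (B - O) → B' ∈ b.1 →
      (Sum.inr a : CartesianPlane F) ≠ Sum.inr b →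
      cross (B - A) (B' - A') = 0 → B' = O + r • (B - O) := by
    intro b B B' hb hB' hab h
    obtain ⟨t, rfl⟩ := hb.exists_smul hB'
    have hne : cross (A - O) (B - O) ≠ 0 := fun h0 => hab (congrArg Sum.inr (da.eq_of_cross hb h0))
    have : (r - t) * cross (A - O) (B - O) = 0 := by
      rw [← h, hr]
      simp only [cross, Prod.fst_add, Prod.snd_add, Prod.smul_fst, Prod.fst_sub, Prod.snd_sub,
        Prod.smul_snd, smul_eq_mul]
      ring
    rw [sub_eq_zero.1 ((mul_eq_zero.1 this).resolve_right hne)]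
  rw [key b B B' db h4 hab h7, key c C C' dc h6 hac h8]
  simp only [cross, Prod.fst_add, Prod.snd_add, Prod.smul_fst, Prod.fst_sub, Prod.snd_sub,
    Prod.smul_snd, smul_eq_mul]
  ring

variable {F} in
theorem cartesianData_infinite [Infinite F] (l : CartesianPlane F) (h : (cartesianData F).ln l) :
    {x | (cartesianData F).inc x l}.Infinite := by
  obtain ⟨l, p, u, rfl, hl⟩ := exists_hasDirection_of_ln F h
  refine Set.infinite_of_injective_forall_mem
    (f := fun t : F => (Sum.inl (p + t • u) : CartesianPlane F)) ?_ ?_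
  · intro s t hst
    have : s • u = t • u := add_left_cancel (Sum.inl_injective hst)
    exact smul_left_injective F hl.1 this
  · intro t
    exact (cartesianData_inc_inl_inr _ _).2 (hl.add_smul_mem t)

variable {F} in
theorem perp_inr_iff {l k : CartesianLine F} {p q u w : F × F}
    (hl : HasDirection l p u) (hk : HasDirection k q w) :
    Perp (Sum.inr l) (Sum.inr k) ↔ dot u w = 0 := by
  rw [← hl.perp_iff hk]
  constructor
  · rintro ⟨l', k', h1, h2, h⟩
    rwa [Sum.inr_injective h1, Sum.inr_injective h2]
  · intro h
    exact ⟨l, k, rfl, rfl, h⟩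

variable {F} in
theorem cross_eq_zero_of_dot {u v w : F × F} (hu : u ≠ 0) (h1 : dot u v = 0) (h2 : dot u w = 0) :
    cross v w = 0 := by
  rw [dot] at h1 h2
  rw [cross]
  by_cases h : u.1 = 0
  · have h' : u.2 ≠ 0 := fun h' => hu (Prod.ext h h')
    refine (mul_eq_zero.1 (?_ : u.2 * _ = 0)).resolve_left h'
    linear_combination v.1 * h2 - w.1 * h1
  · refine (mul_eq_zero.1 (?_ : u.1 * _ = 0)).resolve_left h
    linear_combination w.2 * h1 - v.2 * h2

theorem cartesianData_isOrthogonality : (cartesianData F).IsOrthogonality Perp where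
  of_perp := by
    rintro _ _ ⟨l, k, rfl, rfl, -⟩
    exact ⟨⟨l, rfl⟩, ⟨k, rfl⟩⟩
  symm := by
    have : ∀ l k : CartesianPlane F, Perp l k → Perp k l := by
      rintro _ _ ⟨l, k, rfl, rfl, h⟩
      refine ⟨k, l, rfl, rfl, fun p hp q hq r hr s hs => ?_⟩
      rw [← h r hr s hs p hp q hq]; ring
    exact fun l k => ⟨this l k, this k l⟩
  exists_perp := by
    rintro _ l ⟨p, rfl⟩ h
    obtain ⟨l, q, u, rfl, hl⟩ := exists_hasDirection_of_ln F h
    obtain ⟨k, hk⟩ := exists_line_hasDirection p (u := (-u.2, u.1)) (fun h => hl.1 (by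
      simp only [Prod.mk_eq_zero, neg_eq_zero] at h
      exact Prod.ext h.2 h.1))
    refine ⟨Sum.inr k, (perp_inr_iff hl hk).2 ?_, by simpa using hk.mem⟩
    rw [dot]; ring
  perp_unique := by
    rintro x _ _ _ ⟨l, k, rfl, rfl, h⟩ hx ⟨l', k', h1, rfl, h'⟩ hx'
    obtain ⟨p, -, rfl, -⟩ := cartesianData_inc hx
    rw [cartesianData_inc_inl_inr] at hx hx'
    rw [← Sum.inr_injective h1] at h'
    obtain ⟨_, u, hl⟩ := exists_hasDirection l
    obtain ⟨_, v, hk⟩ := exists_hasDirection k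
    obtain ⟨_, w, hk'⟩ := exists_hasDirection k'
    rw [hl.perp_iff hk] at h
    rw [hl.perp_iff hk'] at h'
    exact congrArg Sum.inr
      ((hk.rebase hx).eq_of_cross (hk'.rebase hx') (cross_eq_zero_of_dot hl.1 h h'))
  par_of_perp := by
    rintro _ _ _ ⟨l, k, rfl, rfl, h⟩ ⟨l', k', h1, rfl, h'⟩
    rw [← Sum.inr_injective h1] at h'
    obtain ⟨_, u, hl⟩ := exists_hasDirection l
    obtain ⟨_, v, hk⟩ := exists_hasDirection k
    obtain ⟨_, w, hk'⟩ := exists_hasDirection k'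
    rw [hl.perp_iff hk] at h
    rw [hl.perp_iff hk'] at h'
    exact (cartesianData_par_iff hk hk').2 (cross_eq_zero_of_dot hl.1 h h')
  exists_not_perp_self := by
    rintro _ ⟨p, rfl⟩
    obtain ⟨k, hk⟩ := exists_line_hasDirection p (u := ((1 : F), 0)) (by simp)
    refine ⟨Sum.inr k, by simpa using hk.mem, ?_⟩
    rw [perp_inr_iff hk hk]
    simp [dot]
  heights := by
    rintro _ _ _ a b c f g h ⟨A, rfl⟩ ⟨B, rfl⟩ ⟨C, rfl⟩ hABC h1 h2 h3 h4 h5 h6 h7 p7 h8 p8 h9 p9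
    obtain ⟨f, a, rfl, rfl, p7⟩ := p7
    obtain ⟨g, b, rfl, rfl, p8⟩ := p8
    obtain ⟨h, c, rfl, rfl, p9⟩ := p9
    rw [cartesianData_coll_iff] at hABC
    rw [cartesianData_inc_inl_inr] at *
    -- a height consists of all points `H` satisfying the perpendicularity equation
    have side : ∀ (a f : CartesianLine F) (A B C : F × F), A ∈ f.1 → B ∈ a.1 → C ∈ a.1 → B ≠ C →
        (∀ p ∈ f.1, ∀ q ∈ f.1, ∀ r ∈ a.1, ∀ s ∈ a.1,
        (q.1 - p.1) * (s.1 - r.1) + (q.2 - p.2) * (s.2 - r.2) = 0) →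
        ∀ H, dot (H - A) (C - B) = 0 → H ∈ f.1 := by
      intro a f A B C hA hB hC hBC hp H hH
      obtain ⟨_, u, hf⟩ := exists_hasDirection f
      replace hf := hf.rebase hA
      have h0 := hp _ hf.mem _ (hf.add_smul_mem 1) _ hB _ hC
      refine (hf.2 H).2 (cross_eq_zero_of_dot (sub_ne_zero.2 hBC.symm) ?_ ?_)
      · rw [← hH, dot, dot]; ring
      · simp only [one_smul, Prod.fst_add, Prod.snd_add] at h0
        rw [dot, Prod.fst_sub, Prod.snd_sub, ← h0]; ring
    have nBC : B ≠ C := by rintro rfl; exact hABC (by rw [cross]; ring)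
    have nCA : C ≠ A := by rintro rfl; exact hABC (by simp [cross])
    have nAB : A ≠ B := by rintro rfl; exact hABC (by simp [cross])
    -- the orthocentre `A + s • J (C - B)`, with `J` the rotation by a right angle
    set D := cross (B - A) (C - A) with hD
    set s := -dot (B - A) (C - A) / D
    have hsD : s * D = -dot (B - A) (C - A) := div_mul_cancel₀ _ hABC
    rw [hD] at hsD
    simp only [cross, dot, Prod.fst_sub, Prod.snd_sub] at hsD
    refine ⟨Sum.inl (A.1 - s * (C.2 - B.2), A.2 + s * (C.1 - B.1)), ?_, ?_, ?_⟩
    · rw [cartesianData_inc_inl_inr]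
      refine side a f A B C h7 h1 h2 nBC p7 _ ?_
      simp only [dot, Prod.fst_sub, Prod.snd_sub]
      ring
    · rw [cartesianData_inc_inl_inr]
      refine side b g B C A h8 h3 h4 nCA p8 _ ?_
      simp only [dot, Prod.fst_sub, Prod.snd_sub]
      linear_combination hsD
    · rw [cartesianData_inc_inl_inr]
      refine side c h C A B h9 h5 h6 nAB p9 _ ?_
      simp only [dot, Prod.fst_sub, Prod.snd_sub]
      linear_combination -hsD

/-! ### The field interpreted in the Cartesian plane -/

open Ring in
/-- For any non-collinear `O`, `E`, `E'`, the map `t ↦ O + t • (E - O)` is an isomorphism of the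
field with the structure interpreted on the line `OE`. -/
theorem cartesianData_isInterpretation [CompatibleRing F] {O E E' : F × F}
    (h : cross (E - O) (E' - O) ≠ 0) :
    IsInterpretation (cartesianData F) (Sum.inl O) (Sum.inl E) (Sum.inl E')
      (fun t : F => (Sum.inl (O + t • (E - O)) : CartesianPlane F)) := by
  have hne := ne_zero_of_cross_ne_zero h
  have coll_iff : ∀ x, (cartesianData F).Coll (Sum.inl O) (Sum.inl E) x ↔
      ∃ t : F, (Sum.inl (O + t • (E - O)) : CartesianPlane F) = x := by
    intro x
    constructor
    · rintro ⟨l, h1, h2, h3⟩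
      obtain ⟨q, -, rfl, -⟩ := cartesianData_inc h3
      have := (cartesianData_coll_iff O E q).1 ⟨l, h1, h2, h3⟩
      obtain ⟨t, ht⟩ := exists_smul_of_cross_eq_zero hne.1
        (u := q - O) (by rw [cross] at *; linear_combination -this)
      exact ⟨t, by rw [← ht]; simp⟩
    · rintro ⟨t, rfl⟩
      rw [cartesianData_coll_iff]
      simp [cross]; ring
  have inj : Function.Injective (fun t : F => (Sum.inl (O + t • (E - O)) : CartesianPlane F)) := by
    intro s t hst
    have : s • (E - O) = t • (E - O) := add_left_cancel (Sum.inl_injective hst)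
    exact smul_left_injective F hne.1 this
  have add : ∀ a b c : F, (cartesianData F).AddRel (Sum.inl O) (Sum.inl E) (Sum.inl E')
      (Sum.inl (O + a • (E - O))) (Sum.inl (O + b • (E - O))) (Sum.inl (O + c • (E - O))) ↔
      a + b = c := by
    intro a b c
    constructor
    · rintro ⟨-, -, -, P, h1, h2, h3⟩
      obtain ⟨P, rfl⟩ := eq_inl_of_joinPar_left h1
      rw [cartesianData_joinPar_iff] at *
      obtain ⟨s, hs⟩ := exists_smul_of_cross_eq_zero hne.1 h1
      obtain rfl : P = E' + s • (E - O) := by rw [← hs]; abel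
      have h4 : (s - a) * cross (E - O) (E' - O) = 0 := by
        rw [← h2]
        simp only [cross, Prod.fst_add, Prod.snd_add, Prod.smul_fst, Prod.fst_sub, Prod.snd_sub,
          Prod.smul_snd, smul_eq_mul]
        ring
      obtain rfl := sub_eq_zero.1 ((mul_eq_zero.1 h4).resolve_right h)
      have h5 : (s + b - c) * cross (E - O) (E' - O) = 0 := by
        rw [← h3]
        simp only [cross, Prod.fst_add, Prod.snd_add, Prod.smul_fst, Prod.fst_sub, Prod.snd_sub,
          Prod.smul_snd, smul_eq_mul]
        ring
      exact sub_eq_zero.1 ((mul_eq_zero.1 h5).resolve_right h)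
    · rintro rfl
      refine ⟨(coll_iff _).2 ⟨a, rfl⟩, (coll_iff _).2 ⟨b, rfl⟩, (coll_iff _).2 ⟨a + b, rfl⟩,
        Sum.inl (E' + a • (E - O)), ?_⟩
      simp only [cartesianData_joinPar_iff, cross, Prod.fst_add, Prod.snd_add, Prod.smul_fst,
        Prod.fst_sub, Prod.snd_sub, Prod.smul_snd, smul_eq_mul]
      refine ⟨?_, ?_, ?_⟩ <;> ring
  have mul : ∀ a b c : F, (cartesianData F).MulRel (Sum.inl O) (Sum.inl E) (Sum.inl E')
      (Sum.inl (O + a • (E - O))) (Sum.inl (O + b • (E - O))) (Sum.inl (O + c • (E - O))) ↔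
      a * b = c := by
    intro a b c
    constructor
    · rintro ⟨-, -, -, Q, h1, h2, h3⟩
      obtain ⟨Q, rfl⟩ := eq_inl_of_joinPar_left h2
      rw [cartesianData_joinPar_iff] at h2 h3
      rw [cartesianData_coll_iff] at h1
      obtain ⟨s, hs⟩ := exists_smul_of_cross_eq_zero hne.2
        (u := Q - O) (by rw [cross] at *; linear_combination -h1)
      obtain rfl : Q = O + s • (E' - O) := by rw [← hs]; abel
      have h4 : (s - b) * cross (E - O) (E' - O) = 0 := by
        rw [← h2]
        simp only [cross, Prod.fst_add, Prod.snd_add, Prod.smul_fst, Prod.fst_sub, Prod.snd_sub,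
          Prod.smul_snd, smul_eq_mul]
        ring
      obtain rfl := sub_eq_zero.1 ((mul_eq_zero.1 h4).resolve_right h)
      have h5 : (a * s - c) * cross (E - O) (E' - O) = 0 := by
        rw [← h3]
        simp only [cross, Prod.fst_add, Prod.snd_add, Prod.smul_fst, Prod.fst_sub, Prod.snd_sub,
          Prod.smul_snd, smul_eq_mul]
        ring
      exact sub_eq_zero.1 ((mul_eq_zero.1 h5).resolve_right h)
    · rintro rfl
      refine ⟨(coll_iff _).2 ⟨a, rfl⟩, (coll_iff _).2 ⟨b, rfl⟩, (coll_iff _).2 ⟨a * b, rfl⟩,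
        Sum.inl (O + b • (E' - O)), ?_⟩
      simp only [cartesianData_joinPar_iff, cartesianData_coll_iff, cross, Prod.fst_add,
        Prod.snd_add, Prod.smul_fst,
        Prod.fst_sub, Prod.snd_sub, Prod.smul_snd, smul_eq_mul]
      refine ⟨?_, ?_, ?_⟩ <;> ring
  have zero : (O + (0 : F) • (E - O)) = O := by simp
  refine ⟨inj, coll_iff, ?_, ?_, fun a b c => ?_, fun a b c => ?_, fun a b => ?_⟩
  · exact congrArg Sum.inl (by rw [CompatibleRing.funMap_zero, zero])
  · exact congrArg Sum.inl (by rw [CompatibleRing.funMap_one]; simp)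
  · rw [add, CompatibleRing.funMap_add]; rfl
  · rw [mul, CompatibleRing.funMap_mul]; rfl
  · have := add a b 0
    rw [zero] at this
    rw [this, CompatibleRing.funMap_neg]
    exact add_eq_zero_iff_neg_eq

/-- The translation of a sentence true in `F` is true in the Cartesian plane over `F`. -/
theorem realize_translate_cartesian {L : FirstOrder.Language.{0, 0}} [PlaneVocabulary L]
    [LawfulPlaneVocabulary L] [L.Structure (CartesianPlane F)] [Ring.CompatibleRing F]
    (hL : planeData L (CartesianPlane F) = cartesianData F) {σ : Language.ring.Sentence}
    (hσ : F ⊨ σ) : CartesianPlane F ⊨ translate L σ := by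
  rw [realize_translate_iff]
  intro O E E' hf
  rw [hL] at hf
  obtain ⟨⟨O, rfl⟩, ⟨E, rfl⟩, ⟨E', rfl⟩, h⟩ := hf
  rw [cartesianData_coll_iff] at h
  have := cartesianData_isInterpretation F h
  rw [← hL] at this
  exact (this.realize_translateF_sentence σ).2 hσ

end CartesianAxioms

/-! ### Affine planes as nets -/

/-- An affine plane, presented by its points and its parallel classes of lines ("directions"):
`N.S d p q` means that `p` and `q` are on a common line of direction `d`. -/
structure Net (X Δ : Type) where
  S : Δ → X → X → Prop
  refl : ∀ d p, S d p p
  symm : ∀ {d p q}, S d p q → S d q p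
  trans : ∀ {d p q r}, S d p q → S d q r → S d p r
  exists_dir : ∀ p q, ∃ d, S d p q
  dir_unique : ∀ {d d' p q}, S d p q → S d' p q → p ≠ q → d = d'
  meet : ∀ {d d'}, d ≠ d' → ∀ p q, ∃ r, S d p r ∧ S d' q r

namespace Net

variable {X Δ : Type} (N : Net X Δ)

/-- The axiom of Pappus for two distinct lines of directions `l` and `k`. -/
def Pappus : Prop :=
  ∀ {l k A₁ A₂ A₃ B₁ B₂ B₃}, N.S l A₁ A₂ → N.S l A₁ A₃ → N.S k B₁ B₂ → N.S k B₁ B₃ →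
    (l ≠ k ∨ ¬ N.S l A₁ B₁) → Function.Injective ![A₁, A₂, A₃, B₁, B₂, B₃] →
    ∀ {d₁ d₂}, N.S d₁ A₁ B₂ → N.S d₁ A₂ B₁ → N.S d₂ A₂ B₃ → N.S d₂ A₃ B₂ →
    ∃ d₃, N.S d₃ A₁ B₃ ∧ N.S d₃ A₃ B₁

variable {N}

theorem injective_vec_six {α : Type*} {a b c d e f : α} (h1 : a ≠ b) (h2 : a ≠ c) (h3 : a ≠ d)
    (h4 : a ≠ e) (h5 : a ≠ f) (h6 : b ≠ c) (h7 : b ≠ d) (h8 : b ≠ e) (h9 : b ≠ f) (h10 : c ≠ d)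
    (h11 : c ≠ e) (h12 : c ≠ f) (h13 : d ≠ e) (h14 : d ≠ f) (h15 : e ≠ f) :
    Function.Injective ![a, b, c, d, e, f] := by
  intro i j hij
  fin_cases i <;> fin_cases j <;> first | rfl | (exfalso; simp_all)

/-- A special case of the Desargues axiom for concurrent lines, after Hilbert. The points `A`,
`A'` are on the second axis, `B`, `B'` on the first, and `P`, `P'` on a third line through `O`, of
direction `g`; the lines `AP` and `A'P'` are parallel to the first axis, and `AB` is parallel to
`A'B'`. Then `BP` is parallel to `B'P'`. The case `AB ∥ OP` is excluded, as the auxiliary point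
`L` does not exist then. -/
theorem Pappus.dilation (hP : N.Pappus) {x y g d : Δ} {O A A' P P' B B' : X} (hxy : x ≠ y)
    (hA : N.S y O A) (hA' : N.S y O A') (nA : O ≠ A) (nA' : O ≠ A') (nAA' : A ≠ A')
    (hAP : N.S x A P) (nP : P ≠ A) (hP1 : N.S g O P) (hP' : N.S g O P') (hAP' : N.S x A' P')
    (hB : N.S x O B) (hB' : N.S x O B') (nB : B ≠ O) (hAB : N.S d A B) (hAB' : N.S d A' B')
    (hdg : d ≠ g) : ∃ e, N.S e B P ∧ N.S e B' P' := by
  have symm := @N.symm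
  have trans := @N.trans
  have uniq := @N.dir_unique
  have ngx : g ≠ x := by grind
  have ngy : g ≠ y := by grind
  have ndx : d ≠ x := by grind
  have ndy : d ≠ y := by grind
  -- The parallel to `OP` through `A` meets the first axis in `M` and `A'B'` in `L`; the lines `AP`
  -- and `LP'` meet in `Q`. Three applications of Pappus give `OQ ∥ A'B'`, `MQ ∥ BP`, `MQ ∥ B'P'`.
  obtain ⟨M, hM, hM'⟩ := N.meet ngx A O
  obtain ⟨L, hL, hL'⟩ := N.meet hdg.symm A A'
  have nLP' : L ≠ P' := by grind
  obtain ⟨n, hn⟩ := N.exists_dir L P'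
  have nnx : n ≠ x := by grind
  obtain ⟨Q, hQ, hQ'⟩ := N.meet nnx L A
  have nOP : O ≠ P := by grind
  have nOP' : O ≠ P' := by grind
  have nMO : M ≠ O := by grind
  have nMA : M ≠ A := by grind
  have nLA : L ≠ A := by grind
  have nLA' : L ≠ A' := by grind
  have nLO : L ≠ O := by grind
  have nQA : Q ≠ A := by grind
  have nQL : Q ≠ L := by grind
  have nQP' : Q ≠ P' := by grind
  have nQO : Q ≠ O := by grind
  have nQA' : Q ≠ A' := by grind
  have nPA' : P' ≠ A := by grind
  have nPA'' : P' ≠ A' := by grind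
  obtain ⟨e, he, he'⟩ := hP (l := y) (k := n) (A₁ := O) (A₂ := A) (A₃ := A') (B₁ := L) (B₂ := P')
    (B₃ := Q) hA hA' hn hQ (by grind)
    (injective_vec_six nA nA' nLO.symm nOP' nQO.symm nAA' nLA.symm nPA'.symm nQA.symm nLA'.symm
      nPA''.symm nQA'.symm nLP' nQL.symm nQP'.symm) hP' hL hQ' hAP'
  obtain rfl : e = d := uniq he' hL' nLA'.symm
  have nMB : M ≠ B := by grind
  have nQP : Q ≠ P := by grind
  have nPM : M ≠ P := by grind
  have nQM : Q ≠ M := by grind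
  have nAB : A ≠ B := by grind
  have nQB : Q ≠ B := by grind
  have nPB : P ≠ B := by grind
  obtain ⟨e₁, h₁, h₁'⟩ := hP (l := x) (k := x) (A₁ := M) (A₂ := O) (A₃ := B) (B₁ := P) (B₂ := A)
    (B₃ := Q) (by grind) (by grind) (by grind) (by grind) (by grind)
    (injective_vec_six nMO nMB nPM nMA nQM.symm nB.symm nOP nA nQO.symm nPB.symm nAB.symm
      nQB.symm nP nQP.symm nQA.symm) (symm hM) hP1 he (symm hAB)
  have : ∃ e₂, N.S e₂ M Q ∧ N.S e₂ B' P' := by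
    -- if `M = B'`, then `L = M`, so that `LP'` is both `MQ` and `B'P'`
    by_cases hMB : M = B'
    · refine ⟨n, ?_, ?_⟩ <;> grind
    have nLM : L ≠ M := by grind
    have nLB : L ≠ B' := by grind
    have nMP : M ≠ P' := by grind
    have nOB : O ≠ B' := by grind
    have nPB' : P' ≠ B' := by grind
    have nQB' : Q ≠ B' := by grind
    exact hP (l := x) (k := n) (A₁ := M) (A₂ := O) (A₃ := B') (B₁ := P') (B₂ := L) (B₃ := Q)
      (by grind) (by grind) (by grind) (by grind) (by grind)
      (injective_vec_six nMO hMB nMP nLM.symm nQM.symm nOB nOP' nLO.symm nQO.symm nPB'.symm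
        nLB.symm nQB'.symm nLP'.symm nQP'.symm nQL.symm) (by grind) hP' he (by grind)
  obtain ⟨e₂, h₂, h₂'⟩ := this
  obtain rfl : e₁ = e₂ := uniq h₁ h₂ nQM.symm
  exact ⟨e₁, h₁', h₂'⟩
end Net
namespace Net

variable {X Δ : Type} (N : Net X Δ)

/-! ### Coordinates -/

/-- The axiom of Desargues for three distinct parallel lines. -/
def DesarguesParallel : Prop :=
  ∀ {x A A' B B' C C'}, N.S x A A' → N.S x B B' → N.S x C C' → ¬ N.S x A B → ¬ N.S x A C →
    ¬ N.S x B C → ∀ {d e}, N.S d A B → N.S d A' B' → N.S e A C → N.S e A' C' →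
    ∃ f, N.S f B C ∧ N.S f B' C'

/-- A coordinate frame: an origin `O`, unit points `E` and `E'`, and the directions `x` and `y` of
the axes `OE` and `OE'`. -/
structure Frame where
  x : Δ
  y : Δ
  O : X
  E : X
  E' : X
  x_ne_y : x ≠ y
  x_OE : N.S x O E
  y_OE : N.S y O E'
  O_ne_E : O ≠ E
  O_ne_E' : O ≠ E'

namespace Frame

variable {N} (f : N.Frame)

/-- the points of the first axis -/
abbrev K : Type := {p // N.S f.x f.O p}

/-- the origin, as a point of the first axis -/
def zero : f.K := ⟨f.O, N.refl _ _⟩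

/-- the unit point, as a point of the first axis -/
def one : f.K := ⟨f.E, f.x_OE⟩

open Classical in
/-- The intersection of the first axis with the line of direction `d` through `p`; the junk value
is the origin if `d` is the direction of the axis. -/
noncomputable def proj (d : Δ) (p : X) : f.K :=
  if h : d ≠ f.x then ⟨(N.meet h p f.O).choose, (N.meet h p f.O).choose_spec.2⟩ else f.zero

variable {f} in
theorem proj_spec {d : Δ} (h : d ≠ f.x) (p : X) : N.S d p (f.proj d p) := by
  rw [proj, dif_pos h]
  exact (N.meet h p f.O).choose_spec.1

variable {f} in
theorem proj_eq {d : Δ} (h : d ≠ f.x) {p : X} {k : f.K} (hk : N.S d p k) : f.proj d p = k := by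
  by_contra hne
  exact h (N.dir_unique (N.trans (N.symm (proj_spec h p)) hk)
    (N.trans (N.symm (f.proj d p).2) k.2) fun h => hne (Subtype.ext h))

variable {f} in
theorem proj_eq_proj_iff {d : Δ} (h : d ≠ f.x) {p q : X} :
    f.proj d p = f.proj d q ↔ N.S d p q :=
  ⟨fun hpq => N.trans (proj_spec h p) (hpq ▸ N.symm (proj_spec h q)),
    fun hpq => proj_eq h (N.trans hpq (proj_spec h q))⟩

/-- `E'` is not on the first axis; `a` stands for an arbitrary point of the axis. -/
theorem not_x_E' (a : f.K) : ¬ N.S f.x f.E' a := fun h =>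
  f.x_ne_y (N.dir_unique (N.trans a.2 (N.symm h)) f.y_OE f.O_ne_E')

/-- the direction of the line joining `E'` to a point of the first axis -/
noncomputable def dir (a : f.K) : Δ := (N.exists_dir f.E' a).choose

theorem dir_spec (a : f.K) : N.S (f.dir a) f.E' a := (N.exists_dir f.E' a).choose_spec

theorem dir_ne (a : f.K) : f.dir a ≠ f.x := fun h => by
  have := f.dir_spec a
  rw [h] at this
  exact f.not_x_E' a this

variable {f} in
theorem eq_dir {a : f.K} {d : Δ} (h : N.S d f.E' a) : d = f.dir a :=
  N.dir_unique h (f.dir_spec a) fun h' => f.not_x_E' a (by rw [← h']; exact N.refl _ _)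

variable {f} in
theorem exists_eq_dir {d : Δ} (h : d ≠ f.x) : ∃ a, d = f.dir a :=
  ⟨f.proj d f.E', eq_dir (proj_spec h _)⟩

theorem y_eq_dir : f.y = f.dir f.zero := eq_dir (N.symm f.y_OE)

/-- the point above `a` on the parallel to the first axis through `E'` -/
noncomputable def top (a : f.K) : X := (N.meet f.x_ne_y f.E' a).choose

theorem top_x (a : f.K) : N.S f.x f.E' (f.top a) := (N.meet f.x_ne_y f.E' a).choose_spec.1

theorem top_y (a : f.K) : N.S f.y a (f.top a) := (N.meet f.x_ne_y f.E' a).choose_spec.2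

theorem dir_one_ne_y : f.dir f.one ≠ f.y := by
  rw [y_eq_dir]
  intro h
  have h1 : N.S (f.dir f.one) f.E f.O :=
    N.trans (N.symm (f.dir_spec f.one)) (h ▸ f.dir_spec f.zero)
  exact f.dir_ne f.one (N.dir_unique h1 (N.symm f.x_OE) f.O_ne_E.symm)

/-- The point of the second axis corresponding to the point `b` of the first axis under the
parallel projection in the direction of `EE'`. -/
noncomputable def side (b : f.K) : X := (N.meet f.dir_one_ne_y b f.O).choose

theorem side_z (b : f.K) : N.S (f.dir f.one) b (f.side b) :=
  (N.meet f.dir_one_ne_y b f.O).choose_spec.1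

theorem side_y (b : f.K) : N.S f.y f.O (f.side b) :=
  (N.meet f.dir_one_ne_y b f.O).choose_spec.2

/-- geometric addition -/
noncomputable def add (a b : f.K) : f.K := f.proj (f.dir b) (f.top a)

/-- geometric multiplication -/
noncomputable def mul (a b : f.K) : f.K := f.proj (f.dir a) (f.side b)

/-- Geometric negation: `-a` is the point of the axis joined to `E'` by a parallel to the line
from the origin to the point above `a`. -/
noncomputable def neg (a : f.K) : f.K := f.proj (N.exists_dir (f.top a) f.O).choose f.E'

/-- `a + b = 0` iff `E'b` is parallel to the line joining the origin to the point above `a`. -/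
theorem add_eq_zero_iff (a b : f.K) : f.add a b = f.zero ↔ f.neg a = b := by
  have he := (N.exists_dir (f.top a) f.O).choose_spec
  rw [neg]
  set e := (N.exists_dir (f.top a) f.O).choose
  have hne : e ≠ f.x := fun h => by
    rw [h] at he
    exact f.not_x_E' f.zero (N.trans (f.top_x a) he)
  constructor
  · intro h
    have h1 := proj_spec (f.dir_ne b) (f.top a)
    rw [show f.proj (f.dir b) (f.top a) = f.zero from h] at h1
    refine proj_eq hne ?_
    have : e = f.dir b := N.dir_unique he h1 fun h0 =>
      f.not_x_E' f.zero (N.trans (f.top_x a) (by rw [h0]; exact N.refl _ _))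
    exact this ▸ f.dir_spec b
  · rintro h
    have : e = f.dir b := eq_dir (h ▸ proj_spec hne f.E')
    exact proj_eq (f.dir_ne b) (this ▸ he)

/-- First coordinate: the projection to the first axis parallel to the second one. -/
noncomputable def fst (p : X) : f.K := f.proj f.y p

/-- Second coordinate: the projection to the second axis, carried to the first axis by the parallel
projection in the direction of `EE'`. -/
noncomputable def snd (p : X) : f.K := f.proj (f.dir f.one) (N.meet f.x_ne_y p f.O).choose

theorem fst_spec (p : X) : N.S f.y p (f.fst p) := proj_spec f.x_ne_y.symm p

theorem snd_spec (p : X) : N.S f.x p (f.side (f.snd p)) := by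
  have h := (N.meet f.x_ne_y p f.O).choose_spec
  have h1 := proj_spec (f.dir_ne f.one) (N.meet f.x_ne_y p f.O).choose
  rw [← snd] at h1
  have : (N.meet f.x_ne_y p f.O).choose = f.side (f.snd p) := by
    by_contra hne
    exact f.dir_one_ne_y (N.dir_unique (N.trans h1 (f.side_z _))
      (N.trans (N.symm h.2) (f.side_y _)) hne)
  exact this ▸ h.1

variable {f} in
theorem fst_eq_iff {p : X} {a : f.K} : f.fst p = a ↔ N.S f.y p a :=
  ⟨fun h => h ▸ f.fst_spec p, fun h => proj_eq f.x_ne_y.symm h⟩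

variable {f} in
theorem side_injective {a b : f.K} (h : f.side a = f.side b) : a = b := by
  have := proj_eq (f.dir_ne f.one) (N.symm (f.side_z a))
  rw [← this, h]
  exact proj_eq (f.dir_ne f.one) (N.symm (f.side_z b))

variable {f} in
theorem snd_eq_iff {p : X} {b : f.K} : f.snd p = b ↔ N.S f.x p (f.side b) := by
  refine ⟨fun h => h ▸ f.snd_spec p, fun h => side_injective ?_⟩
  by_contra hne
  exact f.x_ne_y (N.dir_unique (N.trans (N.symm (f.snd_spec p)) h)
    (N.trans (N.symm (f.side_y _)) (f.side_y b)) hne)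

theorem snd_eq_snd_iff {p q : X} : f.snd p = f.snd q ↔ N.S f.x p q := by
  rw [snd_eq_iff]
  exact ⟨fun h => N.trans h (N.symm (f.snd_spec q)), fun h => N.trans h (f.snd_spec q)⟩

theorem coord_ext {p q : X} (h1 : f.fst p = f.fst q) (h2 : f.snd p = f.snd q) : p = q := by
  by_contra hne
  rw [snd_eq_snd_iff] at h2
  rw [fst_eq_iff] at h1
  exact f.x_ne_y (N.dir_unique h2 (N.trans h1 (N.symm (f.fst_spec q))) hne)

theorem exists_coord (a b : f.K) : ∃ p, f.fst p = a ∧ f.snd p = b := by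
  obtain ⟨p, h1, h2⟩ := N.meet f.x_ne_y (f.side b) a
  exact ⟨p, fst_eq_iff.2 (N.symm h2), snd_eq_iff.2 (N.symm h1)⟩

theorem side_zero : f.side f.zero = f.O := by
  by_contra hne
  exact f.dir_one_ne_y (N.dir_unique (N.symm (f.side_z f.zero)) (N.symm (f.side_y f.zero)) hne)

theorem side_one : f.side f.one = f.E' := by
  by_contra hne
  exact f.dir_one_ne_y (N.dir_unique (N.trans (N.symm (f.side_z f.one))
    (N.symm (f.dir_spec f.one))) (N.trans (N.symm (f.side_y f.one)) f.y_OE) hne)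

theorem not_x_top (a b : f.K) : ¬ N.S f.x (f.top a) b := fun h =>
  f.not_x_E' b (N.trans (f.top_x a) h)

theorem snd_top (a : f.K) : f.snd (f.top a) = f.one := by
  rw [snd_eq_iff, side_one]; exact N.symm (f.top_x a)

theorem fst_top (a : f.K) : f.fst (f.top a) = a := fst_eq_iff.2 (N.symm (f.top_y a))

/-- The operations of the field `K` are the geometric ones. -/
structure Compatible [Field f.K] : Prop where
  add : ∀ a b, f.add a b = a + b
  mul : ∀ a b, f.mul a b = a * b
  zero : f.zero = 0
  one : f.one = 1

variable {f}

section Linear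

variable [Field f.K] (hf : f.Compatible)

include hf in
/-- The points of the first axis, of the second axis, and of the parallel to the first axis through
`E'` are projected to the first axis by the expected linear formula, by the very definition of the
geometric operations. -/
theorem proj_dir_of_special (a : f.K) (p : X)
    (h : f.fst p = 0 ∨ f.snd p = 0 ∨ f.snd p = 1) :
    f.proj (f.dir a) p = f.fst p + a * f.snd p := by
  rcases h with h | h | h
  · rw [h, zero_add, ← hf.mul, mul]
    congr 1
    refine f.coord_ext ?_ ?_
    · rw [h, ← hf.zero, eq_comm, fst_eq_iff]; exact N.symm (f.side_y _)
    · rw [eq_comm, snd_eq_iff]; exact N.refl _ _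
  · rw [h, mul_zero, add_zero]
    rw [← hf.zero, snd_eq_iff, side_zero] at h
    have : f.fst p = ⟨p, N.symm h⟩ := fst_eq_iff.2 (N.refl _ _)
    rw [this]
    exact proj_eq (f.dir_ne a) (N.refl _ _)
  · rw [h, mul_one, ← hf.add, Frame.add]
    congr 1
    refine f.coord_ext ?_ ?_
    · rw [fst_top]
    · rw [snd_top, h, hf.one]

include hf in
/-- The parallel form of Desargues makes the projections to the first axis linear: it is applied to
the triangle `E'`, `(a * b, 0)`, `(0, b)` and its translate by `(c, 0)`, for the point `(c, b)`. -/
theorem proj_dir_of_desargues (hD : N.DesarguesParallel) (a : f.K) (p : X) :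
    f.proj (f.dir a) p = f.fst p + a * f.snd p := by
  by_cases h0 : f.snd p = 0
  · exact proj_dir_of_special hf a p (Or.inr (Or.inl h0))
  by_cases h1 : f.snd p = 1
  · exact proj_dir_of_special hf a p (Or.inr (Or.inr h1))
  set c := f.fst p with hc
  set b := f.snd p with hb
  have hC : ¬ N.S f.x f.E' (f.side b) := by
    intro h
    rw [← snd_eq_iff] at h
    refine h1 (h.symm.trans ?_)
    rw [← hf.one, snd_eq_iff, side_one]; exact N.refl _ _
  have hB : ¬ N.S f.x ((a * b : f.K) : X) (f.side b) := by
    intro h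
    rw [← snd_eq_iff] at h
    refine h0 (h.symm.trans ?_)
    rw [← hf.zero, snd_eq_iff, side_zero]; exact N.symm (a * b).2
  obtain ⟨e, h2, h3⟩ := hD (x := f.x) (A := f.E') (A' := f.top c) (B := (a * b : f.K))
    (B' := (c + a * b : f.K)) (C := f.side b) (C' := p) (f.top_x c)
    (N.trans (N.symm (a * b).2) (c + a * b).2) (N.symm (f.snd_spec p)) (f.not_x_E' _) hC hB
    (d := f.dir (a * b)) (e := f.y) (f.dir_spec _)
    (by rw [← hf.add c]; exact proj_spec (f.dir_ne _) _)
    (N.trans (N.symm f.y_OE) (f.side_y b))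
    (N.trans (N.symm (f.top_y c)) (N.symm (f.fst_spec p)))
  have h4 : N.S (f.dir a) (f.side b) (a * b : f.K) := by
    rw [← hf.mul]; exact proj_spec (f.dir_ne _) _
  have : e = f.dir a := N.dir_unique h2 (N.symm h4) fun h => hB (h ▸ N.refl _ _)
  exact proj_eq (f.dir_ne a) (this ▸ N.symm h3)

include hf in
/-- The axiom of Pappus makes the projections to the first axis linear: a point `(c, b)` is the
image of the point `(c / b, 1)` under the dilation with center `O` and ratio `b`, dilations map
lines to parallel lines, and the formula on the line of ordinate `1` is carried over by the
distributive law. -/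
theorem proj_dir_of_pappus (hP : N.Pappus) (h2 : (2 : f.K) ≠ 0) (a : f.K) (p : X) :
    f.proj (f.dir a) p = f.fst p + a * f.snd p := by
  by_cases h : f.fst p = 0 ∨ f.snd p = 0 ∨ f.snd p = 1
  · exact proj_dir_of_special hf a p h
  push Not at h
  obtain ⟨c0, b0, b1⟩ := h
  have hc := f.fst_spec p
  have hb := f.snd_spec p
  set c := f.fst p
  set b := f.snd p
  set s := c / b with hs
  have hsb : s * b = c := div_mul_cancel₀ _ b0
  have s0 : s ≠ 0 := div_ne_zero c0 b0
  have hO : ((0 : f.K) : X) = f.O := congrArg Subtype.val hf.zero.symm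
  have nOA' : f.O ≠ f.side b := fun h => b0 (by
    rw [← f.side_zero] at h; rw [← hf.zero]; exact (side_injective h).symm)
  have nAA' : f.E' ≠ f.side b := fun h => b1 (by
    rw [← f.side_one] at h; rw [← hf.one]; exact (side_injective h).symm)
  have nP : f.top s ≠ f.E' := by
    intro h
    have h1 := f.top_y s
    rw [h] at h1
    refine s0 ?_
    rw [← f.fst_top s, h, fst_eq_iff, hO]
    exact N.symm f.y_OE
  have nOP : f.O ≠ f.top s := fun h => f.not_x_top s f.zero (h ▸ N.refl _ _)
  obtain ⟨g, hg⟩ := N.exists_dir f.O (f.top s)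
  have ngx : g ≠ f.x := by rintro rfl; exact f.not_x_top s f.zero (N.symm hg)
  -- a point `B` of the first axis is joined to `E'` by a parallel to `g` only if `B = -s`
  have hdir : ∀ B : f.K, f.dir B = g → s + B = 0 := by
    intro B h
    rw [← hf.add, ← hf.zero]
    exact proj_eq (f.dir_ne B) (h ▸ N.symm hg)
  have key : ∀ (P' : X), N.S g f.O P' → N.S f.x (f.side b) P' → ∀ B : f.K, B ≠ 0 → s + B ≠ 0 →
      ∃ e, N.S e B (f.top s) ∧ N.S e (B * b : f.K) P' := by
    intro P' h1 h2 B hB hsB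
    refine hP.dilation f.x_ne_y f.y_OE (f.side_y b) f.O_ne_E' nOA' nAA' (f.top_x s) nP hg h1 h2
      B.2 (B * b).2 ?_ (f.dir_spec B) ?_ (fun h => hsB (hdir B h))
    · exact fun h => hB (Subtype.ext (h.trans hO.symm))
    · rw [← hf.mul]; exact proj_spec (f.dir_ne _) _
  -- the image of `(s, 1)` is the point `p`
  have hgp : N.S g f.O p := by
    obtain ⟨P', h3, h4⟩ := N.meet ngx f.O (f.side b)
    obtain ⟨e, h5, h6⟩ := key P' h3 h4 s s0 (by rw [← two_mul]; exact mul_ne_zero h2 s0)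
    have : e = f.y := N.dir_unique h5 (f.top_y s) fun h => f.not_x_top s s (h ▸ N.refl _ _)
    rw [this, hsb] at h6
    have : P' = p := by
      by_contra hne
      exact f.x_ne_y (N.dir_unique (N.trans (N.symm h4) (N.symm hb))
        (N.trans (N.symm h6) (N.symm hc)) hne)
    exact this ▸ h3
  have main : ∀ a : f.K, a ≠ -(2 * s) → f.proj (f.dir a) p = c + a * b := by
    intro a ha
    have hB : N.S (f.dir a) (f.top s) (s + a : f.K) := by
      rw [← hf.add]; exact proj_spec (f.dir_ne _) _
    refine proj_eq (f.dir_ne a) ?_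
    rw [← hsb, ← add_mul]
    by_cases h0 : s + a = 0
    · rw [h0, zero_mul, hO]
      rw [h0, hO] at hB
      rw [N.dir_unique hB (N.symm hg) nOP.symm]
      exact N.symm hgp
    · obtain ⟨e, h5, h6⟩ := key p hgp (N.symm hb) (s + a) h0 (fun h => ha (by linear_combination h))
      have : e = f.dir a := N.dir_unique h5 (N.symm hB) fun h =>
        f.not_x_top s (s + a) (by rw [h]; exact N.refl _ _)
      exact this ▸ N.symm h6
  by_cases ha : a ≠ -(2 * s)
  · exact main a ha
  push Not at ha
  -- the exceptional value is recovered from the bijectivity of both sides as functions of `a`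
  obtain ⟨d, hd⟩ := N.exists_dir p (c + a * b : f.K)
  have hdx : d ≠ f.x := by
    rintro rfl
    refine b0 ?_
    rw [← hf.zero, snd_eq_iff, side_zero]
    exact N.trans hd (N.symm (c + a * b).2)
  obtain ⟨a', rfl⟩ := exists_eq_dir hdx
  suffices a = a' by rw [this]; exact proj_eq (f.dir_ne a') (this ▸ hd)
  by_contra hne
  have h3 := main a' fun h => hne (ha.trans h.symm)
  rw [proj_eq (f.dir_ne a') hd] at h3
  exact hne (mul_right_cancel₀ b0 (add_left_cancel h3))

end Linear

end Frame
end Net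

/-! ### The net of an affine plane -/

namespace PlaneData

variable {M : Type} (D : PlaneData M)

/-- Affine planes, with parallel lines those that are equal or disjoint. -/
structure IsAffine : Prop where
  incidence : D.IsIncidence
  exists_line : ∀ x, D.pt x → ∃ l, D.inc x l
  parallels : D.HasUniqueParallels
  par_iff : ∀ l k, D.par l k ↔ D.ln l ∧ D.ln k ∧ (l = k ∨ ¬ ∃ x, D.inc x l ∧ D.inc x k)

variable {D}

/-- If parallelism is a relation subject to axioms, as in the parallelity vocabulary, the axioms
force parallel lines to be the lines that are equal or disjoint. -/
theorem isAffine_of_isParallelism (hI : D.IsIncidence)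
    (hL : ∀ x, D.pt x → ∃ l, D.inc x l) (hU : D.HasUniqueParallels)
    (hP : D.IsParallelism) : D.IsAffine := by
  refine ⟨hI, hL, hU, fun l k => ⟨fun h => ?_, ?_⟩⟩
  · refine ⟨(hP.of_par l k h).1, (hP.of_par l k h).2, or_iff_not_imp_right.2 fun hx => ?_⟩
    obtain ⟨x, hx, hx'⟩ := not_not.1 hx
    exact hU.par_unique x k l k hx hx' h (hP.refl k (hP.of_par l k h).2)
  · rintro ⟨hl, hk, h⟩
    by_contra hne
    rcases h with rfl | h
    · exact hne (hP.refl l hl)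
    · exact h (hP.meet l k hl hk hne)

variable (hD : D.IsAffine)

namespace IsAffine

include hD

theorem ln_of_par {l k : M} (h : D.par l k) : D.ln l ∧ D.ln k :=
  ⟨((hD.par_iff l k).1 h).1, ((hD.par_iff l k).1 h).2.1⟩

theorem par_refl {l : M} (h : D.ln l) : D.par l l := (hD.par_iff l l).2 ⟨h, h, Or.inl rfl⟩

theorem par_symm {l k : M} (h : D.par l k) : D.par k l := by
  rw [hD.par_iff] at *
  refine ⟨h.2.1, h.1, h.2.2.imp Eq.symm fun h => ?_⟩
  rintro ⟨x, hx, hx'⟩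
  exact h ⟨x, hx', hx⟩

theorem eq_of_par {l k x : M} (h : D.par l k) (hx : D.inc x l) (hx' : D.inc x k) : l = k :=
  hD.parallels.par_unique x k l k hx hx' h (hD.par_refl (hD.ln_of_par h).2)

theorem par_trans {l k j : M} (h1 : D.par l k) (h2 : D.par k j) : D.par l j := by
  rw [hD.par_iff]
  refine ⟨(hD.ln_of_par h1).1, (hD.ln_of_par h2).2, or_iff_not_imp_right.2 fun h => ?_⟩
  obtain ⟨x, hx, hx'⟩ := not_not.1 h
  exact hD.parallels.par_unique x k l j hx hx' h1 (hD.par_symm h2)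

theorem meet {l k : M} (hl : D.ln l) (hk : D.ln k) (h : ¬ D.par l k) :
    ∃ x, D.inc x l ∧ D.inc x k := by
  by_contra hx
  exact h ((hD.par_iff l k).2 ⟨hl, hk, Or.inr hx⟩)

end IsAffine

/-- parallelism as an equivalence relation on the type of lines -/
def parSetoid (hD : D.IsAffine) : Setoid {l // D.ln l} where
  r l k := D.par l k
  iseqv := ⟨fun l => hD.par_refl l.2, fun h => hD.par_symm h, fun h h' => hD.par_trans h h'⟩

theorem IsAffine.quotient_eq_iff {l k : {l // D.ln l}} :
    (Quotient.mk (parSetoid hD) l = Quotient.mk (parSetoid hD) k) ↔ D.par l k :=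
  Quotient.eq

/-- The points and the parallel classes of an affine plane form a net. -/
def net (hD : D.IsAffine) : Net {x // D.pt x} (Quotient (parSetoid hD)) where
  S d p q := ∃ l, Quotient.mk _ l = d ∧ D.inc p l ∧ D.inc q l
  refl := by
    intro d p
    obtain ⟨l, rfl⟩ := Quotient.exists_rep d
    obtain ⟨k, hk, hkl⟩ := hD.parallels.exists_par p l p.2 l.2
    exact ⟨⟨k, (hD.ln_of_par hkl).1⟩, hD.quotient_eq_iff.2 hkl, hk, hk⟩
  symm := by
    rintro d p q ⟨l, h, hp, hq⟩
    exact ⟨l, h, hq, hp⟩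
  trans := by
    rintro d p q r ⟨l, rfl, hp, hq⟩ ⟨k, hk, hq', hr⟩
    have : l.1 = k.1 := hD.eq_of_par (hD.quotient_eq_iff.1 hk.symm) hq hq'
    exact ⟨l, rfl, hp, this ▸ hr⟩
  exists_dir := by
    intro p q
    have h : ∃ l, D.inc p l ∧ D.inc q l := by
      by_cases hpq : p = q
      · obtain ⟨l, hl⟩ := hD.exists_line p p.2
        exact ⟨l, hl, hpq ▸ hl⟩
      · exact hD.incidence.exists_join p q p.2 q.2 fun h => hpq (Subtype.ext h)
    obtain ⟨l, hl, hl'⟩ := h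
    exact ⟨_, ⟨l, (hD.incidence.of_inc _ _ hl).2⟩, rfl, hl, hl'⟩
  dir_unique := by
    rintro _ _ p q ⟨l, rfl, hp, hq⟩ ⟨k, rfl, hp', hq'⟩ hpq
    have : l = k := Subtype.ext (hD.incidence.join_unique p q l k (fun h => hpq (Subtype.ext h))
      hp hq hp' hq')
    rw [this]
  meet := by
    intro d d' hdd p q
    obtain ⟨l, rfl⟩ := Quotient.exists_rep d
    obtain ⟨k, rfl⟩ := Quotient.exists_rep d'
    obtain ⟨l', hl', hll⟩ := hD.parallels.exists_par p l p.2 l.2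
    obtain ⟨k', hk', hkk⟩ := hD.parallels.exists_par q k q.2 k.2
    have hn : ¬ D.par l' k' := fun h => hdd (hD.quotient_eq_iff.2
      (hD.par_trans (hD.par_symm hll) (hD.par_trans h hkk)))
    obtain ⟨x, hx, hx'⟩ := hD.meet (hD.ln_of_par hll).1 (hD.ln_of_par hkk).1 hn
    exact ⟨⟨x, (hD.incidence.of_inc _ _ hx).1⟩,
      ⟨⟨l', (hD.ln_of_par hll).1⟩, hD.quotient_eq_iff.2 hll, hl', hx⟩,
      ⟨⟨k', (hD.ln_of_par hkk).1⟩, hD.quotient_eq_iff.2 hkk, hk', hx'⟩⟩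

variable {hD}

theorem net_S_iff_of_mem {d : Quotient (parSetoid hD)} {p q : {x // D.pt x}} {l : {l // D.ln l}}
    (hl : Quotient.mk _ l = d) (hp : D.inc p l) : (net hD).S d p q ↔ D.inc q l := by
  constructor
  · rintro ⟨k, rfl, hk, hk'⟩
    rw [hD.eq_of_par (hD.quotient_eq_iff.1 hl) hp hk]
    exact hk'
  · intro hq
    exact ⟨l, hl, hp, hq⟩

theorem joinPar_iff {p q r s : {x // D.pt x}} :
    D.JoinPar p q r s ↔ ∃ d, (net hD).S d p q ∧ (net hD).S d r s := by
  constructor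
  · rintro ⟨l, k, h1, h2, h3, h4, h⟩
    have h' := hD.ln_of_par h
    exact ⟨_, ⟨⟨l, h'.1⟩, rfl, h1, h2⟩, ⟨⟨k, h'.2⟩, (hD.quotient_eq_iff.2 h).symm, h3, h4⟩⟩
  · rintro ⟨d, ⟨l, rfl, h1, h2⟩, ⟨k, hk, h3, h4⟩⟩
    exact ⟨l, k, h1, h2, h3, h4, hD.quotient_eq_iff.1 hk.symm⟩

theorem coll_iff {d : Quotient (parSetoid hD)} {p q r : {x // D.pt x}} (hpq : p ≠ q)
    (h : (net hD).S d p q) : D.Coll p q r ↔ (net hD).S d p r := by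
  constructor
  · rintro ⟨l, h1, h2, h3⟩
    have hl := (hD.incidence.of_inc _ _ h1).2
    have h' : (net hD).S (Quotient.mk _ ⟨l, hl⟩) p q := ⟨⟨l, hl⟩, rfl, h1, h2⟩
    rw [(net hD).dir_unique h h' hpq]
    exact ⟨⟨l, hl⟩, rfl, h1, h3⟩
  · rintro hr
    obtain ⟨l, rfl, h1, h2⟩ := h
    exact ⟨l, h1, h2, (net_S_iff_of_mem rfl h1).1 hr⟩

theorem Pappus.net (hP : D.Pappus) : (net hD).Pappus := by
  intro l k A₁ A₂ A₃ B₁ B₂ B₃ h1 h2 h3 h4 hlk hinj d₁ d₂ h5 h6 h7 h8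
  rw [← joinPar_iff]
  obtain ⟨l, rfl, hA1, hA2⟩ := h1
  obtain ⟨k, rfl, hB1, hB2⟩ := h3
  rw [net_S_iff_of_mem rfl hA1] at h2
  rw [net_S_iff_of_mem rfl hB1] at h4
  refine hP ![A₁, A₂, A₃] ![B₁, B₂, B₃] l k ?_ ?_ ?_ ?_ (joinPar_iff.2 ⟨d₁, h5, h6⟩)
    (joinPar_iff.2 ⟨d₂, h7, h8⟩)
  · convert Subtype.val_injective.comp hinj using 1
    ext i; fin_cases i <;> rfl
  · intro h
    rw [← Subtype.ext_iff] at h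
    subst h
    rcases hlk with hlk | hlk
    · exact hlk rfl
    · exact hlk ((net_S_iff_of_mem rfl hA1).2 hB1)
  · intro i; fin_cases i <;> assumption
  · intro i; fin_cases i <;> assumption

theorem DesarguesParallel.net (hP : D.DesarguesParallel) : (net hD).DesarguesParallel := by
  intro x A A' B B' C C' h1 h2 h3 h4 h5 h6 d e h7 h8 h9 h10
  rw [← joinPar_iff]
  obtain ⟨a, rfl, ha, ha'⟩ := h1
  obtain ⟨b, hb, hb1, hb'⟩ := h2
  obtain ⟨c, hc, hc1, hc'⟩ := h3
  have hbc := hD.quotient_eq_iff.1 (hb.trans hc.symm)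
  rw [net_S_iff_of_mem rfl ha] at h4 h5
  rw [net_S_iff_of_mem hb hb1] at h6
  refine hP A B C A' B' C' a b c ?_ ?_ ?_ (hD.par_symm (hD.quotient_eq_iff.1 hb))
    (hD.par_symm (hD.quotient_eq_iff.1 hc)) hbc ha ha' hb1 hb' hc1 hc'
    (joinPar_iff.2 ⟨d, h7, h8⟩) (joinPar_iff.2 ⟨e, h9, h10⟩)
  · intro h; exact h4 (h ▸ hb1)
  · intro h; exact h5 (h ▸ hc1)
  · intro h; exact h6 (h ▸ hc1)

end PlaneData

/-! ### The field of a frame -/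

namespace Net.Frame

variable {X Δ : Type} {N : Net X Δ} (f : N.Frame)

/-- The geometric operations as a structure for the language of rings. -/
@[reducible] noncomputable def ringStructure : Language.ring.Structure f.K where
  funMap := fun {n} g =>
    match n, g with
    | _, ringFunc.add => fun v => f.add (v 0) (v 1)
    | _, ringFunc.mul => fun v => f.mul (v 0) (v 1)
    | _, ringFunc.neg => fun v => f.neg (v 0)
    | _, ringFunc.zero => fun _ => f.zero
    | _, ringFunc.one => fun _ => f.one
  RelMap := fun R => Empty.elim R

end Net.Frame

namespace PlaneData

variable {M : Type} {D : PlaneData M} {hD : D.IsAffine}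

theorem exists_pt_of_joinPar {p q r s : M} (hD : D.IsAffine) (h : D.JoinPar p q r s) :
    D.pt q := by
  obtain ⟨l, k, h1, h2, -⟩ := h
  exact (hD.incidence.of_inc _ _ h2).1

theorem frame_of_net (f : (net hD).Frame) : D.Frame f.O f.E f.E' := by
  refine ⟨f.O.2, f.E.2, f.E'.2, fun h => ?_⟩
  rw [coll_iff f.O_ne_E f.x_OE] at h
  exact f.not_x_E' f.zero ((net hD).symm h)

/-- The formula for addition defines the operation `Net.Frame.add`. -/
theorem addRel_iff (f : (net hD).Frame) (a b c : f.K) :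
    D.AddRel f.O f.E f.E' a.1 b.1 c.1 ↔ f.add a b = c := by
  have hO : f.O ≠ f.E := f.O_ne_E
  rw [AddRel, coll_iff hO f.x_OE, coll_iff hO f.x_OE, coll_iff hO f.x_OE]
  constructor
  · rintro ⟨-, -, -, P, h1, h2, h3⟩
    obtain ⟨P, rfl⟩ : ∃ P' : {x // D.pt x}, P'.1 = P := ⟨⟨P, exists_pt_of_joinPar hD h1⟩, rfl⟩
    rw [joinPar_iff (hD := hD)] at h1 h2 h3
    obtain ⟨d₁, h1, h1'⟩ := h1
    obtain ⟨d₂, h2, h2'⟩ := h2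
    obtain ⟨d₃, h3, h3'⟩ := h3
    obtain rfl := (net hD).dir_unique h1' f.x_OE hO
    obtain rfl := (net hD).dir_unique h2' f.y_OE f.O_ne_E'
    obtain rfl := Net.Frame.eq_dir h3'
    have hP : P = f.top a := by
      by_contra hne
      exact f.x_ne_y ((net hD).dir_unique ((net hD).trans ((net hD).symm h1) (f.top_x a))
        ((net hD).trans ((net hD).symm h2) (f.top_y a)) hne)
    subst hP
    exact Net.Frame.proj_eq (f.dir_ne b) h3
  · rintro rfl
    refine ⟨a.2, b.2, (f.add a b).2, f.top a, ?_⟩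
    rw [joinPar_iff (hD := hD), joinPar_iff (hD := hD), joinPar_iff (hD := hD)]
    exact ⟨⟨f.x, f.top_x a, f.x_OE⟩, ⟨f.y, f.top_y a, f.y_OE⟩,
      ⟨f.dir b, Net.Frame.proj_spec (f.dir_ne b) _, f.dir_spec b⟩⟩

/-- The formula for multiplication defines the operation `Net.Frame.mul`. -/
theorem mulRel_iff (f : (net hD).Frame) (a b c : f.K) :
    D.MulRel f.O f.E f.E' a.1 b.1 c.1 ↔ f.mul a b = c := by
  have hO : f.O ≠ f.E := f.O_ne_E
  rw [MulRel, coll_iff hO f.x_OE, coll_iff hO f.x_OE, coll_iff hO f.x_OE]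
  have hEE' : f.E ≠ f.E' := fun h => f.not_x_E' f.one (h ▸ (net hD).refl _ _)
  constructor
  · rintro ⟨-, -, -, Q, h1, h2, h3⟩
    obtain ⟨Q, rfl⟩ : ∃ P' : {x // D.pt x}, P'.1 = Q := ⟨⟨Q, exists_pt_of_joinPar hD h2⟩, rfl⟩
    rw [joinPar_iff (hD := hD)] at h2 h3
    rw [coll_iff f.O_ne_E' f.y_OE] at h1
    obtain ⟨d₂, h2, h2'⟩ := h2
    obtain ⟨d₃, h3, h3'⟩ := h3
    obtain rfl := Net.Frame.eq_dir (a := f.one) ((net hD).symm h2')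
    obtain rfl := Net.Frame.eq_dir h3'
    have hQ : Q = f.side b := by
      by_contra hne
      exact f.dir_one_ne_y ((net hD).dir_unique ((net hD).trans ((net hD).symm h2) (f.side_z b))
        ((net hD).trans ((net hD).symm h1) (f.side_y b)) hne)
    subst hQ
    exact Net.Frame.proj_eq (f.dir_ne a) h3
  · rintro rfl
    refine ⟨a.2, b.2, (f.mul a b).2, f.side b, ?_⟩
    rw [joinPar_iff (hD := hD), joinPar_iff (hD := hD), coll_iff f.O_ne_E' f.y_OE]
    exact ⟨f.side_y b, ⟨_, f.side_z b, (net hD).symm (f.dir_spec f.one)⟩,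
      ⟨f.dir a, Net.Frame.proj_spec (f.dir_ne a) _, f.dir_spec a⟩⟩

theorem isInterpretation_net (f : (net hD).Frame) :
    letI := f.ringStructure
    IsInterpretation D f.O.1 f.E.1 f.E'.1 (fun a : f.K => a.1.1) := by
  let _ := f.ringStructure
  refine ⟨fun a b h => Subtype.ext (Subtype.ext h), fun x => ?_, rfl, rfl,
    fun a b c => addRel_iff f a b c, fun a b c => mulRel_iff f a b c, fun a b => ?_⟩
  · constructor
    · intro h
      obtain ⟨l, h1, h2, h3⟩ := id h
      have hx := (hD.incidence.of_inc _ _ h3).1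
      exact ⟨⟨⟨x, hx⟩, (coll_iff (r := ⟨x, hx⟩) f.O_ne_E f.x_OE).1 h⟩, rfl⟩
    · rintro ⟨t, rfl⟩
      exact (coll_iff f.O_ne_E f.x_OE).2 t.2
  · exact (addRel_iff f a b f.zero).trans (f.add_eq_zero_iff a b)

end PlaneData

section Field

variable {L : FirstOrder.Language.{0, 0}} [PlaneVocabulary L] {M : Type} [L.Structure M]

/-- The incidence axioms alone do not provide a line through a point: they do not require the
three non-collinear points to be distinct, and hold if there is one point and no line. The
translated axiom `∃ x y, x ≠ y` excludes this, because then `x`, `x`, `x` is a frame without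
points on its axis. -/
theorem exists_line_of_translate (hT : M ⊨ translate L '' Theory.ACF 0) (x : M)
    (hx : (planeData L M).pt x) : ∃ l, (planeData L M).inc x l := by
  by_contra! hl
  have hc : ∀ a, ¬ (planeData L M).Coll x x a := by
    rintro a ⟨l, h, -⟩
    exact hl l h
  have hmem : Field.FieldAxiom.existsPairNE.toSentence ∈ Theory.ACF 0 :=
    Set.mem_union_left _ (Set.mem_union_left _ ⟨_, rfl⟩)
  have h1 := (Theory.model_iff _).1 hT _ (Set.mem_image_of_mem _ hmem)
  rw [realize_translate_iff] at h1
  have h2 := h1 x x x ⟨hx, hx, hx, hc x⟩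
  refine h2 fun a ha => absurd ?_ (hc a)
  simpa using ha

variable [LawfulPlaneVocabulary L]

/-- The field of a frame of a plane satisfying the translated axioms. -/
theorem exists_field_of_translate {hD : (planeData L M).IsAffine}
    (hT : M ⊨ translate L '' Theory.ACF 0) (f : (PlaneData.net hD).Frame) :
    ∃ _ : Field f.K, IsAlgClosed f.K ∧ CharZero f.K ∧ f.Compatible := by
  let _ := f.ringStructure
  have hK : f.K ⊨ Theory.ACF 0 := by
    refine (Theory.model_iff _).2 fun σ hσ => ?_
    have h1 := (Theory.model_iff _).1 hT _ (Set.mem_image_of_mem _ hσ)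
    rw [realize_translate_iff] at h1
    exact ((PlaneData.isInterpretation_net f).realize_translateF_sentence σ).1
      (h1 _ _ _ (PlaneData.frame_of_net f))
  have := Field.modelField_of_modelACF 0 f.K
  let hF : Field f.K := Field.fieldOfModelField f.K
  let _ : Ring.CompatibleRing f.K := Field.compatibleRingOfModelField f.K
  have := Field.charP_of_model_fieldOfChar 0 f.K
  exact ⟨hF, Field.isAlgClosed_of_model_ACF 0 f.K, CharP.charP_to_charZero f.K,
    ⟨fun _ _ => rfl, fun _ _ => rfl, rfl, rfl⟩⟩

end Field

/-! ### Charts -/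

/-- A coordinate system over the field `F` in which the lines are the solution sets of linear
equations. -/
structure Chart {M : Type} (D : PlaneData M) (F : Type) [Field F] where
  toEquiv : {x // D.pt x} ≃ F × F
  exists_eqn : ∀ l, D.ln l → ∃ a b c : F, (a ≠ 0 ∨ b ≠ 0) ∧
    ∀ p, D.inc p.1 l ↔ a * (toEquiv p).1 + b * (toEquiv p).2 + c = 0
  exists_ln : ∀ a b c : F, (a ≠ 0 ∨ b ≠ 0) → ∃ l, D.ln l ∧
    ∀ p, D.inc p.1 l ↔ a * (toEquiv p).1 + b * (toEquiv p).2 + c = 0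

namespace PlaneData

variable {M : Type} {D : PlaneData M} {hD : D.IsAffine}

/-- Non-collinear points form a frame of the net. -/
theorem exists_frame {O E E' : {x // D.pt x}} (h : ¬ D.Coll O E E') :
    ∃ f : (net hD).Frame, f.O = O ∧ f.E = E ∧ f.E' = E' := by
  obtain ⟨x, hx⟩ := (net hD).exists_dir O E
  obtain ⟨y, hy⟩ := (net hD).exists_dir O E'
  have nE : O ≠ E := by
    rintro rfl
    obtain ⟨l, -, h1, h2⟩ := hy
    exact h ⟨l, h1, h1, h2⟩
  have nE' : O ≠ E' := by
    rintro rfl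
    obtain ⟨l, -, h1, h2⟩ := hx
    exact h ⟨l, h1, h2, h1⟩
  refine ⟨⟨x, y, O, E, E', ?_, hx, hy, nE, nE'⟩, rfl, rfl, rfl⟩
  rintro rfl
  exact h ((coll_iff nE hx).2 hy)

theorem exists_ln_of_net (d : Quotient (parSetoid hD)) (p : {x // D.pt x}) :
    ∃ l, D.ln l ∧ ∀ q : {x // D.pt x}, D.inc q l ↔ (net hD).S d p q := by
  obtain ⟨l, rfl, hl, -⟩ := (net hD).refl d p
  exact ⟨l, l.2, fun q => (net_S_iff_of_mem rfl hl).symm⟩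

/-- The coordinates of a frame whose projections to the first axis are linear. -/
noncomputable def chartOfFrame (f : (net hD).Frame) [Field f.K]
    (h : ∀ a p, f.proj (f.dir a) p = f.fst p + a * f.snd p) : Chart D f.K where
  toEquiv := Equiv.ofBijective (fun p => (f.fst p, f.snd p)) (by
    constructor
    · intro p q hpq
      exact f.coord_ext (congrArg Prod.fst hpq) (congrArg Prod.snd hpq)
    · rintro ⟨a, b⟩
      obtain ⟨p, h1, h2⟩ := f.exists_coord a b
      exact ⟨p, Prod.ext h1 h2⟩)
  exists_eqn := by
    intro l hl
    obtain ⟨p, -, -, hp, -⟩ := hD.incidence.exists_two l hl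
    have hp' := (hD.incidence.of_inc _ _ hp).1
    have key : ∀ q : {x // D.pt x}, D.inc q l ↔
        (net hD).S (Quotient.mk _ ⟨l, hl⟩) ⟨p, hp'⟩ q :=
      fun q => (net_S_iff_of_mem (p := ⟨p, hp'⟩) (l := ⟨l, hl⟩) rfl hp).symm
    by_cases hx : Quotient.mk _ ⟨l, hl⟩ = f.x
    · refine ⟨0, 1, -f.snd ⟨p, hp'⟩, Or.inr one_ne_zero, fun q => ?_⟩
      rw [key, hx, ← f.snd_eq_snd_iff, eq_comm, ← sub_eq_zero]
      simp [sub_eq_add_neg]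
      rfl
    · obtain ⟨a, ha⟩ := Net.Frame.exists_eq_dir hx
      refine ⟨1, a, -f.proj (f.dir a) ⟨p, hp'⟩, Or.inl one_ne_zero, fun q => ?_⟩
      rw [key, ha, ← Net.Frame.proj_eq_proj_iff (f.dir_ne _), h a q, eq_comm, ← sub_eq_zero]
      simp [sub_eq_add_neg]
      rfl
  exists_ln := by
    intro α β γ hαβ
    by_cases hα : α = 0
    · have hβ : β ≠ 0 := hαβ.resolve_left (not_not.2 hα)
      obtain ⟨p, -, hp⟩ := f.exists_coord 0 (-γ / β)
      obtain ⟨l, hl, hl'⟩ := exists_ln_of_net f.x p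
      refine ⟨l, hl, fun q => ?_⟩
      change _ ↔ α * f.fst q + β * f.snd q + γ = 0
      rw [hl', ← f.snd_eq_snd_iff, hp]
      simp only [hα, zero_mul, zero_add]
      rw [div_eq_iff hβ, eq_comm, mul_comm, eq_neg_iff_add_eq_zero]
    · obtain ⟨p, hp, hp'⟩ := f.exists_coord (-γ / α) 0
      obtain ⟨l, hl, hl'⟩ := exists_ln_of_net (f.dir (β / α)) p
      refine ⟨l, hl, fun q => ?_⟩
      change _ ↔ α * f.fst q + β * f.snd q + γ = 0
      rw [hl', ← Net.Frame.proj_eq_proj_iff (f.dir_ne _), h, h, hp, hp']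
      simp only [mul_zero, add_zero]
      rw [div_eq_iff hα, eq_comm, ← sub_eq_zero]
      field_simp
      rw [sub_neg_eq_add]

end PlaneData

namespace Chart

variable {M : Type} {D : PlaneData M} {F : Type} [Field F] (φ : Chart D F)

/-- Rescaling of the second coordinate. -/
def scale (s : F) (hs : s ≠ 0) : Chart D F where
  toEquiv := φ.toEquiv.trans (Equiv.prodCongr (Equiv.refl F) (Equiv.mulLeft₀ s hs))
  exists_eqn := by
    intro l hl
    obtain ⟨a, b, c, hab, h⟩ := φ.exists_eqn l hl
    refine ⟨a, b / s, c, hab.imp id fun h => div_ne_zero h hs, fun p => (h p).trans ?_⟩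
    simp [div_mul_eq_mul_div, mul_div_assoc, hs]
  exists_ln := by
    intro a b c hab
    obtain ⟨l, hl, h⟩ := φ.exists_ln a (b * s) c (hab.imp id fun h => mul_ne_zero h hs)
    refine ⟨l, hl, fun p => (h p).trans ?_⟩
    simp [mul_assoc]

theorem scale_apply (s : F) (hs : s ≠ 0) (p : {x // D.pt x}) :
    (φ.scale s hs).toEquiv p = ((φ.toEquiv p).1, s * (φ.toEquiv p).2) := rfl

/-- the set of coordinates of the points of a line, as a line of the Cartesian plane -/
def lineMap (l : {l // D.ln l}) : CartesianLine F :=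
  ⟨{v | D.inc (φ.toEquiv.symm v).1 l}, by
    obtain ⟨a, b, c, hab, h⟩ := φ.exists_eqn l l.2
    refine ⟨a, b, c, hab, Set.ext fun v => ?_⟩
    simp [h]⟩

theorem mem_lineMap {l : {l // D.ln l}} {p : {x // D.pt x}} :
    φ.toEquiv p ∈ (φ.lineMap l).1 ↔ D.inc p.1 l := by
  change D.inc (φ.toEquiv.symm (φ.toEquiv p)).1 l ↔ _
  rw [Equiv.symm_apply_apply]

theorem lineMap_bijective (hD : D.IsAffine) : Function.Bijective φ.lineMap := by
  constructor
  · intro l k h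
    obtain ⟨x, y, hxy, hx, hy⟩ := hD.incidence.exists_two l l.2
    have key : ∀ x, D.inc x l → D.inc x k := by
      intro x hx
      have hp := (hD.incidence.of_inc _ _ hx).1
      rw [← φ.mem_lineMap (p := ⟨x, hp⟩), ← h, φ.mem_lineMap]
      exact hx
    exact Subtype.ext (hD.incidence.join_unique x y l k hxy hx hy (key x hx) (key y hy))
  · rintro ⟨s, a, b, c, hab, rfl⟩
    obtain ⟨l, hl, h⟩ := φ.exists_ln a b c hab
    refine ⟨⟨l, hl⟩, Subtype.ext (Set.ext fun v => ?_)⟩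
    refine (h (φ.toEquiv.symm v)).trans ?_
    simp

end Chart

/-- Isomorphisms of planes, on the level of points, lines and incidence. -/
structure PlaneIso {M M' : Type} (D : PlaneData M) (D' : PlaneData M') extends M ≃ M' where
  pt_iff : ∀ x, D'.pt (toEquiv x) ↔ D.pt x
  ln_iff : ∀ x, D'.ln (toEquiv x) ↔ D.ln x
  inc_iff : ∀ x l, D'.inc (toEquiv x) (toEquiv l) ↔ D.inc x l

theorem PlaneIso.par_iff {M M' : Type} {D : PlaneData M} {D' : PlaneData M'} (e : PlaneIso D D')
    (hD : D.IsAffine) (hD' : D'.IsAffine) (l k : M) :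
    D'.par (e.toEquiv l) (e.toEquiv k) ↔ D.par l k := by
  rw [hD.par_iff, hD'.par_iff, e.ln_iff, e.ln_iff, e.toEquiv.apply_eq_iff_eq,
    ← e.toEquiv.exists_congr_right]
  simp only [e.inc_iff]

variable (F : Type) [Field F] in
theorem cartesianData_isAffine : (cartesianData F).IsAffine :=
  PlaneData.isAffine_of_isParallelism (cartesianData_isIncidence F)
    (by
      rintro _ ⟨p, rfl⟩
      obtain ⟨l, hl⟩ := exists_line_hasDirection p (u := ((1 : F), 0)) (by simp)
      exact ⟨Sum.inr l, by simpa using hl.mem⟩)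
    (cartesianData_hasUniqueParallels F) (cartesianData_isParallelism F)

/-- A chart is an isomorphism to the Cartesian plane. -/
theorem Chart.exists_planeIso {M : Type} {D : PlaneData M} {F : Type} [Field F] (φ : Chart D F)
    (hD : D.IsAffine) : ∃ e : PlaneIso D (cartesianData F),
      (∀ p : {x // D.pt x}, e.toEquiv p = Sum.inl (φ.toEquiv p)) ∧
      ∀ l : {l // D.ln l}, e.toEquiv l = Sum.inr (φ.lineMap l) := by
  classical
  have hln : ∀ x, ¬ D.pt x ↔ D.ln x := fun x =>
    ⟨(hD.incidence.pt_or_ln x).resolve_left, fun h h' => hD.incidence.not_ln x h' h⟩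
  let e : M ≃ CartesianPlane F :=
    (Equiv.sumCompl D.pt).symm.trans (Equiv.sumCongr φ.toEquiv
      ((Equiv.subtypeEquivRight hln).trans (Equiv.ofBijective _ (φ.lineMap_bijective hD))))
  have h1 : ∀ p : {x // D.pt x}, e p = Sum.inl (φ.toEquiv p) := by
    intro p
    exact congrArg (Equiv.sumCongr φ.toEquiv _) (Equiv.sumCompl_symm_apply_pos (p := D.pt) p)
  have h2 : ∀ l : {l // D.ln l}, e l = Sum.inr (φ.lineMap l) := by
    intro l
    exact congrArg (Equiv.sumCongr φ.toEquiv _)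
      (Equiv.sumCompl_symm_apply_of_neg (p := D.pt) ((hln l).2 l.2))
  have pt_iff : ∀ x, (cartesianData F).pt (e x) ↔ D.pt x := by
    intro x
    by_cases hx : D.pt x
    · exact iff_of_true ⟨_, h1 ⟨x, hx⟩⟩ hx
    · refine iff_of_false ?_ hx
      rintro ⟨p, hp⟩
      rw [h2 ⟨x, (hln x).1 hx⟩] at hp
      exact Sum.inr_ne_inl hp
  have ln_iff : ∀ x, (cartesianData F).ln (e x) ↔ D.ln x := by
    intro x
    by_cases hx : D.ln x
    · exact iff_of_true ⟨_, h2 ⟨x, hx⟩⟩ hx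
    · refine iff_of_false ?_ hx
      rintro ⟨p, hp⟩
      rw [h1 ⟨x, (hD.incidence.pt_or_ln x).resolve_right hx⟩] at hp
      exact Sum.inl_ne_inr hp
  have inc_iff : ∀ x l, (cartesianData F).inc (e x) (e l) ↔ D.inc x l := by
    intro x l
    by_cases hx : D.pt x ∧ D.ln l
    · rw [h1 ⟨x, hx.1⟩, h2 ⟨l, hx.2⟩, cartesianData_inc_inl_inr, φ.mem_lineMap]
    · refine iff_of_false (fun h => hx ?_) (fun h => hx (hD.incidence.of_inc _ _ h))
      have := (cartesianData_isIncidence F).of_inc _ _ h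
      rwa [pt_iff, ln_iff] at this
  exact ⟨⟨e, pt_iff, ln_iff, inc_iff⟩, h1, h2⟩

/-! ### Orthogonality in coordinates -/

/-- Isomorphisms transport orthogonality relations. -/
theorem PlaneData.IsOrthogonality.map {M M' : Type} {D : PlaneData M} {D' : PlaneData M'}
    {perp : M → M → Prop} (h : D.IsOrthogonality perp) (e : PlaneIso D D') (hD : D.IsAffine)
    (hD' : D'.IsAffine) :
    D'.IsOrthogonality fun l k => perp (e.toEquiv.symm l) (e.toEquiv.symm k) := by
  have pt : ∀ x, D'.pt x ↔ D.pt (e.toEquiv.symm x) := fun x => by rw [← e.pt_iff]; simp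
  have ln : ∀ x, D'.ln x ↔ D.ln (e.toEquiv.symm x) := fun x => by rw [← e.ln_iff]; simp
  have inc : ∀ x l, D'.inc x l ↔ D.inc (e.toEquiv.symm x) (e.toEquiv.symm l) := fun x l => by
    rw [← e.inc_iff]; simp
  have par : ∀ x l, D'.par x l ↔ D.par (e.toEquiv.symm x) (e.toEquiv.symm l) := fun x l => by
    rw [← e.par_iff hD hD']; simp
  have coll : ∀ x y z, D'.Coll x y z ↔
      D.Coll (e.toEquiv.symm x) (e.toEquiv.symm y) (e.toEquiv.symm z) := fun x y z => by
    simp only [PlaneData.Coll, inc]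
    exact e.toEquiv.symm.exists_congr_right
      (q := fun l => D.inc (e.toEquiv.symm x) l ∧ D.inc (e.toEquiv.symm y) l ∧
        D.inc (e.toEquiv.symm z) l)
  refine ⟨fun l k hp => ?_, fun l k => h.symm _ _, fun x l hx hl => ?_,
    fun x l k k' h1 h2 h3 h4 => ?_, fun l k k' h1 h2 => ?_, fun x hx => ?_, ?_⟩
  · rw [ln, ln]; exact h.of_perp _ _ hp
  · obtain ⟨k, h1, h2⟩ := h.exists_perp _ _ ((pt x).1 hx) ((ln l).1 hl)
    exact ⟨e.toEquiv k, by simpa using h1, by simpa [inc] using h2⟩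
  · exact e.toEquiv.symm.injective
      (h.perp_unique _ _ _ _ h1 ((inc _ _).1 h2) h3 ((inc _ _).1 h4))
  · rw [par]; exact h.par_of_perp _ _ _ h1 h2
  · obtain ⟨k, h1, h2⟩ := h.exists_not_perp_self _ ((pt x).1 hx)
    exact ⟨e.toEquiv k, by simpa [inc] using h1, by simpa using h2⟩
  · intro A B C a b c f g j hA hB hC hABC h1 h2 h3 h4 h5 h6 h7 h8 h9 h10 h11 h12
    rw [inc] at h1 h2 h3 h4 h5 h6 h7 h9 h11
    rw [pt] at hA hB hC
    rw [coll] at hABC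
    obtain ⟨H, k1, k2, k3⟩ := h.heights _ _ _ _ _ _ _ _ _ hA hB hC hABC h1 h2 h3 h4 h5 h6 h7 h8
      h9 h10 h11 h12
    exact ⟨e.toEquiv H, by simpa [inc] using k1, by simpa [inc] using k2, by simpa [inc] using k3⟩

section Form

variable {F : Type} [Field F]

/-- Some lines with direction vectors `u`, `w` are in the relation `R`. In the presence of the
orthogonality axioms, then all such lines are (`perp_iff_vperp`). -/
def VPerp (R : CartesianPlane F → CartesianPlane F → Prop) (u w : F × F) : Prop :=
  ∃ l k p q, HasDirection l p u ∧ HasDirection k q w ∧ R (Sum.inr l) (Sum.inr k)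

variable {R : CartesianPlane F → CartesianPlane F → Prop}
  (hR : (cartesianData F).IsOrthogonality R)

include hR

theorem VPerp.symm {u w : F × F} (h : VPerp R u w) : VPerp R w u := by
  obtain ⟨l, k, p, q, hl, hk, h⟩ := h
  exact ⟨k, l, q, p, hk, hl, (hR.symm _ _).1 h⟩

/-- Orthogonality is inherited by parallels. -/
theorem perp_of_par {l k k' : CartesianLine F} {q q' w w' : F × F}
    (h : R (Sum.inr l) (Sum.inr k)) (hk : HasDirection k q w) (hk' : HasDirection k' q' w')
    (hw : cross w w' = 0) : R (Sum.inr l) (Sum.inr k') := by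
  obtain ⟨j, hj, hj'⟩ := hR.exists_perp (Sum.inl q') (Sum.inr l) ⟨q', rfl⟩ ⟨l, rfl⟩
  have h1 := (cartesianData_isAffine F).par_trans (hR.par_of_perp _ _ _ hj h)
    ((cartesianData_par_iff hk hk').2 hw)
  rwa [(cartesianData_isAffine F).eq_of_par h1 hj' (by simpa using hk'.mem)] at hj

theorem perp_iff_vperp {l k : CartesianLine F} {p q u w : F × F}
    (hl : HasDirection l p u) (hk : HasDirection k q w) :
    R (Sum.inr l) (Sum.inr k) ↔ VPerp R u w := by
  refine ⟨fun h => ⟨l, k, p, q, hl, hk, h⟩, ?_⟩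
  rintro ⟨l', k', p', q', hl', hk', h⟩
  refine (hR.symm _ _).1 (perp_of_par hR ((hR.symm _ _).1 ?_) hl' hl (by rw [cross]; ring))
  exact perp_of_par hR h hk' hk (by rw [cross]; ring)

theorem VPerp.cross_eq_zero {u w w' : F × F} (h : VPerp R u w) (h' : VPerp R u w') :
    cross w w' = 0 := by
  obtain ⟨l, k, p, q, hl, hk, h⟩ := h
  obtain ⟨-, k', -, q', -, hk', -⟩ := id h'
  rw [← perp_iff_vperp hR hl hk'] at h'
  exact (cartesianData_par_iff hk hk').1 (hR.par_of_perp _ _ _ h h')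

theorem VPerp.of_cross {u w w' : F × F} (h : VPerp R u w) (hw' : w' ≠ 0) (hw : cross w w' = 0) :
    VPerp R u w' := by
  obtain ⟨l, k, p, q, hl, hk, h⟩ := h
  obtain ⟨k', hk'⟩ := exists_line_hasDirection 0 hw'
  exact ⟨l, k', p, 0, hl, hk', perp_of_par hR h hk hk' hw⟩

theorem VPerp.right_iff {u w w' : F × F} (h : VPerp R u w) (hw' : w' ≠ 0) :
    VPerp R u w' ↔ cross w w' = 0 :=
  ⟨fun h' => h.cross_eq_zero hR h', h.of_cross hR hw'⟩

theorem exists_vperp {u : F × F} (hu : u ≠ 0) : ∃ w, VPerp R u w := by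
  obtain ⟨l, hl⟩ := exists_line_hasDirection 0 hu
  obtain ⟨k, hk, hk'⟩ := hR.exists_perp (Sum.inl 0) (Sum.inr l) ⟨_, rfl⟩ ⟨_, rfl⟩
  obtain ⟨-, k, -, rfl, -⟩ := cartesianData_inc hk'
  obtain ⟨q, w, hw⟩ := exists_hasDirection k
  exact ⟨w, l, k, 0, q, hl, hw, hk⟩

/-- A direction orthogonal to one that is not an axis is not an axis. -/
theorem VPerp.slope_ne_zero {m : F} {w : F × F} (h : VPerp R (1, m) w)
    (h0 : VPerp R (1, 0) (0, 1)) (hm : m ≠ 0) : w.1 ≠ 0 ∧ w.2 ≠ 0 := by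
  constructor
  · intro hw1
    have h1 := h.of_cross hR (w' := (0, 1)) (by simp) (by simp [cross, hw1])
    have := (h0.symm hR).cross_eq_zero hR (h1.symm hR)
    simp [cross, hm] at this
  · intro hw2
    have h1 := h.of_cross hR (w' := (1, 0)) (by simp) (by simp [cross, hw2])
    have := h0.cross_eq_zero hR (h1.symm hR)
    simp [cross] at this

/-- The product of orthogonal slopes is constant: the heights of the triangle `(0, 1)`, `(-1/m',
0)`, `(-1/m, 0)` have slopes `n`, `n'` and the direction of the second axis, on which they
therefore meet. -/
theorem mul_slope_eq (h0 : VPerp R (1, 0) (0, 1)) {m n m' n' : F} (hm : m ≠ 0) (hm' : m' ≠ 0)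
    (hmm : m ≠ m') (h : VPerp R (1, m) (1, n)) (h' : VPerp R (1, m') (1, n')) :
    m * n = m' * n' := by
  have v1 : ∀ t : F, ((1, t) : F × F) ≠ 0 := fun t => by simp
  set A : F × F := (0, 1)
  set B : F × F := (-1 / m', 0)
  set C : F × F := (-1 / m, 0)
  obtain ⟨a, ha⟩ := exists_line_hasDirection B (v1 0)
  obtain ⟨b, hb⟩ := exists_line_hasDirection A (v1 m)
  obtain ⟨c, hc⟩ := exists_line_hasDirection A (v1 m')
  obtain ⟨f, hf⟩ := exists_line_hasDirection A (u := ((0 : F), 1)) (by simp)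
  obtain ⟨g, hg⟩ := exists_line_hasDirection B (v1 n)
  obtain ⟨k, hk⟩ := exists_line_hasDirection C (v1 n')
  have hCb : C ∈ b.1 := (hb.2 _).2 (by simp [cross, A, C]; field_simp; ring)
  have hBc : B ∈ c.1 := (hc.2 _).2 (by simp [cross, A, B]; field_simp; ring)
  have hCa : C ∈ a.1 := (ha.2 _).2 (by simp [cross, B, C])
  obtain ⟨H, h1, h2, h3⟩ := hR.heights (Sum.inl A) (Sum.inl B) (Sum.inl C) (Sum.inr a) (Sum.inr b)
    (Sum.inr c) (Sum.inr f) (Sum.inr g) (Sum.inr k) ⟨_, rfl⟩ ⟨_, rfl⟩ ⟨_, rfl⟩ (by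
      rw [cartesianData_coll_iff]
      simp only [cross, A, B, C, Prod.fst_sub, Prod.snd_sub]
      intro h
      field_simp at h
      exact hmm (by linear_combination h))
    (by simpa using ha.mem) (by simpa using hCa) (by simpa using hCb) (by simpa using hb.mem)
    (by simpa using hc.mem) (by simpa using hBc) (by simpa using hf.mem)
    ((perp_iff_vperp hR hf ha).2 (h0.symm hR)) (by simpa using hg.mem)
    ((perp_iff_vperp hR hg hb).2 (h.symm hR)) (by simpa using hk.mem)
    ((perp_iff_vperp hR hk hc).2 (h'.symm hR))
  obtain ⟨H, -, rfl, -⟩ := cartesianData_inc h1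
  rw [cartesianData_inc_inl_inr] at h1 h2 h3
  rw [hf.2] at h1
  rw [hg.2] at h2
  rw [hk.2] at h3
  simp only [cross, A, B, C, Prod.fst_sub, Prod.snd_sub] at h1 h2 h3
  have hH : H.1 = 0 := by linear_combination h1
  rw [hH] at h2 h3
  field_simp at h2 h3
  linear_combination m * h2 - m' * h3

/-- If the axes are orthogonal, then orthogonality is given by a diagonal bilinear form: if `κ` is
the product of orthogonal slopes, then `μ = -1 / κ`. -/
theorem exists_diagonal_form (h0 : VPerp R (1, 0) (0, 1)) :
    ∃ μ : F, μ ≠ 0 ∧ ∀ u w : F × F, u ≠ 0 → w ≠ 0 →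
      (VPerp R u w ↔ u.1 * w.1 + μ * (u.2 * w.2) = 0) := by
  have slope : ∀ m : F, m ≠ 0 → ∃ n, n ≠ 0 ∧ VPerp R (1, m) (1, n) := by
    intro m hm
    obtain ⟨w, h⟩ := exists_vperp hR (u := (1, m)) (by simp)
    have := h.slope_ne_zero hR h0 hm
    refine ⟨w.2 / w.1, div_ne_zero this.2 this.1, h.of_cross hR (by simp) ?_⟩
    simp [cross, mul_div_cancel₀ _ this.1]
  -- `κ` is the product of orthogonal slopes
  obtain ⟨κ, hκ, h1⟩ := slope 1 one_ne_zero
  have slope' : ∀ m : F, m ≠ 0 → VPerp R (1, m) (1, κ / m) := by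
    intro m hm
    obtain ⟨n, hn, h⟩ := slope m hm
    by_cases hm1 : m = 1
    · subst hm1; simpa using h1
    · have := mul_slope_eq hR h0 hm one_ne_zero hm1 h h1
      rwa [show κ / m = n by field_simp; linear_combination -this]
  refine ⟨-1 / κ, div_ne_zero (neg_ne_zero.2 one_ne_zero) hκ, fun u w hu hw => ?_⟩
  by_cases hu1 : u.1 = 0
  · have hu2 : u.2 ≠ 0 := fun h => hu (Prod.ext hu1 h)
    have h2 : VPerp R u (1, 0) := (h0.of_cross hR hu (by simp [cross, hu1])).symm hR
    rw [h2.right_iff hR hw]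
    simp [cross, hu1, hu2, hκ]
  by_cases hu2 : u.2 = 0
  · have h2 : VPerp R u (0, 1) :=
      ((h0.symm hR).of_cross hR hu (by simp [cross, hu2])).symm hR
    rw [h2.right_iff hR hw]
    simp [cross, hu1, hu2]
  have h2 : VPerp R u (1, κ / (u.2 / u.1)) :=
    (((slope' (u.2 / u.1) (div_ne_zero hu2 hu1)).symm hR).of_cross hR hu
      (by simp [cross, div_mul_cancel₀ _ hu1])).symm hR
  rw [h2.right_iff hR hw, cross]
  constructor
  · intro h
    field_simp at h ⊢
    linear_combination -h
  · intro h
    field_simp at h ⊢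
    linear_combination -h

end Form

theorem Chart.hasDirection_scale {M : Type} {D : PlaneData M} {F : Type} [Field F]
    (φ : Chart D F) {s : F} (hs : s ≠ 0) {l : {l // D.ln l}} {p u : F × F}
    (h : HasDirection (φ.lineMap l) p u) :
    HasDirection ((φ.scale s hs).lineMap l) (p.1, s * p.2) (u.1, s * u.2) := by
  refine ⟨fun h0 => h.1 ?_, fun q => ?_⟩
  · simpa [hs, Prod.ext_iff] using h0
  · obtain ⟨x, rfl⟩ := (φ.scale s hs).toEquiv.surjective q
    rw [Chart.mem_lineMap, ← φ.mem_lineMap, h.2, φ.scale_apply]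
    have : cross (((φ.toEquiv x).1, s * (φ.toEquiv x).2) - (p.1, s * p.2)) (u.1, s * u.2) =
        s * cross (φ.toEquiv x - p) u := by
      simp only [cross, Prod.fst_sub, Prod.snd_sub]; ring
    rw [this]; simp [hs]

/-- A plane with orthogonality all of whose frames have linear coordinates in algebraically closed
fields is isomorphic to a Cartesian plane with the standard orthogonality. The axes are chosen
orthogonal; then the second coordinate is rescaled by a square root. -/
theorem exists_planeIso_of_isOrthogonality {M : Type} {D : PlaneData M} (hD : D.IsAffine)
    {perp : M → M → Prop} (hO : D.IsOrthogonality perp)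
    (hf : ∀ f : (PlaneData.net hD).Frame, ∃ _ : Field f.K, IsAlgClosed f.K ∧ CharZero f.K ∧
      ∀ a p, f.proj (f.dir a) p = f.fst p + a * f.snd p) :
    ∃ (K : Type) (_ : Field K), IsAlgClosed K ∧ CharZero K ∧
      ∃ e : PlaneIso D (cartesianData K),
        ∀ l k, Perp (e.toEquiv l) (e.toEquiv k) ↔ perp l k := by
  -- the axes `x` and `y` are orthogonal lines through `O`, distinct as `x` is not self-orthogonal
  obtain ⟨O, -, -, pO, -⟩ := hD.incidence.exists_triangle
  obtain ⟨x, Ox, hx⟩ := hO.exists_not_perp_self O pO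
  have lx := (hD.incidence.of_inc _ _ Ox).2
  obtain ⟨y, hxy, Oy⟩ := hO.exists_perp O x pO lx
  have ly := (hD.incidence.of_inc _ _ Oy).2
  have nxy : x ≠ y := fun h => hx (by rwa [← h] at hxy)
  have other : ∀ l, D.ln l → ∃ E, D.inc E l ∧ O ≠ E := by
    intro l hl
    obtain ⟨E₁, E₂, hne, h1, h2⟩ := hD.incidence.exists_two l hl
    by_cases h : O = E₁
    · exact ⟨E₂, h2, h ▸ hne⟩
    · exact ⟨E₁, h1, h⟩
  obtain ⟨E, Ex, nE⟩ := other x lx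
  obtain ⟨E', Ey, nE'⟩ := other y ly
  have pE := (hD.incidence.of_inc _ _ Ex).1
  have pE' := (hD.incidence.of_inc _ _ Ey).1
  have hcoll : ¬ D.Coll O E E' := by
    rintro ⟨l, h1, h2, h3⟩
    exact nxy ((hD.incidence.join_unique O E x l nE Ox Ex h1 h2).trans
      (hD.incidence.join_unique O E' l y nE' h1 h3 Oy Ey))
  obtain ⟨f, fO, fE, fE'⟩ := PlaneData.exists_frame (hD := hD) (O := ⟨O, pO⟩) (E := ⟨E, pE⟩)
    (E' := ⟨E', pE'⟩) hcoll
  obtain ⟨_, hac, hcz, hlin⟩ := hf f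
  let φ := PlaneData.chartOfFrame f hlin
  obtain ⟨e, e1, e2⟩ := φ.exists_planeIso hD
  have hR := hO.map e hD (cartesianData_isAffine f.K)
  have h0 : VPerp (fun l k => perp (e.toEquiv.symm l) (e.toEquiv.symm k))
      ((1, 0) : f.K × f.K) (0, 1) := by
    obtain ⟨p, u, hu⟩ := exists_hasDirection (φ.lineMap ⟨x, lx⟩)
    obtain ⟨q, w, hw⟩ := exists_hasDirection (φ.lineMap ⟨y, ly⟩)
    have h1 : VPerp (fun l k => perp (e.toEquiv.symm l) (e.toEquiv.symm k)) u w := by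
      refine (perp_iff_vperp hR hu hw).1 ?_
      rwa [← e2, ← e2, Equiv.symm_apply_apply, Equiv.symm_apply_apply]
    have dir : ∀ (l : {l // D.ln l}) (p u : f.K × f.K), HasDirection (φ.lineMap l) p u →
        D.inc O l → ∀ E : {x // D.pt x}, D.inc E l →
        cross (φ.toEquiv E - φ.toEquiv f.O) u = 0 := by
      intro l p u hu hl E hE
      rw [fO, ← (hu.rebase (φ.mem_lineMap.2 hl)).2, φ.mem_lineMap]
      exact hE
    have hE := dir _ p u hu Ox f.E (by rw [fE]; exact Ex)
    have hE' := dir _ q w hw Oy f.E' (by rw [fE']; exact Ey)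
    have c1 : (φ.toEquiv f.E).2 = (φ.toEquiv f.O).2 :=
      f.snd_eq_snd_iff.2 ((PlaneData.net hD).symm f.x_OE)
    have c2 : (φ.toEquiv f.E').1 = (φ.toEquiv f.O).1 :=
      Net.Frame.fst_eq_iff.2 ((PlaneData.net hD).trans ((PlaneData.net hD).symm f.y_OE)
        (f.fst_spec f.O))
    have d1 : (φ.toEquiv f.E).1 - (φ.toEquiv f.O).1 ≠ 0 := fun h =>
      f.O_ne_E (φ.toEquiv.injective (Prod.ext (sub_eq_zero.1 h) c1)).symm
    have d2 : (φ.toEquiv f.E').2 - (φ.toEquiv f.O).2 ≠ 0 := fun h =>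
      f.O_ne_E' (φ.toEquiv.injective (Prod.ext c2 (sub_eq_zero.1 h))).symm
    have hu2 : u.2 = 0 := by simpa [cross, c1, d1] using hE
    have hw1 : w.1 = 0 := by simpa [cross, c2, d2] using hE'
    exact (((h1.of_cross hR (w' := (0, 1)) (by simp) (by simp [cross, hw1])).symm hR).of_cross hR
      (by simp) (by simp [cross, hu2])).symm hR
  obtain ⟨μ, hμ, hform⟩ := exists_diagonal_form hR h0
  -- rescaling the second coordinate by a square root of `μ` turns the form into the standard one
  obtain ⟨s, hs⟩ := IsAlgClosed.exists_pow_nat_eq μ (n := 2) two_pos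
  have hs0 : s ≠ 0 := by rintro rfl; exact hμ (by rw [← hs]; simp)
  obtain ⟨e', -, e2'⟩ := (φ.scale s hs0).exists_planeIso hD
  refine ⟨f.K, _, hac, hcz, e', fun l k => ?_⟩
  by_cases hlk : D.ln l ∧ D.ln k
  · obtain ⟨hl, hk⟩ := hlk
    obtain ⟨p, u, hu⟩ := exists_hasDirection (φ.lineMap ⟨l, hl⟩)
    obtain ⟨q, w, hw⟩ := exists_hasDirection (φ.lineMap ⟨k, hk⟩)
    have h1 := (perp_iff_vperp hR hu hw).trans (hform u w hu.1 hw.1)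
    rw [← e2, ← e2, Equiv.symm_apply_apply, Equiv.symm_apply_apply] at h1
    rw [h1, e2' ⟨l, hl⟩, e2' ⟨k, hk⟩,
      perp_inr_iff (φ.hasDirection_scale hs0 hu) (φ.hasDirection_scale hs0 hw), dot, ← hs]
    ring_nf
  · refine iff_of_false (fun h => hlk ?_) (fun h => hlk (hO.of_perp l k h))
    have := (cartesianData_isOrthogonality f.K).of_perp _ _ h
    rwa [e'.ln_iff, e'.ln_iff] at this

/-! ### Isomorphisms of structures -/

/-- Isomorphic planes are isomorphic structures, parallelism being determined by incidence. -/
theorem nonempty_parLang_equiv {M M' : Type} [parLang.Structure M] [parLang.Structure M']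
    (e : PlaneIso (planeData parLang M) (planeData parLang M'))
    (hD : (planeData parLang M).IsAffine) (hD' : (planeData parLang M').IsAffine) :
    Nonempty (M ≃[parLang] M') := by
  have hpar : ∀ {N : Type} [parLang.Structure N] (l k : N), (planeData parLang N).par l k ↔
      Structure.RelMap (L := parLang) ParRel.par ![l, k] := by
    intro N _ l k
    simp [planeData, par, PlaneVocabulary.par]
  refine ⟨⟨e.toEquiv, fun f => Empty.elim f, ?_⟩⟩
  intro n R v
  cases R with
  | point =>
    rw [show v = ![v 0] by ext i; fin_cases i; rfl,
      show e.toEquiv.toFun ∘ ![v 0] = ![e.toEquiv (v 0)] by ext i; fin_cases i; rfl]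
    exact e.pt_iff (v 0)
  | line =>
    rw [show v = ![v 0] by ext i; fin_cases i; rfl,
      show e.toEquiv.toFun ∘ ![v 0] = ![e.toEquiv (v 0)] by ext i; fin_cases i; rfl]
    exact e.ln_iff (v 0)
  | inc =>
    rw [show v = ![v 0, v 1] by ext i; fin_cases i <;> rfl,
      show e.toEquiv.toFun ∘ ![v 0, v 1] = ![e.toEquiv (v 0), e.toEquiv (v 1)] by
        ext i; fin_cases i <;> rfl]
    exact e.inc_iff (v 0) (v 1)
  | par =>
    rw [show v = ![v 0, v 1] by ext i; fin_cases i <;> rfl,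
      show e.toEquiv.toFun ∘ ![v 0, v 1] = ![e.toEquiv (v 0), e.toEquiv (v 1)] by
        ext i; fin_cases i <;> rfl]
    exact (hpar _ _).symm.trans ((e.par_iff hD hD' (v 0) (v 1)).trans (hpar _ _))

theorem nonempty_orthLang_equiv {M M' : Type} [orthLang.Structure M] [orthLang.Structure M']
    (e : PlaneIso (planeData orthLang M) (planeData orthLang M'))
    (he : ∀ l k, perpRel M' (e.toEquiv l) (e.toEquiv k) ↔ perpRel M l k) :
    Nonempty (M ≃[orthLang] M') := by
  refine ⟨⟨e.toEquiv, fun f => Empty.elim f, ?_⟩⟩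
  intro n R v
  cases R with
  | point =>
    rw [show v = ![v 0] by ext i; fin_cases i; rfl,
      show e.toEquiv.toFun ∘ ![v 0] = ![e.toEquiv (v 0)] by ext i; fin_cases i; rfl]
    exact e.pt_iff (v 0)
  | line =>
    rw [show v = ![v 0] by ext i; fin_cases i; rfl,
      show e.toEquiv.toFun ∘ ![v 0] = ![e.toEquiv (v 0)] by ext i; fin_cases i; rfl]
    exact e.ln_iff (v 0)
  | inc =>
    rw [show v = ![v 0, v 1] by ext i; fin_cases i <;> rfl,
      show e.toEquiv.toFun ∘ ![v 0, v 1] = ![e.toEquiv (v 0), e.toEquiv (v 1)] by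
        ext i; fin_cases i <;> rfl]
    exact e.inc_iff (v 0) (v 1)
  | perp =>
    rw [show v = ![v 0, v 1] by ext i; fin_cases i <;> rfl,
      show e.toEquiv.toFun ∘ ![v 0, v 1] = ![e.toEquiv (v 0), e.toEquiv (v 1)] by
        ext i; fin_cases i <;> rfl]
    exact he (v 0) (v 1)

/-- Isomorphic fields have isomorphic Cartesian planes. -/
theorem exists_planeIso_of_ringEquiv {K F : Type} [Field K] [Field F] (σ : K ≃+* F) :
    ∃ e : PlaneIso (cartesianData K) (cartesianData F),
      ∀ l k, Perp (e.toEquiv l) (e.toEquiv k) ↔ Perp l k := by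
  let τ : K × K ≃ F × F := Equiv.prodCongr σ.toEquiv σ.toEquiv
  have hτ : ∀ p, τ p = (σ p.1, σ p.2) := fun p => rfl
  have hline : ∀ s : Set (K × K),
      (∃ a b c : K, (a ≠ 0 ∨ b ≠ 0) ∧ s = {p | a * p.1 + b * p.2 + c = 0}) ↔
      ∃ a b c : F, (a ≠ 0 ∨ b ≠ 0) ∧ Equiv.Set.congr τ s = {p | a * p.1 + b * p.2 + c = 0} := by
    -- `σ` maps a line to the line whose equation has the images of the coefficients
    have key : ∀ (s : Set (K × K)) (a b c : K),
        s = {p | a * p.1 + b * p.2 + c = 0} ↔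
        Equiv.Set.congr τ s = {p | σ a * p.1 + σ b * p.2 + σ c = 0} := by
      intro s a b c
      rw [← (Equiv.Set.congr τ).apply_eq_iff_eq]
      refine Eq.congr_right (Set.ext fun q => ?_)
      obtain ⟨p, rfl⟩ := τ.surjective q
      refine (τ.injective.mem_set_image).trans ?_
      simp only [Set.mem_ofPred_eq, hτ]
      rw [← map_mul, ← map_mul, ← map_add, ← map_add, map_eq_zero_iff σ σ.injective]
    intro s
    constructor
    · rintro ⟨a, b, c, hab, h⟩
      exact ⟨σ a, σ b, σ c, by simpa using hab, (key s a b c).1 h⟩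
    · rintro ⟨a, b, c, hab, h⟩
      refine ⟨σ.symm a, σ.symm b, σ.symm c, by simpa using hab, (key s _ _ _).2 ?_⟩
      simpa using h
  let lam : CartesianLine K ≃ CartesianLine F := Equiv.subtypeEquiv (Equiv.Set.congr τ) hline
  have hlam : ∀ (p : K × K) (l : CartesianLine K), τ p ∈ (lam l).1 ↔ p ∈ l.1 :=
    fun p l => τ.injective.mem_set_image
  let e : CartesianPlane K ≃ CartesianPlane F := Equiv.sumCongr τ lam
  have hpt : ∀ p, e (Sum.inl p) = Sum.inl (τ p) := fun p => rfl
  have hln : ∀ l, e (Sum.inr l) = Sum.inr (lam l) := fun l => rfl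
  have inl_ne : ∀ {F : Type} [Field F] (p : F × F) (l : CartesianLine F),
      (Sum.inl p : CartesianPlane F) ≠ Sum.inr l := fun p l => Sum.inl_ne_inr
  refine ⟨⟨e, ?_, ?_, ?_⟩, ?_⟩
  · rintro (p | l)
    · exact iff_of_true ⟨_, rfl⟩ ⟨_, rfl⟩
    · exact iff_of_false (fun ⟨p, h⟩ => inl_ne _ _ h.symm) (fun ⟨p, h⟩ => inl_ne _ _ h.symm)
  · rintro (p | l)
    · exact iff_of_false (fun ⟨p, h⟩ => inl_ne _ _ h) (fun ⟨p, h⟩ => inl_ne _ _ h)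
    · exact iff_of_true ⟨_, rfl⟩ ⟨_, rfl⟩
  · rintro (p | l) (q | k)
    · exact iff_of_false (fun ⟨_, _, _, h, _⟩ => inl_ne _ _ h) (fun ⟨_, _, _, h, _⟩ => inl_ne _ _ h)
    · exact (cartesianData_inc_inl_inr _ _).trans
        ((hlam p k).trans (cartesianData_inc_inl_inr _ _).symm)
    · exact iff_of_false (fun ⟨_, _, h, _⟩ => inl_ne _ _ h.symm)
        (fun ⟨_, _, h, _⟩ => inl_ne _ _ h.symm)
    · exact iff_of_false (fun ⟨_, _, h, _⟩ => inl_ne _ _ h.symm)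
        (fun ⟨_, _, h, _⟩ => inl_ne _ _ h.symm)
  · rintro (p | l) (q | k)
    · exact iff_of_false (fun ⟨_, _, h, _⟩ => inl_ne _ _ h) (fun ⟨_, _, h, _⟩ => inl_ne _ _ h)
    · exact iff_of_false (fun ⟨_, _, h, _⟩ => inl_ne _ _ h) (fun ⟨_, _, h, _⟩ => inl_ne _ _ h)
    · exact iff_of_false (fun ⟨_, _, _, h, _⟩ => inl_ne _ _ h) (fun ⟨_, _, _, h, _⟩ => inl_ne _ _ h)
    · have perp_inr : ∀ {F : Type} [Field F] (l k : CartesianLine F),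
          Perp (Sum.inr l : CartesianPlane F) (Sum.inr k) ↔
          ∀ p ∈ l.1, ∀ q ∈ l.1, ∀ r ∈ k.1, ∀ s ∈ k.1,
            (q.1 - p.1) * (s.1 - r.1) + (q.2 - p.2) * (s.2 - r.2) = 0 := by
        intro F _ l k
        obtain ⟨p, u, hl⟩ := exists_hasDirection l
        obtain ⟨q, w, hk⟩ := exists_hasDirection k
        rw [perp_inr_iff hl hk, hl.perp_iff hk]
      refine (perp_inr (lam l) (lam k)).trans (Iff.trans ?_ (perp_inr l k).symm)
      simp only [τ.surjective.forall, hlam]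
      simp only [hτ, ← map_sub, ← map_mul, ← map_add, map_eq_zero_iff σ σ.injective]

/-! ### Categoricity -/

open Cardinal

theorem mk_cartesianPlane (K : Type) [Field K] [Infinite K] : #(CartesianPlane K) = #K := by
  classical
  apply le_antisymm
  · let g : (K × K) ⊕ (K × K × K) → CartesianPlane K := fun x => match x with
      | Sum.inl p => Sum.inl p
      | Sum.inr (a, b, c) => if h : a ≠ 0 ∨ b ≠ 0 then
          Sum.inr ⟨{p | a * p.1 + b * p.2 + c = 0}, a, b, c, h, rfl⟩ else Sum.inl 0
    have hg : Function.Surjective g := by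
      rintro (p | ⟨s, a, b, c, h, rfl⟩)
      · exact ⟨Sum.inl p, rfl⟩
      · exact ⟨Sum.inr (a, b, c), dif_pos h⟩
    refine (mk_le_of_surjective hg).trans ?_
    simp
  · exact mk_le_of_injective (f := fun x : K => (Sum.inl (x, 0) : CartesianPlane K))
      fun x y h => congrArg Prod.fst (Sum.inl_injective h)

/-- A theory true in the complex plane, all of whose models are Cartesian planes over algebraically
closed fields of characteristic zero, axiomatizes the complete theory of the complex plane: by
Steinitz' theorem it has one model of cardinality `𝔠`, and the Łoś–Vaught test applies. -/
theorem mem_completeTheory_iff_models {L : FirstOrder.Language.{0, 0}}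
    [∀ (K : Type) [Field K], L.Structure (CartesianPlane K)] (T : L.Theory)
    (hL : L.card ≤ ℵ₀) (hT : CartesianPlane ℂ ⊨ T)
    (hmap : ∀ (K F : Type) [Field K] [Field F], (K ≃+* F) →
      Nonempty (CartesianPlane K ≃[L] CartesianPlane F))
    (hmodel : ∀ (M : Type) [L.Structure M], M ⊨ T → ∃ (K : Type) (_ : Field K),
      IsAlgClosed K ∧ CharZero K ∧ Nonempty (M ≃[L] CartesianPlane K)) (φ : L.Sentence) :
    φ ∈ L.completeTheory (CartesianPlane ℂ) ↔ T ⊨ᵇ φ := by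
  have hiso : ∀ M : T.ModelType, #M = 𝔠 → Nonempty (M ≃[L] CartesianPlane ℂ) := by
    intro M hM
    obtain ⟨K, _, _, _, ⟨e⟩⟩ := hmodel M M.is_model
    have : Infinite K := IsAlgClosed.instInfinite
    have hK : #K = 𝔠 := by rw [← mk_cartesianPlane, ← hM]; exact (mk_congr e.toEquiv).symm
    obtain ⟨σ⟩ := IsAlgClosed.ringEquiv_of_equiv_of_charZero (K := K) (L := ℂ)
      (by rw [hK]; exact aleph0_lt_continuum) (Cardinal.eq.1 (hK.trans mk_complex.symm))
    obtain ⟨e'⟩ := hmap K ℂ σ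
    exact ⟨e'.comp e⟩
  have hcat : Categorical 𝔠 T := by
    intro M N hM hN
    obtain ⟨e⟩ := hiso M hM
    obtain ⟨e'⟩ := hiso N hN
    exact ⟨e'.symm.comp e⟩
  have hne : Nonempty (CartesianPlane ℂ) := ⟨Sum.inl 0⟩
  have hcomp : T.IsComplete := by
    refine hcat.isComplete 𝔠 T aleph0_le_continuum ?_ ⟨Theory.ModelType.of T (CartesianPlane ℂ)⟩ ?_
    · simpa using hL.trans aleph0_le_continuum
    · intro M
      obtain ⟨K, _, _, _, ⟨e⟩⟩ := hmodel M M.is_model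
      have : Infinite K := IsAlgClosed.instInfinite
      have : Infinite (CartesianPlane K) := by
        rw [infinite_iff, mk_cartesianPlane]; exact aleph0_le_mk K
      exact e.toEquiv.infinite_iff.2 this
  rw [mem_completeTheory]
  exact hcomp.realize_sentence_iff φ _

instance (n : ℕ) : Countable (ParRel n) :=
  ⟨⟨fun R => match R with
    | ParRel.point => 0
    | ParRel.line => 1
    | ParRel.inc => 0
    | ParRel.par => 1, by intro a b; cases a <;> cases b <;> simp⟩⟩

instance (n : ℕ) : Countable (OrthRel n) :=
  ⟨⟨fun R => match R with
    | OrthRel.point => 0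
    | OrthRel.line => 1
    | OrthRel.inc => 0
    | OrthRel.perp => 1, by intro a b; cases a <;> cases b <;> simp⟩⟩

theorem card_parLang_le : parLang.card ≤ ℵ₀ := by
  have : Countable parLang.Symbols :=
    inferInstanceAs (Countable ((Σ _ : ℕ, Empty) ⊕ Σ n, ParRel n))
  exact mk_le_aleph0

theorem card_orthLang_le : orthLang.card ≤ ℵ₀ := by
  have : Countable orthLang.Symbols :=
    inferInstanceAs (Countable ((Σ _ : ℕ, Empty) ⊕ Σ n, OrthRel n))
  exact mk_le_aleph0

theorem complex_model_translate {L : FirstOrder.Language.{0, 0}} [PlaneVocabulary L]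
    [LawfulPlaneVocabulary L] [L.Structure (CartesianPlane ℂ)]
    (hL : planeData L (CartesianPlane ℂ) = cartesianData ℂ) :
    CartesianPlane ℂ ⊨ translate L '' Theory.ACF 0 := by
  let _ := Ring.compatibleRingOfRing ℂ
  refine (Theory.model_iff _).2 ?_
  rintro _ ⟨σ, hσ, rfl⟩
  exact realize_translate_cartesian ℂ hL (Theory.realize_sentence_of_mem (Theory.ACF 0) hσ)

theorem complex_model_pappianParallelityPlane :
    CartesianPlane ℂ ⊨ pappianParallelityPlane := by
  simp only [pappianParallelityPlane, Theory.model_union_iff, Theory.model_singleton_iff,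
    model_incidenceAxioms_iff, model_parallelismAxioms_iff, model_uniqueParallelAxioms_iff,
    realize_pappusAxiom_iff, planeData_parLang_cartesian]
  exact ⟨⟨⟨cartesianData_isIncidence ℂ, cartesianData_isParallelism ℂ⟩,
    cartesianData_hasUniqueParallels ℂ⟩, cartesianData_pappus ℂ⟩

theorem complex_model_wuOrthogonalPlane : CartesianPlane ℂ ⊨ wuOrthogonalPlane := by
  have hinf : CartesianPlane ℂ ⊨ Set.range (infiniteLineAxiom orthLang) := by
    refine (Theory.model_iff _).2 ?_
    rintro _ ⟨n, rfl⟩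
    refine realize_infiniteLineAxiom _ _ ?_
    rw [planeData_orthLang_cartesian]
    exact cartesianData_infinite
  have hdes : CartesianPlane ℂ ⊨
      ({desarguesParallelAxiom orthLang, desarguesConcurrentAxiom orthLang} : orthLang.Theory) := by
    rw [Theory.model_insert_iff, Theory.model_singleton_iff, realize_desarguesParallelAxiom_iff,
      realize_desarguesConcurrentAxiom_iff, planeData_orthLang_cartesian]
    exact ⟨cartesianData_desarguesParallel ℂ, cartesianData_desarguesConcurrent ℂ⟩
  simp only [wuOrthogonalPlane, Theory.model_union_iff, model_incidenceAxioms_iff,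
    model_orthogonalityAxioms_iff, model_uniqueParallelAxioms_iff, planeData_orthLang_cartesian]
  exact ⟨⟨⟨⟨cartesianData_isIncidence ℂ, cartesianData_isOrthogonality ℂ⟩, hinf⟩,
    cartesianData_hasUniqueParallels ℂ⟩, hdes⟩

/-! ### Models are Cartesian planes -/

/-- The models of the theory of the parallelity plane are Cartesian planes: the coordinates of any
frame are a chart by `Net.Frame.proj_dir_of_pappus`. -/
theorem exists_equiv_of_pappian (M : Type) [parLang.Structure M]
    (hM : M ⊨ pappianParallelityPlane ∪ translate parLang '' Theory.ACF 0) :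
    ∃ (K : Type) (_ : Field K), IsAlgClosed K ∧ CharZero K ∧
      Nonempty (M ≃[parLang] CartesianPlane K) := by
  obtain ⟨hP, hT⟩ := Theory.model_union_iff.1 hM
  simp only [pappianParallelityPlane, Theory.model_union_iff, Theory.model_singleton_iff,
    model_incidenceAxioms_iff, model_parallelismAxioms_iff, model_uniqueParallelAxioms_iff,
    realize_pappusAxiom_iff] at hP
  obtain ⟨⟨⟨hI, hPar⟩, hU⟩, hPap⟩ := hP
  have hD := PlaneData.isAffine_of_isParallelism hI (exists_line_of_translate hT) hU hPar
  obtain ⟨O, E, E', pO, pE, pE', hc⟩ := hI.exists_triangle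
  obtain ⟨f, -⟩ := PlaneData.exists_frame (hD := hD) (O := ⟨O, pO⟩) (E := ⟨E, pE⟩)
    (E' := ⟨E', pE'⟩) hc
  obtain ⟨_, h1, h2, hf⟩ := exists_field_of_translate hT f
  obtain ⟨e, -⟩ := (PlaneData.chartOfFrame f (Net.Frame.proj_dir_of_pappus hf hPap.net
    two_ne_zero)).exists_planeIso hD
  refine ⟨f.K, _, h1, h2, ?_⟩
  rw [← planeData_parLang_cartesian] at e
  refine nonempty_parLang_equiv e hD ?_
  rw [planeData_parLang_cartesian]
  exact cartesianData_isAffine f.K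

/-- The models of the theory of the orthogonal plane are Cartesian planes with the standard
orthogonality. -/
theorem exists_equiv_of_wu (M : Type) [orthLang.Structure M]
    (hM : M ⊨ wuOrthogonalPlane ∪ translate orthLang '' Theory.ACF 0) :
    ∃ (K : Type) (_ : Field K), IsAlgClosed K ∧ CharZero K ∧
      Nonempty (M ≃[orthLang] CartesianPlane K) := by
  obtain ⟨hP, hT⟩ := Theory.model_union_iff.1 hM
  simp only [wuOrthogonalPlane, Theory.model_union_iff, Theory.model_insert_iff,
    model_incidenceAxioms_iff, model_orthogonalityAxioms_iff, model_uniqueParallelAxioms_iff,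
    realize_desarguesParallelAxiom_iff] at hP
  obtain ⟨⟨⟨⟨hI, hO⟩, -⟩, hU⟩, hDes, -⟩ := hP
  have hD : (planeData orthLang M).IsAffine :=
    ⟨hI, exists_line_of_translate hT, hU, planeData_orthLang_par_iff M⟩
  obtain ⟨K, _, h1, h2, e, he⟩ := exists_planeIso_of_isOrthogonality hD hO fun f => by
    obtain ⟨hF, h1, h2, hf⟩ := exists_field_of_translate hT f
    exact ⟨hF, h1, h2, Net.Frame.proj_dir_of_desargues hf hDes.net⟩
  refine ⟨K, _, h1, h2, ?_⟩
  -- abstracting the plane data makes rewriting possible, as the type of `e` depends on them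
  have key : ∀ D, D = cartesianData K → ∃ e : PlaneIso (planeData orthLang M) D,
      ∀ l k, Perp (e.toEquiv l) (e.toEquiv k) ↔ perpRel M l k := by
    rintro _ rfl
    exact ⟨e, he⟩
  obtain ⟨e, he⟩ := key _ (planeData_orthLang_cartesian K)
  exact nonempty_orthLang_equiv e he

theorem nonempty_parLang_equiv_of_ringEquiv (K F : Type) [Field K] [Field F] (σ : K ≃+* F) :
    Nonempty (CartesianPlane K ≃[parLang] CartesianPlane F) := by
  obtain ⟨e, -⟩ := exists_planeIso_of_ringEquiv σ
  have hK := cartesianData_isAffine K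
  have hF := cartesianData_isAffine F
  rw [← planeData_parLang_cartesian] at e hK hF
  rw [← planeData_parLang_cartesian] at e
  exact nonempty_parLang_equiv e hK hF

theorem nonempty_orthLang_equiv_of_ringEquiv (K F : Type) [Field K] [Field F] (σ : K ≃+* F) :
    Nonempty (CartesianPlane K ≃[orthLang] CartesianPlane F) := by
  have key : ∀ D D', D = cartesianData K → D' = cartesianData F → ∃ e : PlaneIso D D',
      ∀ l k, Perp (e.toEquiv l) (e.toEquiv k) ↔ Perp l k := by
    rintro _ _ rfl rfl
    exact exists_planeIso_of_ringEquiv σ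
  obtain ⟨e, he⟩ := key _ _ (planeData_orthLang_cartesian K) (planeData_orthLang_cartesian F)
  exact nonempty_orthLang_equiv e he

end AffineGeometry

theorem mainTheorem1 :
    (∀ φ : AffineGeometry.parLang.Sentence,
      φ ∈ AffineGeometry.parLang.completeTheory (AffineGeometry.CartesianPlane ℂ) ↔
        AffineGeometry.pappianParallelityPlane ∪
          AffineGeometry.translate AffineGeometry.parLang '' Theory.ACF 0 ⊨ᵇ φ) ∧
    (∀ φ : AffineGeometry.orthLang.Sentence,
      φ ∈ AffineGeometry.orthLang.completeTheory (AffineGeometry.CartesianPlane ℂ) ↔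
        AffineGeometry.wuOrthogonalPlane ∪
          AffineGeometry.translate AffineGeometry.orthLang '' Theory.ACF 0 ⊨ᵇ φ) := by
  open AffineGeometry in
  constructor
  · refine mem_completeTheory_iff_models _ card_parLang_le ?_
      nonempty_parLang_equiv_of_ringEquiv exists_equiv_of_pappian
    exact Theory.model_union_iff.2 ⟨complex_model_pappianParallelityPlane,
      complex_model_translate (planeData_parLang_cartesian ℂ)⟩
  · refine mem_completeTheory_iff_models _ card_orthLang_le ?_
      nonempty_orthLang_equiv_of_ringEquiv exists_equiv_of_wu
    exact Theory.model_union_iff.2 ⟨complex_model_wuOrthogonalPlane,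
      complex_model_translate (planeData_orthLang_cartesian ℂ)⟩
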